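/- Let a perfect matching-cut of a finite simple graph $G=(V,E)$ be a perfect matching $M\subseteq E$ such that the graph $G-M=(V,E\setminus M)$ is not connected. There is an algorithm that, given the adjacency matrix of a nonempty bipartite graph $G=(V,E)$ with $\operatorname{diam}(G)\le 3$ (where the diameter of a disconnected graph is $\infty$, so that $G$ is connected), decides whether $G$ has a perfect matching-cut in time $O(|V|^{9/2})$, hence in polynomial time. Here time is the number of steps of a random access machine with words of $O(\log |V|)$ bits, in which comparisons, additions, subtractions, multiplications and indirect memory accesses cost one step each: there are a fixed program and constants $C,K$ such that on every such $G$ the program halts with the correct answer after at most $C|V|^{9/2}$ steps and writes no number larger than $K|V|^K$. -/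

import Mathlib

/-- `G` has a perfect matching-cut: a perfect matching `M` such that `G - M` (same vertices, the
edges of `M` deleted) is not connected. -/
def SimpleGraph.HasPerfectMatchingCut {V : Type*} (G : SimpleGraph V) : Prop :=
  ∃ M : G.Subgraph, M.IsPerfectMatching ∧ ¬ (G.deleteEdges M.edgeSet).Connected

/-!
A unit-cost word RAM. A machine has registers and a random access memory, both holding natural
numbers. Programs are built from three-address instructions by sequencing, branching and looping;
such a program is a RAM program with structured jumps. A program mentions only finitely many
registers, and its text does not depend on the input.
-/

namespace WordRAM

/-- The content of the registers and of the memory. -/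
structure State where
  reg : ℕ → ℕ
  mem : ℕ → ℕ

/-- Elementary instructions; the arguments are register numbers, except `k` in `const i k`. -/
inductive Instr where
  /-- `rᵢ := k` -/
  | const (i k : ℕ)
  /-- `rᵢ := rⱼ` -/
  | move (i j : ℕ)
  /-- `rᵢ := rⱼ + rₖ` -/
  | add (i j k : ℕ)
  /-- `rᵢ := max (rⱼ - rₖ) 0` -/
  | sub (i j k : ℕ)
  /-- `rᵢ := rⱼ * rₖ` -/
  | mul (i j k : ℕ)
  /-- `rᵢ := mem[rⱼ]` -/
  | load (i j : ℕ)
  /-- `mem[rᵢ] := rⱼ` -/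
  | store (i j : ℕ)

/-- Comparisons of two registers. -/
inductive Test where
  /-- `rᵢ < rⱼ` -/
  | lt (i j : ℕ)
  /-- `rᵢ = rⱼ` -/
  | eq (i j : ℕ)

/-- Programs. -/
inductive Prog where
  | instr (a : Instr)
  | seq (p q : Prog)
  | ite (b : Test) (p q : Prog)
  | loop (b : Test) (p : Prog)

/-- The state with `v` written to register `i`. -/
def State.setReg (s : State) (i v : ℕ) : State := ⟨Function.update s.reg i v, s.mem⟩

/-- The number that an instruction writes (to a register or to a memory cell). -/
def Instr.value (s : State) : Instr → ℕ
  | .const _ k => k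
  | .move _ j => s.reg j
  | .add _ j k => s.reg j + s.reg k
  | .sub _ j k => s.reg j - s.reg k
  | .mul _ j k => s.reg j * s.reg k
  | .load _ j => s.mem (s.reg j)
  | .store _ j => s.reg j

/-- The state after an instruction. -/
def Instr.apply (s : State) : Instr → State
  | .store i j => ⟨s.reg, Function.update s.mem (s.reg i) (s.reg j)⟩
  | .const i k => s.setReg i (Instr.value s (.const i k))
  | .move i j => s.setReg i (Instr.value s (.move i j))
  | .add i j k => s.setReg i (Instr.value s (.add i j k))
  | .sub i j k => s.setReg i (Instr.value s (.sub i j k))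
  | .mul i j k => s.setReg i (Instr.value s (.mul i j k))
  | .load i j => s.setReg i (Instr.value s (.load i j))

/-- The truth value of a comparison. -/
def Test.Holds (s : State) : Test → Prop
  | .lt i j => s.reg i < s.reg j
  | .eq i j => s.reg i = s.reg j

/-- `Exec W p s t s'`: started in the state `s`, the program `p` halts in the state `s'` after
exactly `t` steps, and no number written on the way exceeds `W`. Every executed instruction and
every evaluated test is one step. If a number larger than `W` would be written, or if the program
does not halt, then there are no such `t` and `s'`. -/
inductive Exec (W : ℕ) : Prog → State → ℕ → State → Prop
  | instr (a : Instr) (s : State) (h : a.value s ≤ W) : Exec W (.instr a) s 1 (a.apply s)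
  | seq {p q : Prog} {s s' s'' : State} {t u : ℕ}
      (hp : Exec W p s t s') (hq : Exec W q s' u s'') : Exec W (.seq p q) s (t + u) s''
  | ite_true {b : Test} {p q : Prog} {s s' : State} {t : ℕ} (hb : b.Holds s)
      (hp : Exec W p s t s') : Exec W (.ite b p q) s (1 + t) s'
  | ite_false {b : Test} {p q : Prog} {s s' : State} {t : ℕ} (hb : ¬ b.Holds s)
      (hq : Exec W q s t s') : Exec W (.ite b p q) s (1 + t) s'
  | loop_true {b : Test} {p : Prog} {s s' s'' : State} {t u : ℕ} (hb : b.Holds s)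
      (hp : Exec W p s t s') (hl : Exec W (.loop b p) s' u s'') :
      Exec W (.loop b p) s (1 + t + u) s''
  | loop_false {b : Test} {p : Prog} {s : State} (hb : ¬ b.Holds s) : Exec W (.loop b p) s 1 s

open Classical in
/-- The initial state for a graph on the vertices `0, …, n - 1`: register `0` holds `n`, the
memory cells `0, …, n² - 1` hold the adjacency matrix row by row, and everything else is `0`. -/
noncomputable def encode {n : ℕ} (G : SimpleGraph (Fin n)) : State where
  reg i := if i = 0 then n else 0
  mem m := if ∃ i j : Fin n, G.Adj i j ∧ m = (i : ℕ) * n + (j : ℕ) then 1 else 0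

/-- `P` decides the graph property `Q` on the class `𝒞` of graphs in time `T`, where `T` may
depend on the number `n` of vertices, with words of `O(log n)` bits: on every nonempty graph of the
class it halts after at most `T n` steps, having written only numbers that are at most `K * n ^ K`
for a fixed `K`, with the answer `1` (yes) or `0` (no) in register `0`. Outside the class nothing
is required. -/
def Decides (P : Prog) (𝒞 Q : ∀ n : ℕ, SimpleGraph (Fin n) → Prop) (T : ℕ → ℝ) : Prop :=
  ∃ K : ℕ, ∀ (n : ℕ) (G : SimpleGraph (Fin n)), 0 < n → 𝒞 n G →
    ∃ (t : ℕ) (s : State), Exec (K * n ^ K) P (encode G) t s ∧ (t : ℝ) ≤ T n ∧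
      (Q n G → s.reg 0 = 1) ∧ (¬ Q n G → s.reg 0 = 0)

end WordRAM

set_option linter.unusedSimpArgs false

/-! A perfect matching-cut is the same as a perfect matching `m` together with a nonconstant
2-colouring all of whose bichromatic edges belong to `m`. In a bipartite graph of diameter at most 3
any two vertices of the same side have a common neighbour (`common_neighbour`). This is all that is
used of the diameter.

A vertex whose mate has its own colour has only neighbours of that colour. If both classes contained
a matching edge, suitable ends of the two edges would lie on the same side and have a common
neighbour, which is absurd. So two kinds of cuts remain (`cut_cases`).

First kind: all vertices of one class `P` are matched into the other class, which contains a
matching edge `u w`. Neither `u` nor `w` has a neighbour in `P`. For `r` in `P`, let `C` be the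
component of `r` after removal of the closed neighbourhoods of `u` and `w`. It stays inside `P`: if
an edge leaves `P` from `b` in `C`, a common neighbour of `b` and the one of `u`, `w` on its side
must be the other end of that edge, which is therefore removed. Hence the edges leaving `C` form a
matching that covers `C`, and the kernel, that is, the vertices outside `C` without neighbours in
`C`, is matched within itself. Conversely, such a `C` and a perfect matching of its kernel give a
cut (`hasCut_of_valid`). The search runs over `u`, `w` and the components. A valid component is the
same for all choices of `u`, `w` in its kernel (`Valid.cp_eq`), so the matching test is run for the
least choice only. Then the products of the sizes of the two kernel sides add up to at most `n ^ 3`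
(`sum_testCost_le`). An auction decides each matching problem in time `O(n)` per unit of this sum,
up to lower terms, so `O(n ^ 4)` suffices.

Second kind: all matching edges are bichromatic, so each vertex has exactly one neighbour of the
other colour. If `y` is the mate of `0`, `q` another neighbour of `0` and `x` the mate of `q`, then
guessing `y` and `x` colours so many vertices that every uncoloured one sees both colours
(`init_nb`). Two rounds of forcing leave at most eight vertices uncoloured (`card_uncoloured`), and
these are tried exhaustively. There are `O(n ^ 2)` guesses at `O(n ^ 2)` steps each.

The answer `1` is only given on a certificate, so soundness does not depend on the search being
guided correctly. The program is written in a small language with a verified compiler, and its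
running time is a component of the state about which invariants may speak. Altogether it takes `O(n
^ 4)` steps, which is below the required bound. -/

namespace PMCut
open WordRAM

/-! A small structured language with variables, unboundedly indexed arrays and read access to the
adjacency matrix, its compilation to the word RAM, and a weakest precondition calculus in which
the running time is a ghost component of the state. -/

/-- Abstract states: variables, arrays and elapsed time. -/
structure St where
  v : ℕ → ℕ
  a : ℕ → ℕ → ℕ
  t : ℕ

/-- Expressions. -/
inductive Ex where
  | c (k : ℕ)
  | v (x : ℕ)
  | add (e f : Ex)
  | sub (e f : Ex)
  | get (b : ℕ) (e : Ex)
  | adj (e f : Ex)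

/-- Conditions. -/
inductive Cn where
  | lt (e f : Ex)
  | eq (e f : Ex)

/-- Commands. -/
inductive Cmd where
  | skip
  | set (x : ℕ) (e : Ex)
  | put (b : ℕ) (e f : Ex)
  | seq (p q : Cmd)
  | ite (b : Cn) (p q : Cmd)
  | loop (x y : ℕ) (p : Cmd)

infixr:60 " ;; " => Cmd.seq

/-- One-armed conditional. -/
def Cmd.when (b : Cn) (p : Cmd) : Cmd := .ite b p .skip

/-- Run `p` for all values of the variable `x` below that of the variable `0`. -/
def Cmd.for (x : ℕ) (p : Cmd) : Cmd :=
  .set x (.c 0) ;; .loop x 0 (p ;; .set x (.add (.v x) (.c 1)))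

/-! ### Semantics with cost, and weakest preconditions. -/

section Semantics

open Classical in
/-- The value of an expression. -/
noncomputable def Ex.eval (A : ℕ → ℕ → Prop) (w : ℕ → ℕ) (a : ℕ → ℕ → ℕ) : Ex → ℕ
  | .c k => k
  | .v x => w x
  | .add e f => e.eval A w a + f.eval A w a
  | .sub e f => e.eval A w a - f.eval A w a
  | .get b e => a b (e.eval A w a)
  | .adj e f => if A (e.eval A w a) (f.eval A w a) then 1 else 0

/-- The number of machine steps needed to evaluate an expression. -/
def Ex.cost : Ex → ℕ
  | .c _ => 1
  | .v _ => 1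
  | .add e f => e.cost + f.cost + 1
  | .sub e f => e.cost + f.cost + 1
  | .get _ e => e.cost + 7
  | .adj e f => e.cost + f.cost + 3

/-- The bounds that guarantee that the machine evaluates an expression correctly. -/
def Ex.Ok (n : ℕ) (A : ℕ → ℕ → Prop) (w : ℕ → ℕ) (a : ℕ → ℕ → ℕ) : Ex → Prop
  | .c k => k ≤ n + 9
  | .v _ => True
  | .add e f => e.Ok n A w a ∧ f.Ok n A w a ∧ e.eval A w a + f.eval A w a ≤ n + 9
  | .sub e f => e.Ok n A w a ∧ f.Ok n A w a
  | .get b e => e.Ok n A w a ∧ b < 16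
  | .adj e f => e.Ok n A w a ∧ f.Ok n A w a ∧ e.eval A w a < n ∧ f.eval A w a < n

/-- The truth value of a condition. -/
def Cn.Holds (A : ℕ → ℕ → Prop) (w : ℕ → ℕ) (a : ℕ → ℕ → ℕ) : Cn → Prop
  | .lt e f => e.eval A w a < f.eval A w a
  | .eq e f => e.eval A w a = f.eval A w a

/-- The number of machine steps needed to evaluate a condition. -/
def Cn.cost : Cn → ℕ
  | .lt e f => e.cost + f.cost + 1
  | .eq e f => e.cost + f.cost + 1

/-- The bounds that guarantee that the machine evaluates a condition correctly. -/
def Cn.Ok (n : ℕ) (A : ℕ → ℕ → Prop) (w : ℕ → ℕ) (a : ℕ → ℕ → ℕ) : Cn → Prop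
  | .lt e f => e.Ok n A w a ∧ f.Ok n A w a
  | .eq e f => e.Ok n A w a ∧ f.Ok n A w a

/-- Weakest preconditions (total correctness). -/
def wp (n : ℕ) (A : ℕ → ℕ → Prop) : Cmd → (St → Prop) → St → Prop
  | .skip, Q, σ => Q ⟨σ.v, σ.a, σ.t + 1⟩
  | .set x e, Q, σ => x ≠ 0 ∧ e.Ok n A σ.v σ.a ∧
      Q ⟨Function.update σ.v x (e.eval A σ.v σ.a), σ.a, σ.t + (e.cost + 1)⟩
  | .put b e f, Q, σ => b < 16 ∧ e.Ok n A σ.v σ.a ∧ f.Ok n A σ.v σ.a ∧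
      Q ⟨σ.v, Function.update σ.a b
        (Function.update (σ.a b) (e.eval A σ.v σ.a) (f.eval A σ.v σ.a)),
        σ.t + (e.cost + f.cost + 7)⟩
  | .seq p q, Q, σ => wp n A p (wp n A q Q) σ
  | .ite b p q, Q, σ => b.Ok n A σ.v σ.a ∧
      (b.Holds A σ.v σ.a → wp n A p Q ⟨σ.v, σ.a, σ.t + b.cost⟩) ∧
      (¬ b.Holds A σ.v σ.a → wp n A q Q ⟨σ.v, σ.a, σ.t + b.cost⟩)
  -- Assignments to variable `0` are forbidden, so at each loop test `τ.v 0 = n` may be assumed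
  -- without being part of the invariant.
  | .loop x y p, Q, σ => ∃ (I : St → Prop) (m : St → ℕ), I σ ∧
      (∀ τ, I τ → τ.v 0 = n → τ.v x < τ.v y →
        wp n A p (fun τ' => I τ' ∧ m τ' < m τ) ⟨τ.v, τ.a, τ.t + 1⟩) ∧
      (∀ τ, I τ → τ.v 0 = n → ¬ τ.v x < τ.v y → Q ⟨τ.v, τ.a, τ.t + 1⟩)

variable {n : ℕ} {A : ℕ → ℕ → Prop}

theorem wp_mono {p : Cmd} {Q R : St → Prop} (h : ∀ σ, Q σ → R σ) {σ : St}
    (hp : wp n A p Q σ) : wp n A p R σ := by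
  induction p generalizing Q R σ with
  | skip => exact h _ hp
  | set x e => exact ⟨hp.1, hp.2.1, h _ hp.2.2⟩
  | put b e f => exact ⟨hp.1, hp.2.1, hp.2.2.1, h _ hp.2.2.2⟩
  | seq p q ihp ihq => exact ihp (fun σ hσ => ihq h hσ) hp
  | ite b p q ihp ihq =>
    exact ⟨hp.1, fun hb => ihp h (hp.2.1 hb), fun hb => ihq h (hp.2.2 hb)⟩
  | loop x y p ih =>
    obtain ⟨I, m, h0, h1, h2⟩ := hp
    exact ⟨I, m, h0, h1, fun τ a b c => h _ (h2 τ a b c)⟩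

end Semantics

/-! ### Compilation to the word RAM and its correctness. -/

section Compilation

/-- Code that turns the index in register `2 * k + 1` into the address of a cell of array `b`. -/
def addrCode (k b : ℕ) : Prog :=
  .seq (.instr (.const (2 * k + 3) 16))
    (.seq (.instr (.mul (2 * k + 1) (2 * k + 1) (2 * k + 3)))
    (.seq (.instr (.mul (2 * k + 3) 0 0))
    (.seq (.instr (.add (2 * k + 1) (2 * k + 1) (2 * k + 3)))
    (.seq (.instr (.const (2 * k + 3) b))
    (.instr (.add (2 * k + 1) (2 * k + 1) (2 * k + 3)))))))

/-- Code that puts the value of an expression into the temporary register `2 * k + 1`. -/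
def Ex.code (k : ℕ) : Ex → Prog
  | .c j => .instr (.const (2 * k + 1) j)
  | .v x => .instr (.move (2 * k + 1) (2 * x))
  | .add e f => .seq (e.code k) (.seq (f.code (k + 1))
      (.instr (.add (2 * k + 1) (2 * k + 1) (2 * k + 3))))
  | .sub e f => .seq (e.code k) (.seq (f.code (k + 1))
      (.instr (.sub (2 * k + 1) (2 * k + 1) (2 * k + 3))))
  | .get b e => .seq (e.code k) (.seq (addrCode k b) (.instr (.load (2 * k + 1) (2 * k + 1))))
  | .adj e f => .seq (e.code k) (.seq (f.code (k + 1))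
      (.seq (.instr (.mul (2 * k + 1) (2 * k + 1) 0))
      (.seq (.instr (.add (2 * k + 1) (2 * k + 1) (2 * k + 3)))
      (.instr (.load (2 * k + 1) (2 * k + 1))))))

/-- The compiler. -/
def Cmd.code : Cmd → Prog
  -- Register `1` is a temporary, so this write is harmless and only costs a step.
  | .skip => .instr (.const 1 0)
  | .set x e => .seq (e.code 0) (.instr (.move (2 * x) 1))
  -- The address stays in register `1` while `f` is evaluated one level higher.
  | .put b e f => .seq (e.code 0) (.seq (addrCode 0 b) (.seq (f.code 1) (.instr (.store 1 3))))
  | .seq p q => .seq p.code q.code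
  | .ite (.lt e f) p q => .seq (e.code 0) (.seq (f.code 1) (.ite (.lt 1 3) p.code q.code))
  | .ite (.eq e f) p q => .seq (e.code 0) (.seq (f.code 1) (.ite (.eq 1 3) p.code q.code))
  | .loop x y p => .loop (.lt (2 * x) (2 * y)) p.code

variable {n W : ℕ} {A : ℕ → ℕ → Prop}

open Classical in
/-- The machine state `s` represents the variables `w` and the arrays `a`. -/
structure Rep (n : ℕ) (A : ℕ → ℕ → Prop) (s : State) (w : ℕ → ℕ) (a : ℕ → ℕ → ℕ) : Prop where
  -- Variables occupy the even registers; the odd ones serve as temporaries.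
  var : ∀ x, s.reg (2 * x) = w x
  size : w 0 = n
  adj : ∀ i j, i < n → j < n → s.mem (i * n + j) = if A i j then 1 else 0
  -- The sixteen arrays are interleaved above the matrix, so that none of them needs a declared
  -- length.
  arr : ∀ b j, b < 16 → s.mem (n * n + j * 16 + b) = a b j
  var_le : ∀ x, w x ≤ n + 9
  arr_le : ∀ b j, b < 16 → a b j ≤ n + 9

theorem Rep.eval_le {s : State} {w : ℕ → ℕ} {a : ℕ → ℕ → ℕ} (h : Rep n A s w a) {e : Ex}
    (he : e.Ok n A w a) : e.eval A w a ≤ n + 9 := by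
  induction e with
  | c k => exact he
  | v x => exact h.var_le x
  | add e f _ _ => exact he.2.2
  | sub e f ihe _ => exact (Nat.sub_le _ _).trans (ihe he.1)
  | get b e _ => exact h.arr_le _ _ he.2
  | adj e f _ _ => simp only [Ex.eval]; split_ifs <;> omega

theorem Rep.congr {s s' : State} {w : ℕ → ℕ} {a : ℕ → ℕ → ℕ} (h : Rep n A s w a)
    (hm : s'.mem = s.mem) (hr : ∀ x, s'.reg (2 * x) = s.reg (2 * x)) : Rep n A s' w a where
  var x := by rw [hr, h.var]
  size := h.size
  adj := by rw [hm]; exact h.adj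
  arr := by rw [hm]; exact h.arr
  var_le := h.var_le
  arr_le := h.arr_le

theorem exec_instr (a : Instr) (s s' : State) (h : a.value s ≤ W) (hs : a.apply s = s') :
    Exec W (.instr a) s 1 s' := hs ▸ Exec.instr a s h

/-- An index is itself a stored value, hence at most `n + 9`. This keeps all intermediate results of
the address computation below the bound in `hW`. -/
theorem exec_addr (hW : n * n + (n + 9) * 16 + 16 ≤ W) (s : State) (k b i : ℕ) (hb : b < 16)
    (hi : i ≤ n + 9) (h0 : s.reg 0 = n) (h1 : s.reg (2 * k + 1) = i) :
    Exec W (addrCode k b) s 6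
      ⟨Function.update (Function.update s.reg (2 * k + 3) b) (2 * k + 1) (n * n + i * 16 + b),
        s.mem⟩ := by
  have key : Exec W (addrCode k b) s (1 + (1 + (1 + (1 + (1 + 1))))) _ :=
    Exec.seq (Exec.instr _ _ ?_) (Exec.seq (Exec.instr _ _ ?_)
      (Exec.seq (Exec.instr _ _ ?_) (Exec.seq (Exec.instr _ _ ?_)
      (Exec.seq (Exec.instr _ _ ?_) (Exec.instr _ _ ?_)))))
  · convert key using 1
    simp only [Instr.value, Instr.apply, State.setReg, State.mk.injEq, and_true]
    funext y
    have e1 : (0 : ℕ) ≠ 2 * k + 1 := by omega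
    have e2 : (0 : ℕ) ≠ 2 * k + 3 := by omega
    simp only [Function.update_apply, h0, h1, if_neg e1, if_neg e2, if_true,
      show 2 * k + 1 ≠ 2 * k + 3 by omega, show 2 * k + 3 ≠ 2 * k + 1 by omega, if_false]
    split_ifs <;> first | rfl | omega
  all_goals simp [Instr.value, Instr.apply, State.setReg, Function.update_apply, h0, h1]
  all_goals nlinarith

/-- Evaluation of expressions by the compiled code. -/
theorem Rep.exec_ex {w : ℕ → ℕ} {a : ℕ → ℕ → ℕ}
    (hW : n * n + (n + 9) * 16 + 16 ≤ W) (e : Ex) :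
    ∀ {s : State} (_ : Rep n A s w a) (_ : e.Ok n A w a) (k : ℕ),
    ∃ s', Exec W (e.code k) s e.cost s' ∧ s'.mem = s.mem ∧
      s'.reg (2 * k + 1) = e.eval A w a ∧
      (∀ x, s'.reg (2 * x) = s.reg (2 * x)) ∧ ∀ j, j < k → s'.reg (2 * j + 1) = s.reg (2 * j + 1) := by
  -- The odd registers act as a stack: evaluation at level `k` leaves those below `2 * k + 1` alone.
  have upd : ∀ (s : State) (k y : ℕ), (∀ x, (s.setReg (2 * k + 1) y).reg (2 * x) = s.reg (2 * x)) ∧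
      (∀ j, j < k → (s.setReg (2 * k + 1) y).reg (2 * j + 1) = s.reg (2 * j + 1)) ∧
      (s.setReg (2 * k + 1) y).reg (2 * k + 1) = y ∧ (s.setReg (2 * k + 1) y).mem = s.mem := by
    intro s k y
    refine ⟨fun x => ?_, fun j hj => ?_, ?_, rfl⟩
    · exact Function.update_of_ne (by omega) _ _
    · exact Function.update_of_ne (by omega) _ _
    · exact Function.update_self _ _ _
  induction e with
  | c j =>
    intro s h he k
    obtain ⟨h1, h2, h3, h4⟩ := upd s k j
    refine ⟨_, Exec.instr _ _ ?_, h4, h3, h1, h2⟩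
    simp only [Ex.Ok] at he
    simp only [Instr.value]; nlinarith
  | v x =>
    intro s h he k
    obtain ⟨h1, h2, h3, h4⟩ := upd s k (s.reg (2 * x))
    refine ⟨_, Exec.instr _ _ ?_, h4, h3.trans (h.var x), h1, h2⟩
    have := h.var_le x
    have := h.var x
    simp only [Instr.value]; nlinarith
  | add e f ihe ihf =>
    intro s h he k
    obtain ⟨s1, e1, m1, r1, x1, j1⟩ := ihe h he.1 k
    obtain ⟨s2, e2, m2, r2, x2, j2⟩ := ihf (h.congr m1 x1) he.2.1 (k + 1)
    obtain ⟨h1, h2, h3, h4⟩ := upd s2 k (s2.reg (2 * k + 1) + s2.reg (2 * k + 3))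
    have hk := j2 k (by omega)
    have hv : s2.reg (2 * k + 1) + s2.reg (2 * k + 3) = e.eval A w a + f.eval A w a := by
      rw [hk, r1, ← r2]; rfl
    refine ⟨s2.setReg (2 * k + 1) (s2.reg (2 * k + 1) + s2.reg (2 * k + 3)),
      ?_, h4.trans (m2.trans m1), h3.trans hv,
      fun x => (h1 x).trans ((x2 x).trans (x1 x)), fun j hj => (h2 j hj).trans
        ((j2 j (by omega)).trans (j1 j hj))⟩
    have h9 := he.2.2
    have := Exec.seq e1 (Exec.seq e2 (exec_instr (W := W) (.add (2 * k + 1) (2 * k + 1) (2 * k + 3)) s2 _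
      (by simp only [Instr.value]; nlinarith) rfl))
    rwa [← Nat.add_assoc] at this
  | sub e f ihe ihf =>
    intro s h he k
    obtain ⟨s1, e1, m1, r1, x1, j1⟩ := ihe h he.1 k
    obtain ⟨s2, e2, m2, r2, x2, j2⟩ := ihf (h.congr m1 x1) he.2 (k + 1)
    obtain ⟨h1, h2, h3, h4⟩ := upd s2 k (s2.reg (2 * k + 1) - s2.reg (2 * k + 3))
    have hk := j2 k (by omega)
    have hv : s2.reg (2 * k + 1) - s2.reg (2 * k + 3) = e.eval A w a - f.eval A w a := by
      rw [hk, r1, ← r2]; rfl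
    refine ⟨s2.setReg (2 * k + 1) (s2.reg (2 * k + 1) - s2.reg (2 * k + 3)),
      ?_, h4.trans (m2.trans m1), h3.trans hv,
      fun x => (h1 x).trans ((x2 x).trans (x1 x)), fun j hj => (h2 j hj).trans
        ((j2 j (by omega)).trans (j1 j hj))⟩
    have h9 := h.eval_le he.1
    have h10 : e.eval A w a - f.eval A w a ≤ e.eval A w a := Nat.sub_le _ _
    have := Exec.seq e1 (Exec.seq e2 (exec_instr (W := W) (.sub (2 * k + 1) (2 * k + 1) (2 * k + 3)) s2 _
      (by simp only [Instr.value]; nlinarith) rfl))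
    rwa [← Nat.add_assoc] at this
  | get b e ihe =>
    intro s h he k
    obtain ⟨s1, e1, m1, r1, x1, j1⟩ := ihe h he.1 k
    have h1 := h.congr m1 x1
    have hev := h.eval_le he.1
    set i := e.eval A w a with hi
    have h0 : s1.reg 0 = n := by simpa [h.size] using h1.var 0
    have ha := h1.arr b i he.2
    have hal := h.arr_le b i he.2
    have hb := he.2
    have e2 := exec_addr hW s1 k b i hb hev h0 r1
    have e3 : Exec W (.instr (.load (2 * k + 1) (2 * k + 1)))
        ⟨Function.update (Function.update s1.reg (2 * k + 3) b) (2 * k + 1) (n * n + i * 16 + b),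
        s1.mem⟩ 1 ⟨Function.update (Function.update (Function.update s1.reg (2 * k + 3) b)
          (2 * k + 1) (n * n + i * 16 + b)) (2 * k + 1) (a b i), s1.mem⟩ := by
      refine exec_instr _ _ _ ?_ ?_
      · simp only [Instr.value, Function.update_self, ha]; omega
      · simp only [Instr.value, Instr.apply, State.setReg, Function.update_self, ha]
    refine ⟨_, Exec.seq e1 (Exec.seq e2 e3), m1, ?_, ?_, ?_⟩
    · simp [Ex.eval, hi]
    · intro x
      simp only [Function.update_apply]
      rw [if_neg (by omega), if_neg (by omega), if_neg (by omega)]; exact x1 x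
    · intro x hx
      simp only [Function.update_apply]
      rw [if_neg (by omega), if_neg (by omega), if_neg (by omega)]; exact j1 x hx
  | adj e f ihe ihf =>
    intro s h he k
    obtain ⟨s1, e1, m1, r1, x1, j1⟩ := ihe h he.1 k
    obtain ⟨s2, e2, m2, r2, x2, j2⟩ := ihf (h.congr m1 x1) he.2.1 (k + 1)
    have hk := (j2 k (by omega)).trans r1
    have h2 := (h.congr m1 x1).congr m2 x2
    have h0 : s2.reg 0 = n := by simpa [h.size] using h2.var 0
    have hx := he.2.2.1
    have hy := he.2.2.2
    set i := e.eval A w a with hi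
    set j := f.eval A w a with hj
    have r2' : s2.reg (2 * k + 3) = j := r2
    have ha := h2.adj i j hx hy
    have hin : i * n + n ≤ n * n := by nlinarith
    have h1 : n * n + 25 ≤ W := by omega
    classical
    have h1W : (if A i j then 1 else 0) ≤ W := by split_ifs <;> omega
    have e3 : Exec W (.seq (.instr (.mul (2 * k + 1) (2 * k + 1) 0))
        (.seq (.instr (.add (2 * k + 1) (2 * k + 1) (2 * k + 3)))
        (.instr (.load (2 * k + 1) (2 * k + 1))))) s2 (1 + (1 + 1))
        ⟨Function.update s2.reg (2 * k + 1) (if A i j then 1 else 0), s2.mem⟩ := by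
      refine Exec.seq (exec_instr _ _ _ ?_ rfl) (Exec.seq (exec_instr _ _ _ ?_ rfl)
        (exec_instr _ _ _ ?_ ?_))
      all_goals
        simp [Instr.value, Instr.apply, State.setReg, h0, hk, r2', ha]
      all_goals omega
    have e4 := Exec.seq e1 (Exec.seq e2 e3)
    rw [← Nat.add_assoc] at e4
    refine ⟨_, e4, m2.trans m1, ?_, ?_, ?_⟩
    · simp [Ex.eval, hi, hj]
    · intro x
      simp only [Function.update_apply]
      rw [if_neg (by omega)]; exact (x2 x).trans (x1 x)
    · intro x hx
      simp only [Function.update_apply]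
      rw [if_neg (by omega)]; exact (j2 x (by omega)).trans (j1 x hx)

/-- A condition is evaluated by evaluating its two sides. -/
theorem Rep.exec_pair {w : ℕ → ℕ} {a : ℕ → ℕ → ℕ}
    (hW : n * n + (n + 9) * 16 + 16 ≤ W) (e f : Ex)
    {s : State} (h : Rep n A s w a) (he : e.Ok n A w a) (hf : f.Ok n A w a) :
    ∃ s1 s2, Exec W (e.code 0) s e.cost s1 ∧ Exec W (f.code 1) s1 f.cost s2 ∧ Rep n A s2 w a ∧
      s2.reg 1 = e.eval A w a ∧ s2.reg 3 = f.eval A w a := by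
  obtain ⟨s1, e1, m1, r1, x1, j1⟩ := h.exec_ex hW e he 0
  obtain ⟨s2, e2, m2, r2, x2, j2⟩ := (h.congr m1 x1).exec_ex hW f hf 1
  exact ⟨s1, s2, e1, e2, (h.congr m1 x1).congr m2 x2, (j2 0 (by omega)).trans r1, r2⟩

/-- Soundness of the weakest precondition calculus. -/
theorem wp_sound (hW : n * n + (n + 9) * 16 + 16 ≤ W) (p : Cmd) :
    ∀ {Q : St → Prop} {σ : St} {s : State} (_ : Rep n A s σ.v σ.a) (_ : wp n A p Q σ),
    ∃ t s' σ', Exec W p.code s t s' ∧ Rep n A s' σ'.v σ'.a ∧ σ'.t = σ.t + t ∧ Q σ' := by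
  induction p with
  | skip =>
    intro Q σ s h hp
    refine ⟨1, _, ⟨σ.v, σ.a, σ.t + 1⟩, Exec.instr _ _ (Nat.zero_le _), h.congr rfl fun x => ?_,
      rfl, hp⟩
    exact Function.update_of_ne (by omega) _ _
  | set x e =>
    intro Q σ s h hp
    obtain ⟨hx, he, hQ⟩ := hp
    obtain ⟨s1, e1, m1, r1, x1, j1⟩ := h.exec_ex hW e he 0
    have h1 := h.congr m1 x1
    have hl := h.eval_le he
    refine ⟨_, _, _, Exec.seq e1 (Exec.instr _ _ ?_), ?_, rfl, hQ⟩
    · simp only [Instr.value]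
      simp only [Nat.mul_zero, Nat.zero_add] at r1
      rw [r1]; nlinarith
    · simp only [Nat.mul_zero, Nat.zero_add] at r1
      simp only [Instr.apply, Instr.value, State.setReg, r1]
      constructor
      · intro y
        simp only [Function.update_apply]
        by_cases hy : y = x
        · simp [hy]
        · rw [if_neg (by omega), if_neg hy]; exact h1.var y
      · rw [Function.update_of_ne hx.symm]; exact h.size
      · exact h1.adj
      · exact h1.arr
      · intro y
        simp only [Function.update_apply]
        split_ifs
        · exact hl
        · exact h.var_le y
      · exact h.arr_le
  | put b e f =>
    intro Q σ s h hp
    obtain ⟨hb, he, hf, hQ⟩ := hp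
    obtain ⟨s1, e1, m1, r1, x1, j1⟩ := h.exec_ex hW e he 0
    have h1 := h.congr m1 x1
    have hl := h.eval_le he
    have hlf := h.eval_le hf
    have h0 : s1.reg 0 = n := by simpa [h.size] using h1.var 0
    simp only [Nat.mul_zero, Nat.zero_add] at r1
    set i := e.eval A σ.v σ.a with hi
    have hs2 : Rep n A ⟨Function.update (Function.update s1.reg 3 b) 1 (n * n + i * 16 + b), s1.mem⟩
        σ.v σ.a := h1.congr rfl fun x => by
      simp only [Function.update_apply]; rw [if_neg (by omega), if_neg (by omega)]
    obtain ⟨s3, e3, m3, r3, x3, j3⟩ := hs2.exec_ex hW f hf 1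
    have j3' : s3.reg 1 = n * n + i * 16 + b := by
      simpa using j3 0 (by omega)
    have r3' : s3.reg 3 = f.eval A σ.v σ.a := r3
    have e2 := exec_addr hW s1 0 b i hb hl h0 r1
    refine ⟨e.cost + (6 + (f.cost + 1)), _, _, Exec.seq e1 (Exec.seq e2
      (Exec.seq e3 (Exec.instr _ _ ?_))), ?_, ?_, hQ⟩
    · simp only [Instr.value, r3']; nlinarith
    · simp only [Instr.apply, j3', r3']
      have h3 := hs2.congr m3 x3
      constructor
      · exact h3.var
      · exact h.size
      · intro x y hx hy
        have : x * n + n ≤ n * n := by nlinarith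
        simp only
        rw [Function.update_of_ne (by omega)]
        exact h3.adj x y hx hy
      · intro c j hc
        simp only
        by_cases hcb : c = b
        · subst hcb
          rw [Function.update_self]
          by_cases hj : j = i
          · subst hj; rw [Function.update_self, Function.update_self]
          · rw [Function.update_of_ne (by omega), Function.update_of_ne hj]
            exact h3.arr c j hc
        · rw [Function.update_of_ne hcb, Function.update_of_ne (by omega)]
          exact h3.arr c j hc
      · exact h.var_le
      · intro c j hc
        by_cases hcb : c = b
        · subst hcb
          rw [Function.update_self, Function.update_apply]
          split_ifs
          · exact hlf
          · exact h.arr_le c j hc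
        · rw [Function.update_of_ne hcb]; exact h.arr_le c j hc
    · simp only; omega
  | seq p q ihp ihq =>
    intro Q σ s h hp
    obtain ⟨t, s', σ', e1, h1, t1, hq⟩ := ihp h hp
    obtain ⟨u, s'', σ'', e2, h2, t2, hQ⟩ := ihq h1 hq
    exact ⟨t + u, s'', σ'', Exec.seq e1 e2, h2, by omega, hQ⟩
  | ite b p q ihp ihq =>
    intro Q σ s h hp
    obtain ⟨hb, hp, hq⟩ := hp
    cases b with
    | lt e f =>
      obtain ⟨s1, s2, e1, e2, h2, r1, r2⟩ := h.exec_pair hW e f hb.1 hb.2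
      by_cases hc : e.eval A σ.v σ.a < f.eval A σ.v σ.a
      · obtain ⟨t, s', σ', e3, h3, t3, hQ⟩ := ihp (σ := ⟨σ.v, σ.a, σ.t + Cn.cost (.lt e f)⟩) h2 (hp hc)
        refine ⟨_, s', σ', Exec.seq e1 (Exec.seq e2 (Exec.ite_true ?_ e3)), h3, ?_, hQ⟩
        · simpa [Test.Holds, r1, r2] using hc
        · rw [t3]; simp only [Cn.cost]; omega
      · obtain ⟨t, s', σ', e3, h3, t3, hQ⟩ := ihq (σ := ⟨σ.v, σ.a, σ.t + Cn.cost (.lt e f)⟩) h2 (hq hc)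
        refine ⟨_, s', σ', Exec.seq e1 (Exec.seq e2 (Exec.ite_false ?_ e3)), h3, ?_, hQ⟩
        · simpa [Test.Holds, r1, r2] using hc
        · rw [t3]; simp only [Cn.cost]; omega
    | eq e f =>
      obtain ⟨s1, s2, e1, e2, h2, r1, r2⟩ := h.exec_pair hW e f hb.1 hb.2
      by_cases hc : e.eval A σ.v σ.a = f.eval A σ.v σ.a
      · obtain ⟨t, s', σ', e3, h3, t3, hQ⟩ := ihp (σ := ⟨σ.v, σ.a, σ.t + Cn.cost (.eq e f)⟩) h2 (hp hc)
        refine ⟨_, s', σ', Exec.seq e1 (Exec.seq e2 (Exec.ite_true ?_ e3)), h3, ?_, hQ⟩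
        · simpa [Test.Holds, r1, r2] using hc
        · rw [t3]; simp only [Cn.cost]; omega
      · obtain ⟨t, s', σ', e3, h3, t3, hQ⟩ := ihq (σ := ⟨σ.v, σ.a, σ.t + Cn.cost (.eq e f)⟩) h2 (hq hc)
        refine ⟨_, s', σ', Exec.seq e1 (Exec.seq e2 (Exec.ite_false ?_ e3)), h3, ?_, hQ⟩
        · simpa [Test.Holds, r1, r2] using hc
        · rw [t3]; simp only [Cn.cost]; omega
  | loop x y p ih =>
    intro Q σ s h hp
    obtain ⟨I, m, h0, h1, h2⟩ := hp
    -- The outer induction runs over programs; the iterations of one loop need an inner induction on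
    -- its measure.
    induction hm : m σ using Nat.strong_induction_on generalizing σ s with
    | _ k ihk =>
    by_cases hc : σ.v x < σ.v y
    · obtain ⟨t, s', σ', e3, h3, t3, hI, hlt⟩ :=
        ih (σ := ⟨σ.v, σ.a, σ.t + 1⟩) h (h1 σ h0 h.size hc)
      obtain ⟨u, s'', σ'', e4, h4, t4, hQ⟩ := ihk _ (hm ▸ hlt) h3 hI rfl
      refine ⟨_, s'', σ'', Exec.loop_true ?_ e3 e4, h4, ?_, hQ⟩
      · simpa [Test.Holds, h.var] using hc
      · rw [t4, t3]; simp only; omega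
    · refine ⟨1, s, ⟨σ.v, σ.a, σ.t + 1⟩, Exec.loop_false ?_, h, rfl, h2 σ h0 h.size hc⟩
      simpa [Test.Holds, h.var] using hc

end Compilation

end PMCut

/-! ### Proof rules for the language, and the computation of the sides. -/

namespace PMCut

section Rules
variable {n : ℕ} {A : ℕ → ℕ → Prop}

@[simp] theorem wp_skip (Q : St → Prop) (w a t) :
    wp n A .skip Q ⟨w, a, t⟩ ↔ Q ⟨w, a, t + 1⟩ := Iff.rfl

@[simp] theorem wp_set (Q : St → Prop) (x e w a t) :
    wp n A (.set x e) Q ⟨w, a, t⟩ ↔ x ≠ 0 ∧ e.Ok n A w a ∧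
      Q ⟨Function.update w x (e.eval A w a), a, t + (e.cost + 1)⟩ := Iff.rfl

@[simp] theorem wp_put (Q : St → Prop) (b e f w a t) :
    wp n A (.put b e f) Q ⟨w, a, t⟩ ↔ b < 16 ∧ e.Ok n A w a ∧ f.Ok n A w a ∧
      Q ⟨w, Function.update a b (Function.update (a b) (e.eval A w a) (f.eval A w a)),
        t + (e.cost + f.cost + 7)⟩ := Iff.rfl

@[simp] theorem wp_seq (Q : St → Prop) (p q σ) :
    wp n A (p ;; q) Q σ ↔ wp n A p (wp n A q Q) σ := Iff.rfl

@[simp] theorem wp_ite (Q : St → Prop) (b p q w a t) :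
    wp n A (.ite b p q) Q ⟨w, a, t⟩ ↔ b.Ok n A w a ∧
      (b.Holds A w a → wp n A p Q ⟨w, a, t + b.cost⟩) ∧
      (¬ b.Holds A w a → wp n A q Q ⟨w, a, t + b.cost⟩) := Iff.rfl

@[simp] theorem wp_when (Q : St → Prop) (b p w a t) :
    wp n A (.when b p) Q ⟨w, a, t⟩ ↔ b.Ok n A w a ∧
      (b.Holds A w a → wp n A p Q ⟨w, a, t + b.cost⟩) ∧
      (¬ b.Holds A w a → Q ⟨w, a, t + b.cost + 1⟩) := Iff.rfl

attribute [simp] Ex.eval Ex.Ok Ex.cost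

@[simp] theorem Cn.lt_holds (e f : Ex) (w a) :
    (Cn.lt e f).Holds A w a ↔ e.eval A w a < f.eval A w a := Iff.rfl

@[simp] theorem Cn.eq_holds (e f : Ex) (w a) :
    (Cn.eq e f).Holds A w a ↔ e.eval A w a = f.eval A w a := Iff.rfl

@[simp] theorem Cn.lt_ok (e f : Ex) (w a) :
    (Cn.lt e f).Ok n A w a ↔ e.Ok n A w a ∧ f.Ok n A w a := Iff.rfl

@[simp] theorem Cn.eq_ok (e f : Ex) (w a) :
    (Cn.eq e f).Ok n A w a ↔ e.Ok n A w a ∧ f.Ok n A w a := Iff.rfl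

@[simp] theorem Cn.lt_cost (e f : Ex) : (Cn.lt e f).cost = e.cost + f.cost + 1 := rfl

@[simp] theorem Cn.eq_cost (e f : Ex) : (Cn.eq e f).cost = e.cost + f.cost + 1 := rfl

/-- The condition that two vertices are adjacent. -/
def Cn.adj (e f : Ex) : Cn := .lt (.c 0) (.adj e f)

@[simp] theorem Cn.adj_holds (e f : Ex) (w a) :
    (Cn.adj e f).Holds A w a ↔ A (e.eval A w a) (f.eval A w a) := by
  simp only [Cn.adj, Cn.lt_holds, Ex.eval]
  split_ifs with h <;> simp [h]

@[simp] theorem Cn.adj_ok (e f : Ex) (w a) : (Cn.adj e f).Ok n A w a ↔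
    e.Ok n A w a ∧ f.Ok n A w a ∧ e.eval A w a < n ∧ f.eval A w a < n := by
  simp [Cn.adj]

@[simp] theorem Cn.adj_cost (e f : Ex) : (Cn.adj e f).cost = e.cost + f.cost + 5 := by
  simp [Cn.adj]; omega

/-- Loop rule with an invariant that may speak about the time. -/
theorem wp_for {x : ℕ} {p : Cmd} {Q : St → Prop} {w : ℕ → ℕ} {a : ℕ → ℕ → ℕ} {t : ℕ}
    (hx : x ≠ 0) (I : ℕ → St → Prop)
    -- The constants are machine costs: 2 steps reset the counter, 1 evaluates the test, 4 increment
    -- the counter.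
    (h0 : I 0 ⟨Function.update w x 0, a, t + 2⟩)
    (hs : ∀ i w a t, i < n → w 0 = n → w x = i → I i ⟨w, a, t⟩ →
      wp n A p (fun τ => τ.v x = i ∧ I (i + 1) ⟨Function.update τ.v x (i + 1), τ.a, τ.t + 4⟩)
        ⟨w, a, t + 1⟩)
    (hQ : ∀ w a t, w 0 = n → w x = n → I n ⟨w, a, t⟩ → Q ⟨w, a, t + 1⟩) :
    wp n A (.for x p) Q ⟨w, a, t⟩ := by
  simp only [Cmd.for, wp_seq, wp_set, Ex.Ok, Ex.eval, Ex.cost]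
  refine ⟨hx, Nat.zero_le _, ⟨fun τ => τ.v x ≤ n ∧ I (τ.v x) τ, fun τ => n - τ.v x, ?_, ?_, ?_⟩⟩
  · simpa using h0
  · rintro ⟨w, a, t⟩ ⟨h1, h2⟩ h3 h4
    simp only at h1 h2 h3 h4
    rw [h3] at h4
    refine (wp_seq _ _ _ _).2 (wp_mono ?_ (hs (w x) w a t h4 h3 rfl h2))
    rintro ⟨w', a', t'⟩ ⟨h5, h6⟩
    simp only at h5 h6
    simp only [wp_set, Ex.Ok, Ex.eval, Ex.cost, h5, Function.update_self]
    exact ⟨hx, ⟨trivial, by omega, by omega⟩, ⟨by omega, h6⟩, by omega⟩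
  · rintro ⟨w, a, t⟩ ⟨h1, h2⟩ h3 h4
    simp only at h1 h2 h3 h4
    have h5 : w x = n := by omega
    exact hQ w a t h3 h5 (h5 ▸ h2)

/-- Loop rule with a time bound for each iteration. -/
theorem wp_for_sum {x : ℕ} {p : Cmd} {Q : St → Prop} {w : ℕ → ℕ} {a : ℕ → ℕ → ℕ} {t : ℕ}
    (hx : x ≠ 0) (I : ℕ → (ℕ → ℕ) → (ℕ → ℕ → ℕ) → Prop) (D : ℕ → ℕ)
    (hI : ∀ i w a y, I i w a → I i (Function.update w x y) a)
    (h0 : I 0 w a)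
    (hs : ∀ i w a t, i < n → w 0 = n → w x = i → I i w a →
      wp n A p (fun τ => τ.v x = i ∧ I (i + 1) τ.v τ.a ∧ τ.t ≤ t + D i) ⟨w, a, t⟩)
    -- The 5 pays for test and increment of an iteration, the 3 for the initialisation and the final
    -- test.
    (hQ : ∀ w a t', w 0 = n → w x = n → I n w a →
      t' ≤ t + ∑ i ∈ Finset.range n, (D i + 5) + 3 → Q ⟨w, a, t'⟩) :
    wp n A (.for x p) Q ⟨w, a, t⟩ := by
  refine wp_for hx
    (fun i τ => I i τ.v τ.a ∧ τ.t ≤ t + ∑ j ∈ Finset.range i, (D j + 5) + 2) ?_ ?_ ?_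
  · exact ⟨hI _ _ _ _ h0, by simp⟩
  · rintro i w a t hi hw hwx ⟨h1, h2⟩
    refine wp_mono ?_ (hs i w a (t + 1) hi hw hwx h1)
    rintro ⟨w', a', t'⟩ ⟨h3, h4, h5⟩
    refine ⟨h3, hI _ _ _ _ h4, ?_⟩
    rw [Finset.sum_range_succ]
    simp only at h2 h5 ⊢
    omega
  · rintro w a t' h1 h2 ⟨h3, h4⟩
    exact hQ w a _ h1 h2 h3 (by simp only at h4; omega)

/-- Loop rule with a uniform time bound for the iterations. -/
theorem wp_for_const {x : ℕ} {p : Cmd} {Q : St → Prop} {w : ℕ → ℕ} {a : ℕ → ℕ → ℕ} {t : ℕ}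
    (hx : x ≠ 0) (I : ℕ → (ℕ → ℕ) → (ℕ → ℕ → ℕ) → Prop) (D : ℕ)
    (hI : ∀ i w a y, I i w a → I i (Function.update w x y) a)
    (h0 : I 0 w a)
    (hs : ∀ i w a t, i < n → w 0 = n → w x = i → I i w a →
      wp n A p (fun τ => τ.v x = i ∧ I (i + 1) τ.v τ.a ∧ τ.t ≤ t + D) ⟨w, a, t⟩)
    (hQ : ∀ w a t', w 0 = n → w x = n → I n w a → t' ≤ t + n * (D + 5) + 3 → Q ⟨w, a, t'⟩) :
    wp n A (.for x p) Q ⟨w, a, t⟩ :=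
  wp_for_sum hx I (fun _ => D) hI h0 hs fun w a t' h1 h2 h3 h4 =>
    hQ w a t' h1 h2 h3 (by simpa using h4)

/-- Outside of the variables `L` and the arrays `M` nothing has changed. -/
structure Fr (L M : List ℕ) (w : ℕ → ℕ) (a : ℕ → ℕ → ℕ) (w' : ℕ → ℕ) (a' : ℕ → ℕ → ℕ) : Prop where
  var : ∀ y, y ∉ L → w' y = w y
  arr : ∀ b, b ∉ M → a' b = a b

variable {L M L' M' : List ℕ} {w w' w'' : ℕ → ℕ} {a a' a'' : ℕ → ℕ → ℕ}

theorem Fr.rfl : Fr L M w a w a := ⟨fun _ _ => .refl _, fun _ _ => .refl _⟩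

theorem Fr.trans (h : Fr L M w a w' a') (h' : Fr L M w' a' w'' a'') : Fr L M w a w'' a'' :=
  ⟨fun y hy => (h'.var y hy).trans (h.var y hy), fun y hy => (h'.arr y hy).trans (h.arr y hy)⟩

theorem Fr.mono (h : Fr L M w a w' a') (hL : L ⊆ L') (hM : M ⊆ M') : Fr L' M' w a w' a' :=
  ⟨fun y hy => h.var y fun h => hy (hL h), fun y hy => h.arr y fun h => hy (hM h)⟩

theorem Fr.set {x k : ℕ} (h : Fr L M w a w' a') (hx : x ∈ L) :
    Fr L M w a (Function.update w' x k) a' :=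
  ⟨fun y hy => by
    rw [Function.update_of_ne (by rintro rfl; exact hy hx)]; exact h.var y hy, h.arr⟩

theorem Fr.put {b : ℕ} {c : ℕ → ℕ} (h : Fr L M w a w' a') (hx : b ∈ M) :
    Fr L M w a w' (Function.update a' b c) :=
  ⟨h.var, fun y hy => by
    rw [Function.update_of_ne (by rintro rfl; exact hy hx)]; exact h.arr y hy⟩

end Rules

/-- Compute the sides of the bipartition: array `0` holds `1` for the vertices on the side of
vertex `0`, and `0` for the others. -/
def sideCmd : Cmd :=
  .for 7 (.set 10 (.c 0) ;;
    .for 8 (.when (.adj (.c 0) (.v 8)) (.when (.adj (.v 8) (.v 7)) (.set 10 (.c 1)))) ;;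
    .put 0 (.v 7) (.v 10)) ;;
  -- The loop finds the vertices two steps away from `0`; it would miss `0` itself if `0` had no
  -- neighbour, as for `n = 1`.
  .put 0 (.c 0) (.c 1)

variable {n : ℕ} {A : ℕ → ℕ → Prop}

theorem sideCmd_spec (hn : 0 < n) {w a t} {Q : St → Prop}
    (hQ : ∀ w' a' t', Fr [7, 8, 10] [0] w a w' a' →
      (∀ v < n, a' 0 v ≤ 1 ∧ (a' 0 v = 1 ↔ v = 0 ∨ ∃ z < n, A 0 z ∧ A z v)) →
      t' ≤ t + 50 * (n * n) + 100 * n + 100 → Q ⟨w', a', t'⟩) :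
    wp n A sideCmd Q ⟨w, a, t⟩ := by
  refine wp_for_const (by decide) (fun i w' a' => Fr [7, 8, 10] [0] w a w' a' ∧
    ∀ v < i, a' 0 v ≤ 1 ∧ (a' 0 v = 1 ↔ ∃ z < n, A 0 z ∧ A z v)) (50 * n + 50) ?_ ?_ ?_ ?_
  · exact fun i w a y h => ⟨h.1.set (by decide), h.2⟩
  · exact ⟨Fr.rfl, by simp⟩
  · rintro v w1 a1 t1 hv hn1 hv7 ⟨hF, h1⟩
    simp only [wp_seq, wp_set, Ex.Ok, Ex.eval, Ex.cost]
    refine ⟨by decide, by omega, ?_⟩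
    refine wp_for_const (by decide) (fun i w' a' => Fr [8, 10] [] w1 a1 w' a' ∧
      w' 10 ≤ 1 ∧ (w' 10 = 1 ↔ ∃ z < i, A 0 z ∧ A z v)) 40 ?_ ?_ ?_ ?_
    · rintro i w a y ⟨h, h2⟩
      exact ⟨h.set (by decide), by simpa using h2⟩
    · exact ⟨Fr.rfl.set (by decide), by simp⟩
    · rintro z w2 a2 t2 hz hn2 hz8 ⟨hF2, h10, h11⟩
      have h7 := hF2.var 7 (by decide)
      rw [hv7] at h7
      simp [hz8, h7, hv, hz, hn, Nat.exists_lt_succ_right, -Order.lt_add_one_iff, h10, h11, hF2]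
      grind [hF2.set]
    · rintro w2 a2 t2 hn2 hz8 ⟨hF2, h10, h11⟩ ht
      have h7 := hF2.var 7 (by decide)
      rw [hv7] at h7
      have h0 := hF2.arr 0 (by decide)
      simp [h7]
      refine ⟨⟨(hF.trans (hF2.mono (by decide) (by decide))).put (by decide), fun u hu => ?_⟩,
        by linarith⟩
      rw [Function.update_apply]
      split_ifs with huv
      · exact huv ▸ ⟨h10, h11⟩
      · rw [h0]
        exact h1 u (by omega)
  · rintro w1 a1 t1 hn1 - ⟨hF, h1⟩ ht
    simp
    refine hQ _ _ _ (hF.put (by decide)) (fun u hu => ?_) (by linarith)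
    simp [Function.update_apply]
    split_ifs with h
    · simp [h]
    · simpa [h] using h1 u hu

end PMCut

/-! ### Cuts of the first kind: valid components and canonical triples. -/

namespace PMCut
open Relation

/-- A bipartite graph on `{0, …, n - 1}` with one side given by `s`, in which any two vertices of
the same side have a common neighbour. -/
structure BG (n : ℕ) (A : ℕ → ℕ → Prop) (s : ℕ → Prop) : Prop where
  symm : ∀ {i j}, A i j → A j i
  lt : ∀ {i j}, A i j → i < n
  bip : ∀ {i j}, A i j → (s i ↔ ¬ s j)
  common : ∀ {i j}, i < n → j < n → i ≠ j → (s i ↔ s j) → ∃ z, A i z ∧ A z j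

/-- `m` is a perfect matching that contains all edges between different classes of the
nonconstant colouring `a`. -/
structure IsCut (n : ℕ) (A : ℕ → ℕ → Prop) (m a : ℕ → ℕ) : Prop where
  adj : ∀ v < n, A v (m v)
  inv : ∀ v < n, m (m v) = v
  cross : ∀ {u v}, A u v → a u ≠ a v → m u = v
  nonconst : ∃ p < n, ∃ q < n, a p ≠ a q

/-- The existence of a perfect matching-cut. -/
def HasCut (n : ℕ) (A : ℕ → ℕ → Prop) : Prop := ∃ m a, IsCut n A m a

variable {n : ℕ} {A : ℕ → ℕ → Prop} {s : ℕ → Prop}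

theorem BG.lt' (B : BG n A s) {i j : ℕ} (h : A i j) : j < n := B.lt (B.symm h)

/-- This allows a matching to be described by cases as a relation. The mate function arises by
choice, with a junk value at numbers that are not vertices. -/
theorem HasCut.of_rel {R : ℕ → ℕ → Prop} {a : ℕ → ℕ} (hR : ∀ {u v}, R u v → R v u)
    (hA : ∀ {u v}, R u v → A u v) (hu : ∀ u < n, ∃! v, R u v)
    (hc : ∀ {u v}, A u v → a u ≠ a v → R u v) (hlt : ∀ {u v}, A u v → u < n)
    (hn : ∃ p < n, ∃ q < n, a p ≠ a q) : HasCut n A := by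
  have : ∀ u, ∃ v, u < n → R u v := fun u => by
    by_cases h : u < n
    · obtain ⟨v, hv, -⟩ := hu u h
      exact ⟨v, fun _ => hv⟩
    · exact ⟨0, fun h' => absurd h' h⟩
  choose m hm using this
  refine ⟨m, a, fun v hv => hA (hm v hv), fun v hv => ?_, fun {u v} h1 h2 => ?_, hn⟩
  · have h1 := hR (hm v hv)
    have h2 := hlt (hA h1)
    exact (hu _ h2).unique (hm _ h2) h1
  · exact (hu u (hlt h1)).unique (hm u (hlt h1)) (hc h1 h2)

/-- The vertices outside of the closed neighbourhoods of `u` and `w`. -/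
def Un (n : ℕ) (A : ℕ → ℕ → Prop) (u w z : ℕ) : Prop :=
  z < n ∧ z ≠ u ∧ z ≠ w ∧ ¬ A u z ∧ ¬ A w z

/-- The component of `r` in the subgraph induced by `Un n A u w`. -/
def Cp (n : ℕ) (A : ℕ → ℕ → Prop) (u w r : ℕ) : ℕ → Prop :=
  ReflTransGen (fun b c => A b c ∧ Un n A u w c) r

/-- Each vertex of `C` has exactly one neighbour outside of `C`, and each vertex outside of `C` has
at most one neighbour in `C`. -/
structure Valid (A : ℕ → ℕ → Prop) (C : ℕ → Prop) : Prop where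
  out : ∀ v, C v → ∃ z, ¬ C z ∧ A v z ∧ ∀ z', ¬ C z' → A v z' → z' = z
  inn : ∀ z v v', ¬ C z → C v → C v' → A v z → A v' z → v = v'

/-- The vertices outside of `C` without neighbours in `C`. -/
def Kp (n : ℕ) (A : ℕ → ℕ → Prop) (C : ℕ → Prop) (z : ℕ) : Prop :=
  z < n ∧ ¬ C z ∧ ∀ v, C v → ¬ A v z

/-- The component of `r` in `Un n A u w` is valid, and `u` and `w` are the least vertices of their
sides that have no neighbours in it. -/
structure Canon (n : ℕ) (A : ℕ → ℕ → Prop) (s : ℕ → Prop) (u w r : ℕ) : Prop where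
  un : Un n A u w r
  valid : Valid A (Cp n A u w r)
  left : ∀ z, Kp n A (Cp n A u w r) z → s z → u ≤ z
  right : ∀ z, Kp n A (Cp n A u w r) z → ¬ s z → w ≤ z

open Classical in
/-- The number of left vertices in `Kp`. -/
noncomputable def kx (n : ℕ) (A : ℕ → ℕ → Prop) (s C : ℕ → Prop) : ℕ :=
  Nat.count (fun z => Kp n A C z ∧ s z) n

open Classical in
/-- The number of right vertices in `Kp`. -/
noncomputable def ky (n : ℕ) (A : ℕ → ℕ → Prop) (s C : ℕ → Prop) : ℕ :=
  Nat.count (fun z => Kp n A C z ∧ ¬ s z) n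

/-- The left vertices of `Kp` can be matched into the right ones. -/
def KMatch (n : ℕ) (A : ℕ → ℕ → Prop) (s C : ℕ → Prop) : Prop :=
  ∃ f : ℕ → ℕ, (∀ x, Kp n A C x → s x → Kp n A C (f x) ∧ ¬ s (f x) ∧ A x (f x)) ∧
    ∀ x y, Kp n A C x → s x → Kp n A C y → s y → f x = f y → x = y

theorem Cp.un {u w r v : ℕ} (hr : Un n A u w r) (h : Cp n A u w r v) : Un n A u w v := by
  induction h with
  | refl => exact hr
  | tail _ h _ => exact h.2

theorem Cp.self (u w r : ℕ) : Cp n A u w r r := ReflTransGen.refl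

theorem Cp.symm (B : BG n A s) {u w r v : ℕ} (hr : Un n A u w r) (h : Cp n A u w r v) :
    Cp n A u w v r := by
  induction h with
  | refl => exact ReflTransGen.refl
  | @tail b c hb h ih => exact ReflTransGen.head ⟨B.symm h.1, Cp.un hr hb⟩ ih

theorem Cp.eq (B : BG n A s) {u w r v : ℕ} (hr : Un n A u w r) (h : Cp n A u w r v) :
    Cp n A u w v = Cp n A u w r := by
  funext z
  exact propext ⟨fun hz => ReflTransGen.trans h hz,
    fun hz => ReflTransGen.trans (Cp.symm B hr h) hz⟩

/-- Suppose that the neighbour `z` of `v` is outside `C`. Then it is the only such neighbour of `v`.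
A common neighbour of `v` and the kernel vertex on its side cannot lie in `C`, so it is `z`; hence
`z` is adjacent to `u` or `w`. Thus any `u`, `w` in the kernel cut `C` off at the same places. -/
theorem Valid.mem_iff (B : BG n A s) {C : ℕ → Prop} (hC : Valid A C) {u w v z : ℕ}
    (hu : Kp n A C u) (hw : Kp n A C w) (su : s u) (sw : ¬ s w) (hv : C v) (h : A v z) :
    C z ↔ Un n A u w z := by
  constructor
  · intro hz
    refine ⟨B.lt' h, ?_, ?_, fun h' => hu.2.2 z hz (B.symm h'), fun h' => hw.2.2 z hz (B.symm h')⟩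
    · rintro rfl; exact hu.2.1 hz
    · rintro rfl; exact hw.2.1 hz
  · rintro ⟨-, -, -, h3, h4⟩
    by_contra hz
    obtain ⟨o, -, -, ho⟩ := hC.out v hv
    have key : ∀ k, Kp n A C k → (s v ↔ s k) → A k z := by
      intro k hk hs
      obtain ⟨t, t1, t2⟩ := B.common (B.lt h) hk.1 (by rintro rfl; exact hk.2.1 hv) hs
      have ht : ¬ C t := fun h => hk.2.2 t h t2
      rw [ho z hz h, ← ho t ht t1]
      exact B.symm t2
    by_cases sv : s v
    · exact h3 (key u hu (by simp [sv, su]))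
    · exact h4 (key w hw (by simp [sv, sw]))

theorem Valid.un (B : BG n A s) {C : ℕ → Prop} {u w v : ℕ}
    (hu : Kp n A C u) (hw : Kp n A C w) (hv : C v) (hn : v < n) : Un n A u w v := by
  refine ⟨hn, ?_, ?_, fun h => hu.2.2 v hv (B.symm h), fun h => hw.2.2 v hv (B.symm h)⟩
  · rintro rfl; exact hu.2.1 hv
  · rintro rfl; exact hw.2.1 hv

/-- A valid component does not depend on the choice of the two vertices that define it. -/
theorem Valid.cp_eq (B : BG n A s) {u w r u' w' : ℕ} (hC : Valid A (Cp n A u w r))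
    (hu : Kp n A (Cp n A u w r) u') (hw : Kp n A (Cp n A u w r) w')
    (su : s u') (sw : ¬ s w') : Cp n A u' w' r = Cp n A u w r := by
  have key : ∀ {v z}, _ → A v z → _ := hC.mem_iff B hu hw su sw
  funext v
  refine propext ⟨fun h => ?_, fun h => ?_⟩
  · induction h with
    | refl => exact ReflTransGen.refl
    | tail _ h ih => exact (key ih h.1).2 h.2
  · have : Cp n A u w r v ∧ Cp n A u' w' r v := by
      induction h with
      | refl => exact ⟨ReflTransGen.refl, ReflTransGen.refl⟩
      | tail _ h ih =>
        have h' := ReflTransGen.tail ih.1 h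
        exact ⟨h', ReflTransGen.tail ih.2 ⟨h.1, (key ih.1 h.1).1 h'⟩⟩
    exact this.2

theorem Kp.base (B : BG n A s) {u w r : ℕ} (hr : Un n A u w r) (hu : u < n) (hw : w < n) :
    Kp n A (Cp n A u w r) u ∧ Kp n A (Cp n A u w r) w :=
  ⟨⟨hu, fun h => (Cp.un hr h).2.1 rfl, fun _ hv h => (Cp.un hr hv).2.2.2.1 (B.symm h)⟩,
    ⟨hw, fun h => (Cp.un hr h).2.2.1 rfl, fun _ hv h => (Cp.un hr hv).2.2.2.2 (B.symm h)⟩⟩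

theorem count_eq_card (p : ℕ → Prop) [DecidablePred p] (n : ℕ) :
    Nat.count p n = ((Finset.range n).filter p).card := Nat.count_eq_card_filter_range p n

open Classical in
/-- The cost of the matching test for the component of `r` in `Un n A u w`. -/
noncomputable def testCost (n : ℕ) (A : ℕ → ℕ → Prop) (s : ℕ → Prop) (u w r : ℕ) : ℕ :=
  if s u ∧ ¬ s w ∧ Canon n A s u w r then
    kx n A s (Cp n A u w r) * ky n A s (Cp n A u w r) else 0

/-- The matching tests are cheap on the whole: a component is tested only once. -/
theorem sum_testCost_le (B : BG n A s) :
    ∑ u ∈ Finset.range n, ∑ w ∈ Finset.range n, ∑ r ∈ Finset.range n, testCost n A s u w r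
      ≤ n ^ 3 := by
  classical
  let R := Finset.range n
  let T : Finset (ℕ × ℕ × ℕ) := (R ×ˢ R ×ˢ R).filter fun q => s q.1 ∧ ¬ s q.2.1 ∧
    Canon n A s q.1 q.2.1 q.2.2
  let K : ℕ × ℕ × ℕ → Finset (ℕ × ℕ) := fun q => (R.filter fun z => Kp n A (Cp n A q.1 q.2.1 q.2.2) z ∧ s z) ×ˢ
    (R.filter fun z => Kp n A (Cp n A q.1 q.2.1 q.2.2) z ∧ ¬ s z)
  have h1 : ∑ u ∈ R, ∑ w ∈ R, ∑ r ∈ R, testCost n A s u w r = ∑ q ∈ T, (K q).card := by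
    rw [Finset.sum_filter, Finset.sum_product]
    refine Finset.sum_congr rfl fun u _ => ?_
    rw [Finset.sum_product]
    refine Finset.sum_congr rfl fun w _ => Finset.sum_congr rfl fun r _ => ?_
    simp only [testCost, K, Finset.card_product, kx, ky, count_eq_card, R]
  -- The product of the kernel sides counts pairs of kernel vertices. Such a pair and the root `r`
  -- determine the component by `Valid.cp_eq`, hence its kernel, hence the least kernel vertices on
  -- the two sides, which are the first two entries of the triple.
  have h2 : (T.sigma K).card ≤ (R ×ˢ R ×ˢ R).card := by
    refine Finset.card_le_card_of_injOn (fun p => (p.2.1, p.2.2, p.1.2.2)) ?_ ?_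
    · rintro ⟨⟨u, w, r⟩, ⟨u', w'⟩⟩ h
      simp [T, K] at h ⊢
      tauto
    · rintro ⟨⟨u, w, r⟩, ⟨u1, w1⟩⟩ h ⟨⟨u', w', r'⟩, ⟨u1', w1'⟩⟩ h' he
      simp [T, K, R] at h h' he
      obtain ⟨rfl, rfl, rfl⟩ := he
      have c := h.1.2.2.2
      have c' := h'.1.2.2.2
      have e1 := c.valid.cp_eq B h.2.1.2.1 h.2.2.2.1 h.2.1.2.2 h.2.2.2.2
      have e2 := c'.valid.cp_eq B h'.2.1.2.1 h'.2.2.2.1 h'.2.1.2.2 h'.2.2.2.2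
      have e := e1.symm.trans e2
      obtain ⟨b1, b2⟩ := Kp.base B c.un h.1.1.1 h.1.1.2.1
      obtain ⟨b1', b2'⟩ := Kp.base B c'.un h'.1.1.1 h'.1.1.2.1
      have q1 := c.left u' (e ▸ b1') h'.1.2.1
      have q2 := c'.left u (e ▸ b1) h.1.2.1
      have q3 := c.right w' (e ▸ b2') h'.1.2.2.1
      have q4 := c'.right w (e ▸ b2) h.1.2.2.1
      obtain rfl : u = u' := le_antisymm q1 q2
      obtain rfl : w = w' := le_antisymm q3 q4
      rfl
  change ∑ u ∈ R, ∑ w ∈ R, ∑ r ∈ R, testCost n A s u w r ≤ n ^ 3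
  rw [h1, ← Finset.card_sigma]
  refine h2.trans (le_of_eq ?_)
  simp [R]; ring

/-- A valid set together with a perfect matching of the vertices that are not matched by the edges
leaving the set yields a perfect matching-cut. -/
theorem hasCut_of_valid (B : BG n A s) {C : ℕ → Prop} (hC : Valid A C) {r : ℕ} (hr : C r)
    (hlt : r < n) (hk : kx n A s C = ky n A s C) (hm : KMatch n A s C) : HasCut n A := by
  classical
  obtain ⟨f, hf, hinj⟩ := hm
  have hsurj : ∀ y, Kp n A C y → ¬ s y → ∃ x, Kp n A C x ∧ s x ∧ f x = y := by
    intro y hy sy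
    have := Finset.surj_on_of_inj_on_of_card_le
      (s := (Finset.range n).filter fun z => Kp n A C z ∧ s z)
      (t := (Finset.range n).filter fun z => Kp n A C z ∧ ¬ s z) (fun x _ => f x)
      (by
        intro x hx
        simp only [Finset.mem_filter, Finset.mem_range] at hx ⊢
        have := hf x hx.2.1 hx.2.2
        exact ⟨this.1.1, this.1, this.2.1⟩)
      (by
        intro x y hx hy h
        simp only [Finset.mem_filter, Finset.mem_range] at hx hy
        exact hinj x y hx.2.1 hx.2.2 hy.2.1 hy.2.2 h)
      (by rw [← count_eq_card, ← count_eq_card]; exact hk.ge)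
      y (by simp [hy, sy, hy.1])
    obtain ⟨x, hx, rfl⟩ := this
    simp only [Finset.mem_filter, Finset.mem_range] at hx
    exact ⟨x, hx.2.1, hx.2.2, rfl⟩
  let P : ℕ → ℕ → Prop := fun x y => Kp n A C x ∧ s x ∧ f x = y
  -- The matching consists of the edges leaving `C` and of the pairs given by `f`. Mates are unique
  -- by `Valid.out` in `C`, by `Valid.inn` at the outer ends of leaving edges, and by bijectivity of
  -- `f` on the kernel.
  refine HasCut.of_rel (R := fun u v => A u v ∧ ((C u ↔ ¬ C v) ∨ P u v ∨ P v u))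
    (a := fun v => if C v then 1 else 0) ?_ (fun h => h.1) ?_ ?_ B.lt ?_
  · rintro u v ⟨h1, h2⟩
    exact ⟨B.symm h1, by tauto⟩
  · intro u hu
    have kC : ∀ {x y}, Kp n A C x → A x y → ¬ C y := fun h1 h2 h3 => h1.2.2 _ h3 (B.symm h2)
    by_cases h : C u
    · obtain ⟨z, z1, z2, z3⟩ := hC.out u h
      refine ⟨z, ⟨z2, .inl (by simp [h, z1])⟩, ?_⟩
      rintro y ⟨y1, y2 | y2 | y2⟩
      · exact z3 y (by tauto) y1
      · exact absurd h y2.1.2.1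
      · exact absurd h (kC y2.1 (B.symm y1))
    · by_cases h' : Kp n A C u
      · by_cases su : s u
        · refine ⟨f u, ⟨(hf u h' su).2.2, .inr (.inl ⟨h', su, rfl⟩)⟩, ?_⟩
          rintro y ⟨y1, y2 | y2 | y2⟩
          · exact absurd (by tauto) (kC h' y1)
          · exact y2.2.2.symm
          · exact absurd y2.2.1 ((B.bip y1).1 su)
        · obtain ⟨x, x1, x2, x3⟩ := hsurj u h' su
          refine ⟨x, ⟨B.symm (x3 ▸ (hf x x1 x2).2.2), .inr (.inr ⟨x1, x2, x3⟩)⟩, ?_⟩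
          rintro y ⟨y1, y2 | y2 | y2⟩
          · exact absurd (by tauto) (kC h' y1)
          · exact absurd y2.2.1 su
          · exact hinj y x y2.1 y2.2.1 x1 x2 (y2.2.2.trans x3.symm)
      · obtain ⟨v, v1, v2⟩ : ∃ v, C v ∧ A v u := by
          by_contra hcon
          exact h' ⟨hu, h, fun v h1 h2 => hcon ⟨v, h1, h2⟩⟩
        refine ⟨v, ⟨B.symm v2, .inl (by simp [h, v1])⟩, ?_⟩
        rintro y ⟨y1, y2 | y2 | y2⟩
        · exact hC.inn u y v h (by tauto) v1 (B.symm y1) v2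
        · exact absurd y2.1 h'
        · exact absurd (y2.2.2 ▸ (hf y y2.1 y2.2.1).1) h'
  · intro u v h1 h2
    refine ⟨h1, .inl ?_⟩
    by_cases h3 : C u <;> by_cases h4 : C v <;> simp_all
  · obtain ⟨z, z1, z2, -⟩ := hC.out r hr
    exact ⟨r, hlt, z, B.lt' z2, by simp [hr, z1]⟩

/-- If one class `P` of a perfect matching-cut consists of vertices that are matched to the other
class, and the other class has an edge of the matching, then a canonical triple exists. -/
theorem exists_canon (B : BG n A s) {m : ℕ → ℕ} {P : ℕ → Prop} (hadj : ∀ v < n, A v (m v))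
    (hinv : ∀ v < n, m (m v) = v) (hcross : ∀ {u v}, A u v → P u → ¬ P v → m u = v)
    (hall : ∀ v < n, P v → ¬ P (m v)) {r : ℕ} (hr : P r) (hrn : r < n) {k : ℕ} (hkn : k < n)
    (hk : ¬ P k) (hk' : ¬ P (m k)) :
    ∃ u < n, ∃ w < n, s u ∧ ¬ s w ∧ Canon n A s u w r ∧
      kx n A s (Cp n A u w r) = ky n A s (Cp n A u w r) ∧ KMatch n A s (Cp n A u w r) := by
  classical
  have hinj : ∀ u v, u < n → v < n → m u = m v → u = v := fun u v hu hv h => by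
    rw [← hinv u hu, h, hinv v hv]
  -- An edge from `P` to `k` would be bichromatic, hence the matching edge at `k`, whose other end
  -- is not in `P`.
  have nc : ∀ k < n, ¬ P k → ¬ P (m k) → ∀ v, P v → ¬ A v k := by
    intro k hkn hk hk' v hv h
    have := hcross h hv hk
    rw [← this, hinv v (B.lt h)] at hk'
    exact hk' hv
  obtain ⟨u0, w0, hu0, hw0, su0, sw0, pu0, pw0, nu0, nw0⟩ : ∃ u w, u < n ∧ w < n ∧ s u ∧ ¬ s w ∧
      ¬ P u ∧ ¬ P w ∧ (∀ v, P v → ¬ A v u) ∧ ∀ v, P v → ¬ A v w := by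
    have h1 := hadj k hkn
    have h2 := B.lt' h1
    have h3 := nc k hkn hk hk'
    have h4 := nc (m k) h2 hk' (by rwa [hinv k hkn])
    by_cases sk : s k
    · exact ⟨k, m k, hkn, h2, sk, (B.bip h1).1 sk, hk, hk', h3, h4⟩
    · exact ⟨m k, k, h2, hkn, (B.bip (B.symm h1)).2 sk, sk, hk', hk, h4, h3⟩
  set C := Cp n A u0 w0 r with hCdef
  have unP : ∀ v < n, P v → Un n A u0 w0 v := fun v hv h =>
    ⟨hv, by rintro rfl; exact pu0 h, by rintro rfl; exact pw0 h,
      fun h' => nu0 v h (B.symm h'), fun h' => nw0 v h (B.symm h')⟩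
  have hr0 := unP r hrn hr
  -- If the path left `P` along the edge `b c`, then `c` would be the only neighbour of `b` outside
  -- `P`. The common neighbour of `b` and the one of `u0`, `w0` on its side is outside `P`, so it
  -- equals `c`, which would then have been removed.
  have hCP : ∀ v, C v → P v := by
    intro v hv
    induction hv with
    | refl => exact hr
    | @tail b c hb h ih =>
      by_contra hc
      have key : ∀ k < n, ¬ P k → (∀ v, P v → ¬ A v k) → (s b ↔ s k) → A k c := by
        intro k hkn hk hk' hs
        obtain ⟨t, t1, t2⟩ := B.common (B.lt h.1) hkn (by rintro rfl; exact hk ih) hs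
        have ht : ¬ P t := fun h => hk' t h t2
        rw [← hcross h.1 ih hc, hcross t1 ih ht]
        exact B.symm t2
      by_cases sb : s b
      · exact h.2.2.2.2.1 (key u0 hu0 pu0 nu0 (by simp [sb, su0]))
      · exact h.2.2.2.2.2 (key w0 hw0 pw0 nw0 (by simp [sb, sw0]))
  have hCn : ∀ v, C v → v < n := fun v hv => (Cp.un hr0 hv).1
  have hout : ∀ v z, C v → ¬ C z → A v z → z = m v := by
    intro v z hv hz h
    refine (hcross h (hCP v hv) fun hPz => hz ?_).symm
    exact ReflTransGen.tail hv ⟨h, unP z (B.lt' h) hPz⟩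
  have hV : Valid A C := by
    constructor
    · intro v hv
      exact ⟨m v, fun h => hall v (hCn v hv) (hCP v hv) (hCP _ h), hadj v (hCn v hv),
        fun z hz h => hout v z hv hz h⟩
    · intro z v v' hz hv hv' h h'
      exact hinj v v' (hCn v hv) (hCn v' hv')
        ((hout v z hv hz h).symm.trans (hout v' z hv' hz h'))
  have hKu : Kp n A C u0 ∧ s u0 :=
    ⟨⟨hu0, fun h => pu0 (hCP _ h), fun v hv => nu0 v (hCP v hv)⟩, su0⟩
  have hKw : Kp n A C w0 ∧ ¬ s w0 :=
    ⟨⟨hw0, fun h => pw0 (hCP _ h), fun v hv => nw0 v (hCP v hv)⟩, sw0⟩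
  -- For canonicity `u0` and `w0` are replaced by the least kernel vertices, which does not change
  -- the component.
  have exu : ∃ u, Kp n A C u ∧ s u := ⟨u0, hKu⟩
  have exw : ∃ w, Kp n A C w ∧ ¬ s w := ⟨w0, hKw⟩
  have hu := Nat.find_spec exu
  have hw := Nat.find_spec exw
  have hmu := fun z (h : Kp n A C z ∧ s z) => Nat.find_min' exu h
  have hmw := fun z (h : Kp n A C z ∧ ¬ s z) => Nat.find_min' exw h
  set u := Nat.find exu
  set w := Nat.find exw
  have hE : Cp n A u w r = C := hV.cp_eq B hu.1 hw.1 hu.2 hw.2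
  -- If the mate of `z` had a neighbour `v` in `C`, it would be the mate of `v`, so `z = v` would
  -- lie in `C`.
  have hmK : ∀ z, Kp n A C z → Kp n A C (m z) := by
    intro z hz
    have h1 := hadj z hz.1
    have h2 : ¬ C (m z) := fun h => hz.2.2 _ h (B.symm h1)
    refine ⟨B.lt' h1, h2, fun v hv h => ?_⟩
    have := hinj _ _ hz.1 (hCn v hv) (hout v _ hv h2 h)
    exact hz.2.1 (this ▸ hv)
  refine ⟨u, hu.1.1, w, hw.1.1, hu.2, hw.2, ?_⟩
  refine ⟨⟨Valid.un B hu.1 hw.1 (Cp.self _ _ _ : C r) hrn, ?_, ?_, ?_⟩, ?_, ?_⟩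
  all_goals rw [hE]
  · exact hV
  · exact fun z h1 h2 => hmu z ⟨h1, h2⟩
  · exact fun z h1 h2 => hmw z ⟨h1, h2⟩
  · simp only [kx, ky, count_eq_card]
    refine Finset.card_nbij' m m ?_ ?_ ?_ ?_
    · intro z hz
      simp only [Finset.coe_filter, Finset.mem_range, Set.mem_ofPred_eq] at hz ⊢
      exact ⟨(hmK z hz.2.1).1, hmK z hz.2.1, (B.bip (hadj z hz.1)).1 hz.2.2⟩
    · intro z hz
      simp only [Finset.coe_filter, Finset.mem_range, Set.mem_ofPred_eq] at hz ⊢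
      exact ⟨(hmK z hz.2.1).1, hmK z hz.2.1, (B.bip (B.symm (hadj z hz.1))).2 hz.2.2⟩
    · intro z hz
      simp only [Finset.coe_filter, Finset.mem_range, Set.mem_ofPred_eq] at hz
      exact hinv z hz.1
    · intro z hz
      simp only [Finset.coe_filter, Finset.mem_range, Set.mem_ofPred_eq] at hz
      exact hinv z hz.1
  · exact ⟨m, fun x hx sx => ⟨hmK x hx, (B.bip (hadj x hx.1)).1 sx, hadj x hx.1⟩,
      fun x y hx _ hy _ h => hinj x y hx.1 hy.1 h⟩

end PMCut

/-! ### Cuts of the second kind: forcing of colours. -/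

namespace PMCut

variable {n : ℕ} {A : ℕ → ℕ → Prop} {s : ℕ → Prop}

/-- A 2-colouring in which each vertex has exactly one neighbour of the other colour. -/
structure Good (n : ℕ) (A : ℕ → ℕ → Prop) (g : ℕ → ℕ) : Prop where
  val : ∀ v, g v = 1 ∨ g v = 2
  ex : ∀ v < n, ∃ z, A v z ∧ g z ≠ g v
  uniq : ∀ {v z z'}, A v z → A v z' → g z ≠ g v → g z' ≠ g v → z = z'

theorem hasCut_of_colouring (B : BG n A s) (hn : 0 < n) {c : ℕ → ℕ}
    (hc : ∀ v < n, ∃! z, A v z ∧ c z ≠ c v) : HasCut n A := by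
  refine HasCut.of_rel (R := fun u v => A u v ∧ c v ≠ c u) (a := c)
    (fun h => ⟨B.symm h.1, h.2.symm⟩) (fun h => h.1) hc (fun h h' => ⟨h, h'.symm⟩) B.lt ?_
  obtain ⟨z, ⟨h1, h2⟩, -⟩ := hc 0 hn
  exact ⟨0, hn, z, B.lt' h1, h2.symm⟩

/-- Either there is a canonical triple, or all edges of the matching join different classes. -/
theorem cut_cases (B : BG n A s) (hn : 0 < n) (hn2 : n ≠ 2) (h : HasCut n A) :
    (∃ u < n, ∃ w < n, ∃ r, s u ∧ ¬ s w ∧ Canon n A s u w r ∧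
      kx n A s (Cp n A u w r) = ky n A s (Cp n A u w r) ∧ KMatch n A s (Cp n A u w r)) ∨
    ∃ g, Good n A g ∧ g 0 = 1 ∧ ∃ y q, A 0 y ∧ g y = 2 ∧ A 0 q ∧ q ≠ y := by
  classical
  obtain ⟨m, a, hm⟩ := h
  obtain ⟨p, hp, p', hp', hpp⟩ := hm.nonconst
  -- If `0` has no neighbour besides its mate, then `{0}` is a class of the first kind; `n ≠ 2`
  -- provides a matching edge in the rest.
  by_cases hleaf : ∃ q, A 0 q ∧ q ≠ m 0
  swap
  · push Not at hleaf
    have h0 := hm.adj 0 hn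
    have h00 : m 0 ≠ 0 := fun h => by
      rw [h] at h0
      exact iff_not_self (B.bip h0)
    obtain ⟨k, hk, k0, km⟩ : ∃ k < n, k ≠ 0 ∧ k ≠ m 0 := by
      have := B.lt' h0
      by_cases h1 : m 0 = 1
      · exact ⟨2, by omega, by omega, by omega⟩
      · exact ⟨1, by omega, by omega, by omega⟩
    obtain ⟨u, hu, w, hw, h⟩ := exists_canon (P := fun v => v = 0) B hm.adj hm.inv
      (fun {u v} h1 h2 _ => by subst h2; exact (hleaf v h1).symm) (fun v _ h => by subst h; exact h00)
      rfl hn hk k0 (fun h => km (by rw [← hm.inv k hk, h]))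
    exact .inl ⟨u, hu, w, hw, 0, h⟩
  obtain ⟨q, hq, hqm⟩ := hleaf
  by_cases h1 : ∃ k < n, a k ≠ a p ∧ a (m k) ≠ a p
  · obtain ⟨k, hk, k1, k2⟩ := h1
    by_cases h2 : ∃ k < n, a k = a p ∧ a (m k) = a p
    · exfalso
      obtain ⟨l, hl, l1, l2⟩ := h2
      -- A common neighbour `z` of `k` and `l` has another colour than one of them, so it would be
      -- the mate of that vertex, whose mate has its own colour.
      have key : ∀ k < n, ∀ l < n, a k ≠ a p → a (m k) ≠ a p → a l = a p → a (m l) = a p →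
          (s k ↔ s l) → False := by
        intro k hk l hl k1 k2 l1 l2 hs
        obtain ⟨z, z1, z2⟩ := B.common hk hl (by rintro rfl; exact k1 l1) hs
        by_cases hz : a z = a p
        · exact k2 (by rw [hm.cross z1 (by rw [hz]; exact k1), hz])
        · exact hz (by rw [← hm.cross (B.symm z2) (by rw [l1]; exact Ne.symm hz), l2])
      by_cases hs : s k ↔ s l
      · exact key k hk l hl k1 k2 l1 l2 hs
      · have b1 := hm.adj l hl
        refine key k hk (m l) (B.lt' b1) k1 k2 l2 (by rw [hm.inv l hl]; exact l1) ?_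
        have := B.bip b1
        tauto
    · push Not at h2
      obtain ⟨u, hu, w, hw, h⟩ := exists_canon (P := fun v => a v = a p) B hm.adj hm.inv
        (fun {u v} b1 b2 b3 => hm.cross b1 (by rw [b2]; exact Ne.symm b3))
        (fun v hv h => h2 v hv h) rfl hp hk k1 k2
      exact .inl ⟨u, hu, w, hw, p, h⟩
  · push Not at h1
    by_cases h2 : ∃ k < n, a k = a p ∧ a (m k) = a p
    · obtain ⟨k, hk, k1, k2⟩ := h2
      obtain ⟨u, hu, w, hw, h⟩ := exists_canon (P := fun v => a v ≠ a p) B hm.adj hm.inv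
        (fun {u v} b1 b2 b3 => hm.cross b1 (by rw [not_not.1 b3]; exact b2))
        (fun v hv h => not_not.2 (h1 v hv h)) hpp.symm hp' hk (not_not.2 k1) (not_not.2 k2)
      exact .inl ⟨u, hu, w, hw, p', h⟩
    · push Not at h2
      right
      -- The colours are normalised such that vertex `0` gets `1`.
      let g : ℕ → ℕ := fun v => if (a v = a p ↔ a 0 = a p) then 1 else 2
      have hg : ∀ u v, g u ≠ g v ↔ ¬ (a u = a p ↔ a v = a p) := by
        intro u v
        by_cases e1 : a u = a p <;> by_cases e2 : a v = a p <;> by_cases e3 : a 0 = a p <;>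
          simp [g, e1, e2, e3]
      have hx : ∀ v < n, g (m v) ≠ g v := by
        intro v hv
        rw [hg]
        have := h1 v hv
        have := h2 v hv
        tauto
      have hcr : ∀ {v z}, A v z → g z ≠ g v → m v = z := by
        intro v z h1 h2
        rw [hg] at h2
        exact hm.cross h1 fun h => h2 (by rw [h])
      have hG : Good n A g := ⟨fun v => by
          simp only [g]; split_ifs <;> simp, fun v hv => ⟨m v, hm.adj v hv, hx v hv⟩,
        fun h1 h2 h3 h4 => (hcr h1 h3).symm.trans (hcr h2 h4)⟩
      have g0 : g 0 = 1 := by simp [g]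
      refine ⟨g, hG, g0, m 0, q, hm.adj 0 hn, ?_, hq, hqm⟩
      have := hx 0 hn
      rcases hG.val (m 0) with h | h <;> omega

/-- The partial colouring `c` (with `0` for uncoloured) agrees with `g`. -/
def Ext (n : ℕ) (c g : ℕ → ℕ) : Prop := ∀ v < n, c v ≠ 0 → c v = g v

open Classical in
/-- The number of neighbours of `v` with colour `k`. -/
noncomputable def nb (n : ℕ) (A : ℕ → ℕ → Prop) (c : ℕ → ℕ) (k v : ℕ) : ℕ :=
  Nat.count (fun z => A v z ∧ c z = k) n

theorem nb_pos (B : BG n A s) {c : ℕ → ℕ} {k v z : ℕ} (h : A v z) (hz : c z = k) :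
    0 < nb n A c k v := by
  classical
  rw [nb, count_eq_card, Finset.card_pos]
  exact ⟨z, by simp [h, hz, B.lt' h]⟩

theorem exists_of_nb_pos {c : ℕ → ℕ} {k v : ℕ} (h : 0 < nb n A c k v) :
    ∃ z, A v z ∧ c z = k := by
  classical
  rw [nb, count_eq_card, Finset.card_pos] at h
  obtain ⟨z, hz⟩ := h
  exact ⟨z, (Finset.mem_filter.1 hz).2⟩

theorem nb_two_le {c : ℕ → ℕ} {k v : ℕ} : 2 ≤ nb n A c k v ↔
    ∃ z < n, ∃ z' < n, (A v z ∧ c z = k) ∧ (A v z' ∧ c z' = k) ∧ z ≠ z' := by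
  classical
  rw [nb, count_eq_card, Nat.succ_le_iff, Finset.one_lt_card]
  constructor
  · rintro ⟨z, hz, z', hz', h⟩
    simp only [Finset.mem_filter, Finset.mem_range] at hz hz'
    exact ⟨z, hz.1, z', hz'.1, hz.2, hz'.2, h⟩
  · rintro ⟨z, hz, z', hz', h1, h2, h⟩
    exact ⟨z, by simp [hz, h1], z', by simp [hz', h2], h⟩

/-- The colour that a coloured vertex forces on its uncoloured neighbours. -/
noncomputable def vote (n : ℕ) (A : ℕ → ℕ → Prop) (c : ℕ → ℕ) (v : ℕ) : ℕ :=
  if c v = 1 then (if 0 < nb n A c 2 v then 1 else if nb n A c 0 v = 1 then 2 else 0)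
  else if c v = 2 then (if 0 < nb n A c 1 v then 2 else if nb n A c 0 v = 1 then 1 else 0)
  else 0

/-- The colour that is forced on a vertex by two neighbours of that colour. -/
noncomputable def pull (n : ℕ) (A : ℕ → ℕ → Prop) (c : ℕ → ℕ) (v : ℕ) : ℕ :=
  if 1 < nb n A c 1 v then 1 else if 1 < nb n A c 2 v then 2 else 0

/-- `c'` arises from `c` by one parallel round of forcing. -/
def Round (n : ℕ) (A : ℕ → ℕ → Prop) (c c' : ℕ → ℕ) : Prop :=
  ∀ v < n, (c v ≠ 0 → c' v = c v) ∧ (c v = 0 →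
    (∃ z, A v z ∧ vote n A c z ≠ 0 ∧ c' v = vote n A c z) ∨
    ((∀ z, A v z → vote n A c z = 0) ∧ c' v = pull n A c v))

theorem Good.swap_eq {g : ℕ → ℕ} (hg : Good n A g) {v z : ℕ} (h : g z ≠ g v) :
    g z = 3 - g v := by
  rcases hg.val v with h1 | h1 <;> rcases hg.val z with h2 | h2 <;> omega

/-- If `z` already has a neighbour of the other colour, that neighbour is the only one, and all
others share the colour of `z`. If it has none and a single uncoloured neighbour, then this
neighbour must be the one of the other colour. -/
theorem vote_sound (B : BG n A s) {c g : ℕ → ℕ} (hg : Good n A g) (hc : Ext n c g) {v z : ℕ}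
    (hv : c v = 0) (h : A v z) (hz : vote n A c z ≠ 0) : g v = vote n A c z := by
  have hzn := B.lt' h
  have key : ∀ k l, k ≠ 0 → l ≠ 0 → c z = k → k + l = 3 →
      (if 0 < nb n A c l z then k else if nb n A c 0 z = 1 then l else 0) ≠ 0 →
      g v = if 0 < nb n A c l z then k else if nb n A c 0 z = 1 then l else 0 := by
    intro k l hk hl hcz hkl h0
    have hgz : g z = k := by rw [← hc z hzn (by omega), hcz]
    split_ifs at h0 ⊢ with h1 h2
    · obtain ⟨y, y1, y2⟩ := exists_of_nb_pos h1
      have hgy : g y = l := by rw [← hc y (B.lt' y1) (by omega), y2]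
      by_contra hne
      have := hg.uniq y1 (B.symm h) (by omega) (by omega)
      rw [this] at y2
      omega
    · obtain ⟨y, y1, y2⟩ := hg.ex z hzn
      have h3 := hg.swap_eq y2
      have hcy : c y = 0 := by
        by_contra hne
        have h4 := hc y (B.lt' y1) hne
        exact h1 (nb_pos B y1 (by omega))
      have : v = y := by
        by_contra hne
        have := nb_two_le.2 ⟨v, B.lt h, y, B.lt' y1, ⟨B.symm h, hv⟩, ⟨y1, hcy⟩, hne⟩
        omega
      rw [this]; omega
    · exact absurd rfl h0
  simp only [vote] at hz ⊢
  by_cases h1 : c z = 1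
  · simp only [h1, if_true] at hz ⊢
    exact key 1 2 (by omega) (by omega) h1 (by omega) hz
  · by_cases h2 : c z = 2
    · simp [h2] at hz ⊢
      exact key 2 1 (by omega) (by omega) h2 (by omega) (by simpa using hz)
    · simp [h1, h2] at hz

/-- Two neighbours of the same colour cannot both be the unique neighbour of the other colour. -/
theorem pull_sound {c g : ℕ → ℕ} (hg : Good n A g) (hc : Ext n c g) {v : ℕ}
    (hv : pull n A c v ≠ 0) : g v = pull n A c v := by
  have key : ∀ k, k ≠ 0 → 1 < nb n A c k v → g v = k := by
    intro k hk h
    obtain ⟨z, hz, z', hz', ⟨h1, h2⟩, ⟨h3, h4⟩, hne⟩ := nb_two_le.1 h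
    by_contra hv
    have e1 := hc z hz (by omega)
    have e2 := hc z' hz' (by omega)
    exact hne (hg.uniq h1 h3 (by omega) (by omega))
  simp only [pull] at hv ⊢
  split_ifs at hv ⊢ with h1 h2
  · exact key 1 (by omega) h1
  · exact key 2 (by omega) h2
  · exact absurd rfl hv

theorem Round.ext (B : BG n A s) {c c' g : ℕ → ℕ} (hg : Good n A g) (hc : Ext n c g)
    (h : Round n A c c') : Ext n c' g := by
  intro v hv hv'
  by_cases h0 : c v = 0
  · rcases (h v hv).2 h0 with ⟨z, z1, z2, z3⟩ | ⟨-, h2⟩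
    · rw [z3, vote_sound B hg hc h0 z1 z2]
    · rw [h2] at hv' ⊢
      rw [pull_sound hg hc hv']
  · rw [(h v hv).1 h0] at hv' ⊢
    exact hc v hv hv'

/-- What it means that a vertex is still uncoloured after a round. -/
theorem Round.uncoloured {c c' : ℕ → ℕ} (h : Round n A c c') {v : ℕ}
    (hv : v < n) (h0 : c' v = 0) : c v = 0 ∧ nb n A c 1 v < 2 ∧ nb n A c 2 v < 2 ∧
      ∀ z, A v z → (c z = 1 → nb n A c 2 z = 0 ∧ nb n A c 0 z ≠ 1) ∧
        (c z = 2 → nb n A c 1 z = 0 ∧ nb n A c 0 z ≠ 1) := by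
  have h1 : c v = 0 := by
    by_contra hne
    exact hne ((h v hv).1 hne ▸ h0)
  rcases (h v hv).2 h1 with ⟨z, z1, z2, z3⟩ | ⟨h2, h3⟩
  · exact absurd (z3 ▸ h0) z2
  · rw [h3] at h0
    refine ⟨h1, ?_, ?_, fun z hz => ?_⟩
    · by_contra hcon
      rw [pull, if_pos (by omega)] at h0
      omega
    · by_contra hcon
      rw [pull] at h0
      split_ifs at h0
      omega
    · have h4 := h2 z hz
      constructor <;> intro h5 <;> simp [vote, h5] at h4 <;> split_ifs at h4 <;>
        exact ⟨by omega, by omega⟩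

/-- The vertices are points of a grid; those of `ZA` lie in distinct columns, those of `ZB` in
distinct rows, and each point of `ZA` shares a row or a column with each point of `ZB`. If `ZA` has
two points, a point of `ZB` in neither of their rows would share its column with both; so `ZB` fits
into two rows and has at most two points, and likewise with the roles exchanged. If `ZA` is a single
point `z`, a point of `T` in `ZB` shares its row with another point, which can only be `z`, so there
is at most one such point. -/
theorem card_grid {ZA ZB T : Finset ℕ} {row col : ℕ → ℕ}
    (hA : ∀ z ∈ ZA, ∀ z' ∈ ZA, col z = col z' → z = z')
    (hB : ∀ z ∈ ZB, ∀ z' ∈ ZB, row z = row z' → z = z')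
    (hAB : ∀ z ∈ ZA, ∀ x ∈ ZB, row x = row z ∨ col x = col z)
    (hT : T ⊆ ZA ∪ ZB)
    (h1 : T.Nonempty → ZA.Nonempty ∧ ZB.Nonempty)
    (h2 : ∀ x ∈ T, x ∈ ZB → ∃ y, y ≠ x ∧ y ∈ ZA ∪ ZB ∧ row y = row x)
    (h3 : ∀ x ∈ T, x ∈ ZA → ∃ y, y ≠ x ∧ y ∈ ZA ∪ ZB ∧ col y = col x) : T.card ≤ 4 := by
  classical
  have big : ∀ {ZA ZB : Finset ℕ} {row col : ℕ → ℕ}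
      (_ : ∀ z ∈ ZA, ∀ z' ∈ ZA, col z = col z' → z = z')
      (_ : ∀ z ∈ ZB, ∀ z' ∈ ZB, row z = row z' → z = z')
      (_ : ∀ z ∈ ZA, ∀ x ∈ ZB, row x = row z ∨ col x = col z), 1 < ZA.card → ZB.card ≤ 2 := by
    intro ZA ZB row col hA hB hAB h
    obtain ⟨z, hz, z', hz', hne⟩ := Finset.one_lt_card.1 h
    refine (Finset.card_le_card_of_injOn (t := {row z, row z'}) row ?_ fun x hx y hy e =>
      hB x hx y hy e).trans Finset.card_le_two
    intro x hx
    have e1 := hAB z hz x hx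
    have e2 := hAB z' hz' x hx
    have e3 : col z ≠ col z' := fun e => hne (hA z hz z' hz' e)
    simp only [Finset.coe_insert, Finset.coe_singleton, Set.mem_insert_iff, Set.mem_singleton_iff]
    by_contra hcon
    push Not at hcon
    exact e3 ((e1.resolve_left hcon.1).symm.trans (e2.resolve_left hcon.2))
  have small : ∀ {ZA ZB : Finset ℕ} {row : ℕ → ℕ}
      (_ : ∀ z ∈ ZB, ∀ z' ∈ ZB, row z = row z' → z = z') (_ : T ⊆ ZA ∪ ZB)
      (_ : T.Nonempty → ZA.Nonempty)
      (_ : ∀ x ∈ T, x ∈ ZB → ∃ y, y ≠ x ∧ y ∈ ZA ∪ ZB ∧ row y = row x),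
      ZA.card ≤ 1 → T.card ≤ 4 := by
    intro ZA ZB row hB hT h1 h2 h
    by_cases hne : T.Nonempty
    swap
    · rw [Finset.not_nonempty_iff_eq_empty.1 hne]; simp
    obtain ⟨z, hz⟩ := h1 hne
    have hz' : ∀ y ∈ ZA, y = z := fun y hy => Finset.card_le_one.1 h y hy z hz
    have hsub : T ⊆ insert z (ZB.filter fun x => row x = row z) := by
      intro x hx
      rcases Finset.mem_union.1 (hT hx) with hxA | hxB
      · simp [hz' x hxA]
      · obtain ⟨y, y1, y2, y3⟩ := h2 x hx hxB
        rcases Finset.mem_union.1 y2 with hyA | hyB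
        · have := hz' y hyA
          subst this
          simp [hxB, y3]
        · exact absurd (hB y hyB x hxB y3) y1
    have hf : (ZB.filter fun x => row x = row z).card ≤ 1 := by
      refine Finset.card_le_one.2 fun x hx y hy => ?_
      simp only [Finset.mem_filter] at hx hy
      exact hB x hx.1 y hy.1 (hx.2.trans hy.2.symm)
    have := (Finset.card_le_card hsub).trans (Finset.card_insert_le _ _)
    omega
  by_cases c1 : ZA.card ≤ 1
  · exact small hB hT (fun h => (h1 h).1) h2 c1
  by_cases c2 : ZB.card ≤ 1
  · exact small hA (by rwa [Finset.union_comm]) (fun h => (h1 h).2)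
      (by simpa only [Finset.union_comm ZB ZA] using h3) c2
  have d1 := big hA hB hAB (by omega)
  have d2 := big hB hA (fun x hx z hz => by
    rcases hAB z hz x hx with h | h
    · exact .inr h.symm
    · exact .inl h.symm) (by omega)
  have := (Finset.card_le_card hT).trans (Finset.card_union_le _ _)
  omega

/-- After two rounds only few vertices of each side are uncoloured, provided that initially each
uncoloured vertex has neighbours of both colours. -/
theorem card_uncoloured_side (B : BG n A s) {S : ℕ → Prop}
    [DecidablePred S] (hbip : ∀ {i j}, A i j → (S i ↔ ¬ S j))
    (hcom : ∀ {i j}, i < n → j < n → i ≠ j → S i → S j → ∃ z, A i z ∧ A z j)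
    {g c0 c1 c2 : ℕ → ℕ} (hg : Good n A g) (h0 : Ext n c0 g)
    (hnb : ∀ v < n, c0 v = 0 → ∀ k, k = 1 ∨ k = 2 → ∃ t, A v t ∧ c0 t = k)
    (h1 : Round n A c0 c1) (h2 : Round n A c1 c2) :
    ((Finset.range n).filter fun v => S v ∧ c2 v = 0).card ≤ 4 := by
  classical
  have e1 := h1.ext B hg h0
  -- A vertex uncoloured after the first round has at least one neighbour of colour `k` by `hnb`,
  -- and at most one since `pull` did not apply. For `k = 1` and `k = 2` these are its `row` and
  -- `col`.
  have hk : ∀ k, k = 1 ∨ k = 2 → ∀ v, ∃ t, v < n → c1 v = 0 →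
      A v t ∧ c0 t = k ∧ ∀ t', A v t' → c0 t' = k → t' = t := by
    intro k hk v
    by_cases hv : v < n ∧ c1 v = 0
    · obtain ⟨u0, u1, u2, -⟩ := h1.uncoloured hv.1 hv.2
      obtain ⟨t, t1, t2⟩ := hnb v hv.1 u0 k hk
      refine ⟨t, fun _ _ => ⟨t1, t2, fun t' t3 t4 => ?_⟩⟩
      by_contra hne
      have := nb_two_le.2 ⟨t', B.lt' t3, t, B.lt' t1, ⟨t3, t4⟩, ⟨t1, t2⟩, hne⟩
      rcases hk with rfl | rfl <;> omega
    · exact ⟨0, fun h h' => absurd ⟨h, h'⟩ hv⟩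
  choose row hrow using hk 1 (.inl rfl)
  choose col hcol using hk 2 (.inr rfl)
  let Z : ℕ → Finset ℕ := fun k => (Finset.range n).filter fun v => (S v ∧ c1 v = 0) ∧ g v = k
  have hZ : ∀ {k v}, v ∈ Z k ↔ v < n ∧ (S v ∧ c1 v = 0) ∧ g v = k := by
    intro k v; simp [Z]
  have memZ : ∀ {v}, v < n → S v → c1 v = 0 → v ∈ Z 1 ∪ Z 2 := by
    intro v h1 h2 h3
    rcases hg.val v with h | h
    · exact Finset.mem_union_left _ (hZ.2 ⟨h1, ⟨h2, h3⟩, h⟩)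
    · exact Finset.mem_union_right _ (hZ.2 ⟨h1, ⟨h2, h3⟩, h⟩)
  have gk : ∀ {t k}, t < n → k ≠ 0 → c0 t = k → g t = k := fun ht hk h => by
    rw [← h0 _ ht (by omega), h]
  have ck : ∀ {t k}, t < n → k ≠ 0 → c0 t = k → c1 t = k := fun ht hk h => by
    rw [(h1 _ ht).1 (by omega), h]
  -- The vertex `f z` has colour `l`, and `z` is its unique neighbour of the other colour `k`.
  have injZ : ∀ {k l : ℕ} {f : ℕ → ℕ}, k ≠ l → l ≠ 0 →
      (∀ v, v < n → c1 v = 0 → A v (f v) ∧ c0 (f v) = l) →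
      ∀ z ∈ Z k, ∀ z' ∈ Z k, f z = f z' → z = z' := by
    intro k l f hkl hl hf z hz z' hz' he
    rw [hZ] at hz hz'
    have f1 := hf z hz.1 hz.2.1.2
    have f2 := hf z' hz'.1 hz'.2.1.2
    have := gk (B.lt' f1.1) hl f1.2
    refine hg.uniq (B.symm f1.1) (B.symm (he ▸ f2.1)) ?_ ?_ <;> omega
  -- The second round forced nothing from `t` onto `x`. So `t` has no neighbour coloured `k` yet,
  -- which means that its neighbour of the other colour is still uncoloured, and `t` has an
  -- uncoloured neighbour besides `x`.
  have mateZ : ∀ {k l x t : ℕ}, k ≠ 0 → l ≠ 0 → k + l = 3 → x < n → S x → c2 x = 0 → A x t →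
      c0 t = l → (Z k).Nonempty ∧ ∃ y, y ≠ x ∧ y ∈ Z 1 ∪ Z 2 ∧ A y t := by
    intro k l x t hk hl hkl hx Sx h2x hxt ht
    have htn := B.lt' hxt
    obtain ⟨u0, -, -, u⟩ := h2.uncoloured hx h2x
    have ct := ck htn hl ht
    have gt' := gk htn hl ht
    have u' : nb n A c1 k t = 0 ∧ nb n A c1 0 t ≠ 1 := by
      have : (k = 1 ∧ l = 2) ∨ (k = 2 ∧ l = 1) := by omega
      rcases this with ⟨rfl, rfl⟩ | ⟨rfl, rfl⟩
      · exact (u t hxt).2 ct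
      · exact (u t hxt).1 ct
    have Sof : ∀ {y}, A t y → S y := fun h => by
      have e1 := hbip h
      have e2 := hbip hxt
      tauto
    constructor
    · obtain ⟨z, z1, z2⟩ := hg.ex t htn
      have z3 := hg.swap_eq z2
      refine ⟨z, hZ.2 ⟨B.lt' z1, ⟨Sof z1, ?_⟩, by omega⟩⟩
      by_contra hne
      have z4 := e1 z (B.lt' z1) hne
      have := nb_pos B z1 (show c1 z = k by omega)
      omega
    · have p1 := nb_pos B (B.symm hxt) u0
      obtain ⟨z, hz, z', hz', ⟨q1, q2⟩, ⟨q3, q4⟩, hne⟩ :=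
        nb_two_le.1 (show 2 ≤ nb n A c1 0 t by omega)
      by_cases hzx : z = x
      · exact ⟨z', fun h => hne (hzx.trans h.symm), memZ hz' (Sof q3) q4, B.symm q3⟩
      · exact ⟨z, hzx, memZ hz (Sof q1) q2, B.symm q1⟩
  have c12 : ∀ {x}, x < n → c2 x = 0 → c1 x = 0 := fun hx h => (h2.uncoloured hx h).1
  refine card_grid (ZA := Z 1) (ZB := Z 2) (row := row) (col := col) ?_ ?_ ?_ ?_ ?_ ?_ ?_
  · exact injZ (l := 2) (by omega) (by omega) fun v hv h => ⟨(hcol v hv h).1, (hcol v hv h).2.1⟩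
  · exact injZ (l := 1) (by omega) (by omega) fun v hv h => ⟨(hrow v hv h).1, (hrow v hv h).2.1⟩
  · intro z hz x hx
    rw [hZ] at hz hx
    obtain ⟨t, t1, t2⟩ := hcom hz.1 hx.1 (by rintro rfl; omega) hz.2.1.1 hx.2.1.1
    have rx := hrow x hx.1 hx.2.1.2
    have rz := hrow z hz.1 hz.2.1.2
    have cz := hcol z hz.1 hz.2.1.2
    have cx := hcol x hx.1 hx.2.1.2
    have g1 := gk (B.lt' rx.1) (by omega) rx.2.1
    have g2 := gk (B.lt' cz.1) (by omega) cz.2.1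
    -- The common neighbour `t` has another colour than `x` or than `z`, so it is the `row` of `x`
    -- or the `col` of `z`.
    rcases hg.val t with h | h
    · left
      have := hg.uniq (B.symm t2) rx.1 (by omega) (by omega)
      subst this
      exact rz.2.2 _ t1 rx.2.1
    · right
      have := hg.uniq t1 cz.1 (by omega) (by omega)
      subst this
      exact (cx.2.2 _ (B.symm t2) cz.2.1).symm
  · intro x hx
    simp only [Finset.mem_filter, Finset.mem_range] at hx
    exact memZ hx.1 hx.2.1 (c12 hx.1 hx.2.2)
  · rintro ⟨x, hx⟩
    simp only [Finset.mem_filter, Finset.mem_range] at hx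
    have c := c12 hx.1 hx.2.2
    have r := hrow x hx.1 c
    have q := hcol x hx.1 c
    exact ⟨(mateZ (k := 1) (l := 2) (by omega) (by omega) (by omega) hx.1 hx.2.1 hx.2.2 q.1 q.2.1).1,
      (mateZ (k := 2) (l := 1) (by omega) (by omega) (by omega) hx.1 hx.2.1 hx.2.2 r.1 r.2.1).1⟩
  · intro x hx _
    simp only [Finset.mem_filter, Finset.mem_range] at hx
    have r := hrow x hx.1 (c12 hx.1 hx.2.2)
    obtain ⟨y, y1, y2, y3⟩ := (mateZ (k := 2) (l := 1) (by omega) (by omega) (by omega)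
      hx.1 hx.2.1 hx.2.2 r.1 r.2.1).2
    refine ⟨y, y1, y2, ?_⟩
    have hy : y < n ∧ c1 y = 0 := by
      rcases Finset.mem_union.1 y2 with h | h <;> rw [hZ] at h <;> exact ⟨h.1, h.2.1.2⟩
    exact ((hrow y hy.1 hy.2).2.2 _ y3 r.2.1).symm
  · intro x hx _
    simp only [Finset.mem_filter, Finset.mem_range] at hx
    have r := hcol x hx.1 (c12 hx.1 hx.2.2)
    obtain ⟨y, y1, y2, y3⟩ := (mateZ (k := 1) (l := 2) (by omega) (by omega) (by omega)
      hx.1 hx.2.1 hx.2.2 r.1 r.2.1).2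
    refine ⟨y, y1, y2, ?_⟩
    have hy : y < n ∧ c1 y = 0 := by
      rcases Finset.mem_union.1 y2 with h | h <;> rw [hZ] at h <;> exact ⟨h.1, h.2.1.2⟩
    exact ((hcol y hy.1 hy.2).2.2 _ y3 r.2.1).symm

open Classical in
/-- After two rounds at most eight vertices are uncoloured. -/
theorem card_uncoloured (B : BG n A s) {g c0 c1 c2 : ℕ → ℕ} (hg : Good n A g) (h0 : Ext n c0 g)
    (hnb : ∀ v < n, c0 v = 0 → ∀ k, k = 1 ∨ k = 2 → ∃ t, A v t ∧ c0 t = k)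
    (h1 : Round n A c0 c1) (h2 : Round n A c1 c2) : Nat.count (fun v => c2 v = 0) n ≤ 8 := by
  have a1 := card_uncoloured_side B (S := s) B.bip
    (fun hi hj hne h h' => B.common hi hj hne (by simp [h, h'])) hg h0 hnb h1 h2
  have a2 := card_uncoloured_side B (S := fun v => ¬ s v)
    (fun h => by have := B.bip h; tauto)
    (fun hi hj hne h h' => B.common hi hj hne (by simp [h, h'])) hg h0 hnb h1 h2
  rw [count_eq_card]
  have : (Finset.range n).filter (fun v => c2 v = 0) =
      (Finset.range n).filter (fun v => s v ∧ c2 v = 0) ∪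
      (Finset.range n).filter (fun v => ¬ s v ∧ c2 v = 0) := by
    ext v
    simp only [Finset.mem_filter, Finset.mem_range, Finset.mem_union]
    tauto
  rw [this]
  exact (Finset.card_union_le _ _).trans (by omega)

open Classical in
/-- The initial colouring for the guess that the edges `0 y` and `q x` belong to the matching. -/
noncomputable def init (A : ℕ → ℕ → Prop) (y q x v : ℕ) : ℕ :=
  if v = 0 ∨ v = q then 1 else if v = y ∨ v = x then 2 else if A 0 v ∨ A q v then 1
  else if A y v ∨ A x v then 2 else 0

/-- The four guessed vertices form two pairs of mates of different colours, so each further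
neighbour of one of them has the colour of that vertex. -/
theorem init_ext (B : BG n A s) {g : ℕ → ℕ} (hg : Good n A g) {y q x : ℕ} (g0 : g 0 = 1)
    (gy : g y = 2) (gq : g q = 1) (gx : g x = 2) (h0y : A 0 y) (hqx : A q x) :
    Ext n (init A y q x) g := by
  intro v _ h
  simp only [init] at h ⊢
  split_ifs at h ⊢ with h1 h2 h3 h4
  · rcases h1 with rfl | rfl <;> omega
  · rcases h2 with rfl | rfl <;> omega
  · by_contra hne
    rcases h3 with h3 | h3
    · exact h2 (.inl (hg.uniq h3 h0y (by omega) (by omega)))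
    · exact h2 (.inr (hg.uniq h3 hqx (by omega) (by omega)))
  · by_contra hne
    rcases h4 with h4 | h4
    · exact h1 (.inl (hg.uniq h4 (B.symm h0y) (by omega) (by omega)))
    · exact h1 (.inr (hg.uniq h4 (B.symm hqx) (by omega) (by omega)))
  · exact absurd rfl h

/-- The vertices `0`, `x` lie on one side and `y`, `q` on the other, and each pair shows both
colours. An uncoloured `v` is adjacent to none of the four. So its common neighbour with the vertex
`e` of its side is not the mate of `e`, and has received the colour of `e`. -/
theorem init_nb (B : BG n A s) {g : ℕ → ℕ} (hg : Good n A g) {y q x : ℕ} (g0 : g 0 = 1)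
    (gy : g y = 2) (gq : g q = 1) (gx : g x = 2) (h0y : A 0 y) (h0q : A 0 q) (hqx : A q x) :
    ∀ v < n, init A y q x v = 0 → ∀ k, k = 1 ∨ k = 2 → ∃ t, A v t ∧ init A y q x t = k := by
  intro v hv h
  have hext := init_ext B hg g0 gy gq gx h0y hqx
  obtain ⟨v1, v2, v3, v4⟩ : ¬ (v = 0 ∨ v = q) ∧ ¬ (v = y ∨ v = x) ∧ ¬ (A 0 v ∨ A q v) ∧
      ¬ (A y v ∨ A x v) := by
    simp only [init] at h
    split_ifs at h with h1 h2 h3 h4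
    exact ⟨h1, h2, h3, h4⟩
  push Not at v1 v2 v3 v4
  have b1 := B.bip h0y
  have b2 := B.bip h0q
  have b3 := B.bip hqx
  have key : ∀ e, (e = 0 ∨ e = q ∨ e = y ∨ e = x) → (s v ↔ s e) →
      ∃ t, A v t ∧ init A y q x t = g e := by
    intro e he hs
    have hen : e < n ∧ e ≠ v := by
      rcases he with rfl | rfl | rfl | rfl
      · exact ⟨B.lt h0y, v1.1.symm⟩
      · exact ⟨B.lt hqx, v1.2.symm⟩
      · exact ⟨B.lt' h0y, v2.1.symm⟩
      · exact ⟨B.lt' hqx, v2.2.symm⟩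
    obtain ⟨t, t1, t2⟩ := B.common hv hen.1 hen.2.symm hs
    have t3 := B.symm t1
    have t4 := B.symm t2
    have ne0 : t ≠ 0 := by rintro rfl; exact v3.1 t3
    have neq : t ≠ q := by rintro rfl; exact v3.2 t3
    have ney : t ≠ y := by rintro rfl; exact v4.1 t3
    have nex : t ≠ x := by rintro rfl; exact v4.2 t3
    have hge : g t = g e := by
      by_contra hne
      rcases he with rfl | rfl | rfl | rfl
      · exact ney (hg.uniq t4 h0y (by omega) (by omega))
      · exact nex (hg.uniq t4 hqx (by omega) (by omega))
      · exact ne0 (hg.uniq t4 (B.symm h0y) (by omega) (by omega))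
      · exact neq (hg.uniq t4 (B.symm hqx) (by omega) (by omega))
    refine ⟨t, t1, ?_⟩
    rw [← hge]
    refine hext t (B.lt t2) ?_
    simp only [init, ne0, neq, ney, nex, or_self, if_false]
    split_ifs with k1 k2
    · omega
    · omega
    · rcases he with rfl | rfl | rfl | rfl <;> tauto
  rintro k (rfl | rfl)
  · by_cases hs : s v ↔ s 0
    · exact g0 ▸ key 0 (by simp) hs
    · exact gq ▸ key q (by simp) (by tauto)
  · by_cases hs : s v ↔ s 0
    · exact gx ▸ key x (by simp) (by tauto)
    · exact gy ▸ key y (by simp) (by tauto)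

end PMCut


/-! ### Programs for the initial colouring and for a round of forcing. -/

namespace PMCut

variable {n : ℕ} {A : ℕ → ℕ → Prop} {s : ℕ → Prop}

/-- `x := x + 1`. -/
def Cmd.inc (x : ℕ) : Cmd := .set x (.add (.v x) (.c 1))

@[simp] theorem wp_inc (Q : St → Prop) (x w a t) :
    wp n A (.inc x) Q ⟨w, a, t⟩ ↔ x ≠ 0 ∧ w x + 1 ≤ n + 9 ∧
      Q ⟨Function.update w x (w x + 1), a, t + 4⟩ := by
  simp [Cmd.inc]

/-- Array `6` gets the initial colouring. -/
def initCmd : Cmd :=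
  .for 7 (.set 9 (.c 0) ;;
    .ite (.eq (.v 7) (.c 0)) (.set 9 (.c 1)) (.ite (.eq (.v 7) (.v 3)) (.set 9 (.c 1))
    (.ite (.eq (.v 7) (.v 2)) (.set 9 (.c 2)) (.ite (.eq (.v 7) (.v 4)) (.set 9 (.c 2))
    (.ite (.adj (.c 0) (.v 7)) (.set 9 (.c 1)) (.ite (.adj (.v 3) (.v 7)) (.set 9 (.c 1))
    (.ite (.adj (.v 2) (.v 7)) (.set 9 (.c 2)) (.when (.adj (.v 4) (.v 7)) (.set 9 (.c 2))))))))) ;;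
    .put 6 (.v 7) (.v 9))

theorem initCmd_spec {w a t} {Q : St → Prop} {y q x : ℕ} (hn : 0 < n) (hy : y < n) (hq : q < n)
    (hx : x < n) (wy : w 2 = y) (wq : w 3 = q) (wx : w 4 = x)
    (hQ : ∀ w' a' t', Fr [7, 9] [6] w a w' a' → (∀ v < n, a' 6 v = init A y q x v) →
      t' ≤ t + 100 * n + 100 → Q ⟨w', a', t'⟩) :
    wp n A initCmd Q ⟨w, a, t⟩ := by
  refine wp_for_const (by decide) (fun i w' a' => Fr [7, 9] [6] w a w' a' ∧
    ∀ v < i, a' 6 v = init A y q x v) 95 ?_ ?_ ?_ ?_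
  · exact fun i w a y h => ⟨h.1.set (by decide), h.2⟩
  · exact ⟨Fr.rfl, by simp⟩
  · rintro v w1 a1 t1 hv hn1 hv7 ⟨hF, h1⟩
    have e2 := (hF.var 2 (by decide)).trans wy
    have e3 := (hF.var 3 (by decide)).trans wq
    have e4 := (hF.var 4 (by decide)).trans wx
    have key : ∀ k, (init A y q x v = k) → ∀ v' < v + 1,
        Function.update (a1 6) v k v' = init A y q x v' := by
      intro k hk v' hv'
      rw [Function.update_apply]
      split_ifs with h
      · rw [h, hk]
      · exact h1 v' (by omega)
    have hF' : ∀ {f k}, Fr [7, 9] [6] w a (Function.update w1 9 k) (Function.update a1 6 f) :=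
      (hF.set (by decide)).put (by decide)
    have hF2 : ∀ {f k l}, Fr [7, 9] [6] w a (Function.update (Function.update w1 9 k) 9 l)
      (Function.update a1 6 f) := ((hF.set (by decide)).set (by decide)).put (by decide)
    have b : v ≤ n + 9 := by omega
    simp only [wp_seq, wp_set, wp_ite, wp_when, wp_put]
    simp [hv7, e2, e3, e4, hv, hn, hy, hq, hx, hF']
    grind [init]
  · rintro w' a' t' - - ⟨hF, h⟩ ht
    exact hQ w' a' t' hF h (by linarith)

/-- Compute the vote of vertex `v7` from the numbers of its neighbours of the three colours. -/
def voteCmd : Cmd :=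
  .set 9 (.c 0) ;;
  .ite (.eq (.get 6 (.v 7)) (.c 1))
    (.ite (.lt (.c 0) (.v 12)) (.set 9 (.c 1)) (.when (.eq (.v 13) (.c 1)) (.set 9 (.c 2))))
    (.when (.eq (.get 6 (.v 7)) (.c 2))
      (.ite (.lt (.c 0) (.v 11)) (.set 9 (.c 2)) (.when (.eq (.v 13) (.c 1)) (.set 9 (.c 1)))))

theorem voteCmd_spec {w a t} {Q : St → Prop} {v : ℕ} (h7 : w 7 = v)
    (h11 : w 11 = nb n A (a 6) 1 v) (h12 : w 12 = nb n A (a 6) 2 v)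
    (h13 : w 13 = nb n A (a 6) 0 v)
    (hQ : ∀ t' ≤ t + 50, Q ⟨Function.update w 9 (vote n A (a 6) v), a, t'⟩) :
    wp n A voteCmd Q ⟨w, a, t⟩ := by
  have key : ∀ k t', k = vote n A (a 6) v → t' ≤ t + 50 → Q ⟨Function.update w 9 k, a, t'⟩ := by
    rintro k t' rfl h; exact hQ t' h
  simp only [vote] at key
  simp only [voteCmd, wp_seq, wp_set, wp_ite, wp_when]
  simp only [ne_eq, OfNat.ofNat_ne_zero, not_false_eq_true, Ex.Ok, Nat.zero_le, Ex.eval, Ex.cost,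
    Cn.eq_ok, Cn.eq_holds, Cn.eq_cost, Cn.lt_ok, Cn.lt_holds, Cn.lt_cost, true_and,
    Function.update_self, Function.update_idem, Nat.reduceLT, h7, h11, h12, h13,
    Function.update_of_ne, OfNat.ofNat_eq_ofNat, Nat.reduceEqDiff, and_true, true_and]
  grind

/-- Compute the colour that is forced on vertex `v7` by two neighbours of the same colour. -/
def pullCmd : Cmd :=
  .set 9 (.c 0) ;;
  .ite (.lt (.c 1) (.v 11)) (.set 9 (.c 1)) (.when (.lt (.c 1) (.v 12)) (.set 9 (.c 2)))

theorem pullCmd_spec {w a t} {Q : St → Prop} {v : ℕ} {c : ℕ → ℕ}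
    (h11 : w 11 = nb n A c 1 v) (h12 : w 12 = nb n A c 2 v)
    (hQ : ∀ t' ≤ t + 50, Q ⟨Function.update w 9 (pull n A c v), a, t'⟩) :
    wp n A pullCmd Q ⟨w, a, t⟩ := by
  have key : ∀ k t', k = pull n A c v → t' ≤ t + 50 → Q ⟨Function.update w 9 k, a, t'⟩ := by
    rintro k t' rfl h; exact hQ t' h
  simp only [pull] at key
  simp only [pullCmd, wp_seq, wp_set, wp_ite, wp_when]
  simp only [ne_eq, OfNat.ofNat_ne_zero, not_false_eq_true, Ex.Ok, Nat.zero_le, Ex.eval, Ex.cost,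
    Cn.eq_ok, Cn.eq_holds, Cn.eq_cost, Cn.lt_ok, Cn.lt_holds, Cn.lt_cost, true_and,
    Function.update_self, Function.update_idem, Nat.reduceLT, h11, h12,
    Function.update_of_ne, OfNat.ofNat_eq_ofNat, Nat.reduceEqDiff, and_true, true_and]
  grind

/-- One round of forcing on the colouring in array `6`. -/
def roundCmd : Cmd :=
  .for 7 (.set 11 (.c 0) ;; .set 12 (.c 0) ;; .set 13 (.c 0) ;;
    .for 8 (.when (.adj (.v 7) (.v 8))
      (.ite (.eq (.get 6 (.v 8)) (.c 1)) (.inc 11)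
      (.ite (.eq (.get 6 (.v 8)) (.c 2)) (.inc 12)
      (.when (.eq (.get 6 (.v 8)) (.c 0)) (.inc 13))))) ;;
    voteCmd ;;
    .put 7 (.v 7) (.v 9) ;;
    pullCmd ;;
    .put 8 (.v 7) (.v 9)) ;;
  -- Votes and pulls were stored before any colour changes, so the round is parallel. A nonzero vote
  -- overrides the pull, and the last voting neighbour wins.
  .for 7 (.when (.eq (.get 6 (.v 7)) (.c 0))
    (.set 9 (.get 8 (.v 7)) ;;
    .for 8 (.when (.adj (.v 7) (.v 8)) (.when (.lt (.c 0) (.get 7 (.v 8)))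
      (.set 9 (.get 7 (.v 8))))) ;;
    .put 6 (.v 7) (.v 9)))

open Classical in
theorem roundCmd_spec (B : BG n A s) {w a t} {Q : St → Prop}
    (hQ : ∀ w' a' t', Fr [7, 8, 9, 11, 12, 13] [6, 7, 8] w a w' a' → Round n A (a 6) (a' 6) →
      t' ≤ t + 200 * (n * n) + 500 * n + 100 → Q ⟨w', a', t'⟩) :
    wp n A roundCmd Q ⟨w, a, t⟩ := by
  refine wp_for_const (by decide) (fun i w' a' => Fr [7, 8, 9, 11, 12, 13] [7, 8] w a w' a' ∧
    ∀ v < i, a' 7 v = vote n A (a 6) v ∧ a' 8 v = pull n A (a 6) v) (100 * n + 200) ?_ ?_ ?_ ?_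
  · exact fun i w a y h => ⟨h.1.set (by decide), h.2⟩
  · exact ⟨Fr.rfl, by simp⟩
  · rintro v w1 a1 t1 hv hn1 hv7 ⟨hF, h1⟩
    have h6 := hF.arr 6 (by decide)
    simp only [wp_seq, wp_set, wp_put]
    refine ⟨by decide, by simp, by decide, by simp, by decide, by simp, ?_⟩
    refine wp_for_const (by decide) (fun i w' a' => Fr [8, 11, 12, 13] [] w1 a1 w' a' ∧
      w' 11 = Nat.count (fun z => A v z ∧ a 6 z = 1) i ∧
      w' 12 = Nat.count (fun z => A v z ∧ a 6 z = 2) i ∧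
      w' 13 = Nat.count (fun z => A v z ∧ a 6 z = 0) i) 90 ?_ ?_ ?_ ?_
    · rintro i w a y ⟨h, h2⟩
      exact ⟨h.set (by decide), by simpa using h2⟩
    · exact ⟨((Fr.rfl.set (by decide)).set (by decide)).set (by decide), by simp⟩
    · rintro z w2 a2 t2 hz hn2 hz8 ⟨hF2, h11, h12, h13⟩
      have h7 := (hF2.var 7 (by decide)).trans hv7
      have h6' := (hF2.arr 6 (by decide)).trans h6
      have hle : ∀ k, Nat.count (fun z => A v z ∧ a 6 z = k) z + 1 ≤ n + 9 := fun k => by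
        have := Nat.count_le (p := fun z => A v z ∧ a 6 z = k) (n := z)
        omega
      have g11 : ∀ {k}, Fr [8, 11, 12, 13] [] w1 a1 (Function.update w2 11 k) a2 :=
        hF2.set (by decide)
      have g12 : ∀ {k}, Fr [8, 11, 12, 13] [] w1 a1 (Function.update w2 12 k) a2 :=
        hF2.set (by decide)
      have g13 : ∀ {k}, Fr [8, 11, 12, 13] [] w1 a1 (Function.update w2 13 k) a2 :=
        hF2.set (by decide)
      simp [hz8, h7, h6', hv, hz, h11, h12, h13, Nat.count_succ, hle, hF2, g11, g12, g13]
      by_cases hA : A v z <;> simp [hA]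
      by_cases c1 : a 6 z = 1 <;> simp [c1]
      by_cases c2 : a 6 z = 2 <;> simp [c2]
    · rintro w2 a2 t2 hn2 - ⟨hF2, h11, h12, h13⟩ ht
      have h7 := (hF2.var 7 (by decide)).trans hv7
      have h6' := (hF2.arr 6 (by decide)).trans h6
      change w2 11 = nb n A (a 6) 1 v at h11
      change w2 12 = nb n A (a 6) 2 v at h12
      change w2 13 = nb n A (a 6) 0 v at h13
      have hF3 : Fr [7, 8, 9, 11, 12, 13] [7, 8] w a w2 a2 :=
        hF.trans (hF2.mono (by decide) (by decide))
      have g7 := hF2.arr 7 (by decide)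
      have g8 := hF2.arr 8 (by decide)
      refine voteCmd_spec h7 (h6' ▸ h11) (h6' ▸ h12) (h6' ▸ h13) fun t3 ht3 => ?_
      refine ⟨by decide, by simp, by simp, ?_⟩
      refine pullCmd_spec (v := v) (c := a 6) (by simp [h11]) (by simp [h12]) fun t4 ht4 => ?_
      simp [h7, -Order.lt_add_one_iff]
      refine ⟨⟨((hF3.set (by decide)).put (by decide)).put (by decide),
        fun u hu => ?_⟩, ?_⟩
      · simp only [Function.update_apply]
        split_ifs with huv
        · rw [huv, h6']; exact ⟨rfl, rfl⟩
        · rw [g7, g8]; exact h1 u (by omega)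
      · simp at ht ht3 ht4
        linarith
  · rintro w1 a1 t1 hn1 - ⟨hF, h1⟩ ht1
    refine wp_for_const (by decide) (fun i w' a' => Fr [7, 8, 9] [6] w1 a1 w' a' ∧
      (∀ v, i ≤ v → a' 6 v = a 6 v) ∧ ∀ v < i, (a 6 v ≠ 0 → a' 6 v = a 6 v) ∧ (a 6 v = 0 →
      (∃ z, A v z ∧ vote n A (a 6) z ≠ 0 ∧ a' 6 v = vote n A (a 6) z) ∨
      ((∀ z, A v z → vote n A (a 6) z = 0) ∧ a' 6 v = pull n A (a 6) v))) (100 * n + 200)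
      ?_ ?_ ?_ ?_
    · exact fun i w a y h => ⟨h.1.set (by decide), h.2⟩
    · exact ⟨Fr.rfl, by simp [hF.arr 6 (by decide)], by simp⟩
    · rintro v w2 a2 t2 hv hn2 hv7 ⟨hF2, hv6, h2⟩
      have g7 := hF2.arr 7 (by decide)
      have g8 := hF2.arr 8 (by decide)
      have e6 := hv6 v le_rfl
      simp only [wp_when, wp_seq, wp_set]
      simp only [Cn.eq_ok, Ex.Ok, Cn.eq_holds, Ex.eval, hv7, Cn.eq_cost, Ex.cost, e6, g8,
        (h1 v hv).2]
      refine ⟨by simp, fun h0 => ⟨by decide, by simp, ?_⟩, fun h0 => ⟨trivial, ⟨hF2, fun u hu =>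
        hv6 u (by omega), fun u hu => ?_⟩, by linarith⟩⟩
      swap
      · rcases Nat.lt_succ_iff_lt_or_eq.1 hu with hu | rfl
        · exact h2 u hu
        · exact ⟨fun _ => e6, fun h => absurd h h0⟩
      refine wp_for_const (by decide) (fun i w' a' => Fr [8, 9] [] w2 a2 w' a' ∧
        ((∃ z, A v z ∧ vote n A (a 6) z ≠ 0 ∧ w' 9 = vote n A (a 6) z) ∨
        ((∀ z < i, A v z → vote n A (a 6) z = 0) ∧ w' 9 = pull n A (a 6) v))) 60 ?_ ?_ ?_ ?_
      · rintro i w a y ⟨h, h2⟩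
        exact ⟨h.set (by decide), by simpa using h2⟩
      · exact ⟨Fr.rfl.set (by decide), by simp⟩
      · rintro z w3 a3 t3 hz hn3 hz8 ⟨hF3, h3⟩
        have h7 := (hF3.var 7 (by decide)).trans hv7
        have h7' := (congrFun ((hF3.arr 7 (by decide)).trans g7) z).trans (h1 z hz).1
        have hF4 : ∀ {k}, Fr [8, 9] [] w2 a2 (Function.update w3 9 k) a3 := hF3.set (by decide)
        simp [hz8, h7, h7', hv, hz, hF3, hF4, -Order.lt_add_one_iff, Nat.forall_lt_succ_right]
        grind
      · rintro w3 a3 t3 hn3 - ⟨hF3, h3⟩ ht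
        have h7 := (hF3.var 7 (by decide)).trans hv7
        have h6' := hF3.arr 6 (by decide)
        simp [h7, -Order.lt_add_one_iff]
        refine ⟨⟨(hF2.trans (hF3.mono (by decide) (by decide))).put (by decide), fun u hu => ?_,
          fun u hu => ?_⟩, ?_⟩
        · rw [Function.update_of_ne (by omega), h6']; exact hv6 u (by omega)
        · by_cases huv : u = v
          · subst huv
            refine ⟨fun h => absurd h0 h, fun _ => ?_⟩
            rw [Function.update_self]
            refine h3.imp id fun h => ⟨fun z hz => h.1 z (B.lt' hz) hz, h.2⟩
          · rw [Function.update_of_ne huv, h6']; exact h2 u (by omega)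
        · linarith
    · rintro w2 a2 t2 hn2 - ⟨hF2, -, h2⟩ ht
      exact hQ _ _ _ ((hF.mono (by decide) (by decide)).trans (hF2.mono (by decide) (by decide)))
        h2 (by linarith)

end PMCut


/-! ### Exhaustive completion of colourings, and the search for cuts of the second kind. -/

namespace PMCut

variable {n : ℕ} {A : ℕ → ℕ → Prop} {s : ℕ → Prop}

/-- The answer in variable `1` is a bit, and it is `1` only if there is a perfect matching-cut. -/
def Ans (n : ℕ) (A : ℕ → ℕ → Prop) (w : ℕ → ℕ) : Prop := w 1 = 0 ∨ w 1 = 1 ∧ HasCut n A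

theorem Ans.congr {w w' : ℕ → ℕ} (h : Ans n A w) (h' : w' 1 = w 1) : Ans n A w' := by
  rwa [Ans, h']

theorem count_eq_one (B : BG n A s) {p : ℕ → Prop} {v : ℕ}
    [DecidablePred fun z => A v z ∧ p z] :
    Nat.count (fun z => A v z ∧ p z) n = 1 ↔ ∃! z, A v z ∧ p z := by
  classical
  rw [count_eq_card, Finset.card_eq_one]
  constructor
  · rintro ⟨z, hz⟩
    rw [Finset.ext_iff] at hz
    simp only [Finset.mem_filter, Finset.mem_range, Finset.mem_singleton] at hz
    exact ⟨z, ((hz z).2 rfl).2, fun y hy => (hz y).1 ⟨B.lt' hy.1, hy⟩⟩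
  · rintro ⟨z, hz, h⟩
    refine ⟨z, Finset.ext fun y => ?_⟩
    simp only [Finset.mem_filter, Finset.mem_range, Finset.mem_singleton]
    exact ⟨fun hy => h y hy.2, by rintro rfl; exact ⟨B.lt' hz.1, hz⟩⟩

/-- Set the answer to `1` if each vertex has exactly one neighbour of another colour. -/
def checkCmd : Cmd :=
  .set 14 (.c 1) ;;
  .for 7 (.set 11 (.c 0) ;;
    .for 8 (.when (.adj (.v 7) (.v 8))
      (.ite (.eq (.get 6 (.v 8)) (.get 6 (.v 7))) .skip (.inc 11))) ;;
    .ite (.eq (.v 11) (.c 1)) .skip (.set 14 (.c 0))) ;;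
  .when (.eq (.v 14) (.c 1)) (.set 1 (.c 1))

-- Nothing is assumed about array `6`: a colouring that passes is a certificate by
-- `hasCut_of_colouring`.
open Classical in
theorem checkCmd_spec (B : BG n A s) (hn : 0 < n) {w a t} {Q : St → Prop} (hw : Ans n A w)
    (hQ : ∀ w' t', Fr [1, 7, 8, 11, 14] [] w a w' a → Ans n A w' →
      (w 1 = 1 ∨ (∀ v < n, ∃! z, A v z ∧ a 6 z ≠ a 6 v) → w' 1 = 1) →
      t' ≤ t + 100 * (n * n) + 100 * n + 100 → Q ⟨w', a, t'⟩) :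
    wp n A checkCmd Q ⟨w, a, t⟩ := by
  simp only [checkCmd, wp_seq, wp_set]
  refine ⟨by decide, by simp, ?_⟩
  refine wp_for_const (by decide) (fun i w' a' => Fr [7, 8, 11, 14] [] w a w' a' ∧ a' = a ∧
    (w' 14 = 1 ↔ ∀ v < i, ∃! z, A v z ∧ a 6 z ≠ a 6 v)) (100 * n + 50) ?_ ?_ ?_ ?_
  · rintro i w a y ⟨h, h2⟩
    exact ⟨h.set (by decide), by simpa using h2⟩
  · exact ⟨Fr.rfl.set (by decide), rfl, by simp⟩
  · rintro v w1 a1 t1 hv hn1 hv7 ⟨hF, rfl, h1⟩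
    simp only [wp_seq, wp_set]
    refine ⟨by decide, by simp, ?_⟩
    refine wp_for_const (by decide) (fun i w' a' => Fr [8, 11] [] w1 a1 w' a' ∧ a' = a1 ∧
      w' 11 = Nat.count (fun z => A v z ∧ a1 6 z ≠ a1 6 v) i) 60 ?_ ?_ ?_ ?_
    · rintro i w a y ⟨h, h2⟩
      exact ⟨h.set (by decide), by simpa using h2⟩
    · exact ⟨Fr.rfl.set (by decide), rfl, by simp⟩
    · rintro z w2 a2 t2 hz hn2 hz8 ⟨hF2, rfl, h11⟩
      have h7 := (hF2.var 7 (by decide)).trans hv7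
      have hle : Nat.count (fun z => A v z ∧ a2 6 z ≠ a2 6 v) z + 1 ≤ n + 9 := by
        have := Nat.count_le (p := fun z => A v z ∧ a2 6 z ≠ a2 6 v) (n := z)
        omega
      have g11 : ∀ {k}, Fr [8, 11] [] w1 a2 (Function.update w2 11 k) a2 := hF2.set (by decide)
      simp only [ne_eq] at hle
      simp [hz8, h7, hv, hz, h11, Nat.count_succ, hF2, g11, hle]
      by_cases hA : A v z <;> simp [hA]
    · rintro w2 a2 t2 hn2 - ⟨hF2, rfl, h11⟩ ht
      have h7 := (hF2.var 7 (by decide)).trans hv7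
      have h14 := hF2.var 14 (by decide)
      have hF3 : Fr [7, 8, 11, 14] [] w a2 w2 a2 := hF.trans (hF2.mono (by decide) (by decide))
      have h11' : w2 11 = 1 ↔ ∃! z, A v z ∧ a2 6 z ≠ a2 6 v := by
        rw [h11]; exact count_eq_one B
      have g14 : ∀ {k}, Fr [7, 8, 11, 14] [] w a2 (Function.update w2 14 k) a2 :=
        hF3.set (by decide)
      simp only [Ex.cost] at ht
      simp only [wp_ite, wp_skip, wp_set]
      simp [h7, -Order.lt_add_one_iff, Nat.forall_lt_succ_right, hF3, g14, h14]
      refine ⟨fun h => ⟨?_, by linarith⟩, fun h => ⟨?_, by linarith⟩⟩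
      · rw [h1]
        simp only [h11', ne_eq] at h ⊢
        simp [h]
      · intro _
        simpa only [h11', ne_eq] using h
  · rintro w1 a1 t1 hn1 - ⟨hF, rfl, h1⟩ ht
    have h01 := hF.var 1 (by decide)
    have hF' : Fr [1, 7, 8, 11, 14] [] w a1 w1 a1 := hF.mono (by decide) (by decide)
    simp only [Ex.cost] at ht
    simp only [wp_when, wp_set]
    refine ⟨by simp, fun h => ⟨by decide, by simp, ?_⟩, fun h => ?_⟩
    · refine hQ _ _ (hF'.set (by decide)) (.inr ⟨by simp, ?_⟩) (fun _ => by simp) ?_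
      · exact hasCut_of_colouring B hn (c := a1 6) (h1.1 h)
      · simp; linarith
    · refine hQ _ _ hF' (hw.congr h01) ?_ ?_
      · rintro (h2 | h2)
        · rw [h01, h2]
        · exact absurd (h1.2 h2) h
      · simp; linarith

/-- Try all ways of colouring up to `k` uncoloured vertices. -/
def tryCmd : ℕ → Cmd
  | 0 => checkCmd
  | k + 1 =>
    -- The recursion is unrolled in the program text, so each depth has its own variable. The value
    -- `n` means that no uncoloured vertex was found.
    .set (21 + k) (.v 0) ;;
    .for 8 (.when (.eq (.get 6 (.v 8)) (.c 0)) (.set (21 + k) (.v 8))) ;;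
    .ite (.lt (.v (21 + k)) (.v 0))
      (.put 6 (.v (21 + k)) (.c 1) ;; tryCmd k ;; .put 6 (.v (21 + k)) (.c 2) ;; tryCmd k ;;
        .put 6 (.v (21 + k)) (.c 0))
      checkCmd

/-- A bound for the running time of `tryCmd`. -/
def tryTime (n : ℕ) : ℕ → ℕ
  | 0 => 100 * (n * n) + 100 * n + 100
  | k + 1 => 2 * tryTime n k + 100 * n + 100

/-- The variables changed by `tryCmd`. -/
def tryVars (k : ℕ) : List ℕ := [1, 7, 8, 11, 14] ++ (List.range k).map (21 + ·)

theorem tryVars_mono (k : ℕ) : tryVars k ⊆ tryVars (k + 1) := by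
  intro x hx
  simp only [tryVars, List.mem_append, List.mem_map, List.mem_range] at hx ⊢
  rcases hx with hx | ⟨j, hj, rfl⟩
  · exact .inl hx
  · exact .inr ⟨j, by omega, rfl⟩

theorem mem_tryVars (k : ℕ) : 21 + k ∈ tryVars (k + 1) := by
  simp [tryVars]

theorem not_mem_tryVars (k : ℕ) : 21 + k ∉ tryVars k := by
  simp [tryVars]; omega

theorem base_subset_tryVars (k : ℕ) : [1, 7, 8, 11, 14] ⊆ tryVars k := by
  intro x hx
  exact List.mem_append_left _ hx

theorem le_tryTime (n k : ℕ) : 100 * (n * n) + 100 * n + 100 ≤ tryTime n k := by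
  induction k with
  | zero => rfl
  | succ k ih => simp only [tryTime]; omega

theorem ext_full {c g : ℕ → ℕ} (B : BG n A s) (hg : Good n A g) (hc : Ext n c g)
    (h : ∀ v < n, c v ≠ 0) : ∀ v < n, ∃! z, A v z ∧ c z ≠ c v := by
  intro v hv
  obtain ⟨z, z1, z2⟩ := hg.ex v hv
  have e : ∀ u < n, c u = g u := fun u hu => hc u hu (h u hu)
  refine ⟨z, ⟨z1, by rwa [e z (B.lt' z1), e v hv]⟩, ?_⟩
  rintro y ⟨y1, y2⟩
  rw [e y (B.lt' y1), e v hv] at y2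
  exact hg.uniq y1 z1 y2 z2

-- The array is returned unchanged, since the branching vertex is uncoloured again at the end.
-- Completeness follows the branch that gives this vertex its colour under `g`.
open Classical in
theorem tryCmd_spec (B : BG n A s) (hn : 0 < n) (k : ℕ) {w a t} {Q : St → Prop} (hw0 : w 0 = n)
    (hw : Ans n A w)
    (hQ : ∀ w' t', Fr (tryVars k) [] w a w' a → Ans n A w' →
      (w 1 = 1 ∨ (∃ g, Good n A g ∧ Ext n (a 6) g ∧ Nat.count (fun v => a 6 v = 0) n ≤ k) →
        w' 1 = 1) →
      t' ≤ t + tryTime n k → Q ⟨w', a, t'⟩) :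
    wp n A (tryCmd k) Q ⟨w, a, t⟩ := by
  induction k generalizing w a t Q with
  | zero =>
    refine checkCmd_spec B hn hw fun w' t' hF h1 h2 ht =>
      hQ w' t' (hF.mono (base_subset_tryVars 0) (by simp)) h1 (fun h => h2 (h.imp id ?_))
      (by simp only [tryTime]; omega)
    rintro ⟨g, hg, hc, hk⟩
    refine ext_full B hg hc fun v hv h0 => ?_
    have : 0 < Nat.count (fun v => a 6 v = 0) n := by
      rw [count_eq_card, Finset.card_pos]
      exact ⟨v, by simp [hv, h0]⟩
    omega
  | succ k ih =>
    have hx : 21 + k ≠ 0 := by omega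
    have h8 : 8 ≠ 21 + k := by omega
    simp only [tryCmd, wp_seq, wp_set]
    refine ⟨hx, trivial, ?_⟩
    simp only [Ex.eval, Ex.cost]
    refine wp_for_const (by decide) (fun i w' a' => Fr (tryVars (k + 1)) [] w a w' a' ∧ a' = a ∧
      w' 1 = w 1 ∧
      ((w' (21 + k) = n ∧ ∀ v < i, a 6 v ≠ 0) ∨ (w' (21 + k) < n ∧ a 6 (w' (21 + k)) = 0)))
      40 ?_ ?_ ?_ ?_
    · rintro i w a y ⟨h, h2⟩
      refine ⟨h.set (base_subset_tryVars _ (by decide)), ?_⟩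
      simpa [Function.update_of_ne h8.symm] using h2
    · refine ⟨Fr.rfl.set (mem_tryVars k), rfl, ?_, .inl ⟨?_, by simp⟩⟩
      · exact Function.update_of_ne (by omega) _ _
      · simp [hw0]
    · rintro z w1 a1 t1 hz hn1 hz8 ⟨hF, rfl, h1, h2⟩
      have hF' : ∀ {l}, Fr (tryVars (k + 1)) [] w a1 (Function.update w1 (21 + k) l) a1 :=
        hF.set (mem_tryVars k)
      simp only [wp_when, wp_set]
      simp [hz8, hz, hF, hF', Function.update_of_ne h8, h1, -Order.lt_add_one_iff,
        Nat.forall_lt_succ_right, Function.update_of_ne (show 1 ≠ 21 + k by omega)]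
      grind
    · rintro w1 a1 t1 hn1 - ⟨hF, rfl, h1, h2⟩ ht
      simp only [wp_ite]
      refine ⟨by simp, fun h => ?_, fun h => ?_⟩
      swap
      · simp only [Cn.lt_holds, Ex.eval, hn1] at h
        have h2' := h2.resolve_right fun h' => h h'.1
        refine checkCmd_spec B hn (hw.congr h1) fun w' t' hF2 h3 h4 ht' =>
          hQ w' t' (hF.trans (hF2.mono (base_subset_tryVars _) (by simp))) h3 (fun h => h4 ?_) ?_
        · rw [h1]
          refine h.imp id ?_
          rintro ⟨g, hg, hc, -⟩
          exact ext_full B hg hc h2'.2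
        · have := le_tryTime n k
          simp at ht ht' ⊢
          simp only [tryTime]
          omega
      · simp only [Cn.lt_holds, Ex.eval, hn1] at h
        have h0 := (h2.resolve_left fun h' => by omega).2
        set p := w1 (21 + k) with hp
        have dec : ∀ j g, Good n A g → Ext n (a1 6) g → Nat.count (fun v => a1 6 v = 0) n ≤ k + 1 →
            g p = j → Ext n (Function.update (a1 6) p j) g ∧
              Nat.count (fun v => Function.update (a1 6) p j v = 0) n ≤ k := by
          rintro j g hg hc hk rfl
          refine ⟨fun v hv hv0 => ?_, ?_⟩
          · rw [Function.update_apply] at hv0 ⊢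
            split_ifs at hv0 ⊢ with hvp
            · rw [hvp]
            · exact hc v hv hv0
          · have hlt : Nat.count (fun v => Function.update (a1 6) p (g p) v = 0) n <
                Nat.count (fun v => a1 6 v = 0) n := by
              rw [count_eq_card, count_eq_card]
              refine Finset.card_lt_card (Finset.ssubset_iff_of_subset ?_ |>.2 ⟨p, ?_, ?_⟩)
              · intro v
                simp only [Finset.mem_filter, Finset.mem_range, Function.update_apply]
                rintro ⟨h1, h2⟩
                split_ifs at h2 with hvp
                · exact ⟨h1, by rw [hvp, h0]⟩
                · exact ⟨h1, h2⟩
              · simp [h, h0]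
              · simp only [Finset.mem_filter, Finset.mem_range, Function.update_self]
                rcases hg.val p with h | h <;> omega
            omega
        simp only [wp_seq, wp_put]
        refine ⟨by decide, trivial, by simp, ?_⟩
        refine ih hn1 (hw.congr h1) fun w2 t2 hF2 hw2 h3 ht2 => ?_
        have p2 : w2 (21 + k) = p := hF2.var _ (not_mem_tryVars k)
        refine ⟨by decide, trivial, by simp, ?_⟩
        refine ih ((hF2.var 0 (by simp [tryVars])).trans hn1) hw2 fun w3 t3 hF3 hw3 h4 ht3 => ?_
        have p3 : w3 (21 + k) = p := (hF3.var _ (not_mem_tryVars k)).trans p2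
        simp only [wp_put]
        refine ⟨by decide, trivial, by simp, ?_⟩
        simp only [Ex.eval, p2, p3, ← hp, Function.update_idem, Function.update_self] at h3 h4 ⊢
        have e6 : Function.update a1 6 (Function.update (a1 6) p 0) = a1 := by
          rw [← h0, Function.update_eq_self, Function.update_eq_self]
        rw [e6]
        refine hQ _ _ ?_ hw3 ?_ ?_
        · have f1 : Fr (tryVars (k + 1)) [] w1 a1 w2 a1 :=
            ⟨fun y hy => hF2.var y fun h => hy (tryVars_mono k h), fun _ _ => rfl⟩
          have f2 : Fr (tryVars (k + 1)) [] w2 a1 w3 a1 :=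
            ⟨fun y hy => hF3.var y fun h => hy (tryVars_mono k h), fun _ _ => rfl⟩
          exact hF.trans (f1.trans f2)
        · rintro (h5 | ⟨g, hg, hc, hk⟩)
          · exact h4 (.inl (h3 (.inl (h1.trans h5))))
          · rcases hg.val p with hgp | hgp
            · exact h4 (.inl (h3 (.inr ⟨g, hg, dec 1 g hg hc hk hgp⟩)))
            · exact h4 (.inr ⟨g, hg, dec 2 g hg hc hk hgp⟩)
        · simp at ht ht2 ht3 ⊢
          simp only [tryTime]
          omega

/-- Search for a perfect matching-cut all of whose matching edges join different classes. -/
def fullCmd : Cmd :=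
  .for 2 (.when (.adj (.c 0) (.v 2)) (
    -- Any neighbour `q ≠ y` of `0` will do: it has the colour of `0`, as `y` is the only neighbour
    -- of `0` of the other colour. So only `y` and the mate of `q` have to be guessed.
    .set 3 (.v 0) ;;
    .for 8 (.when (.adj (.c 0) (.v 8)) (.ite (.eq (.v 8) (.v 2)) .skip (.set 3 (.v 8)))) ;;
    .when (.lt (.v 3) (.v 0)) (
      .for 4 (.when (.adj (.v 3) (.v 4)) (.ite (.eq (.v 4) (.c 0)) .skip (
        initCmd ;; roundCmd ;; roundCmd ;; tryCmd 8))))))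

theorem tryTime_eight (n : ℕ) : tryTime n 8 ≤ 60000 * (n * n) + 60000 * n + 60000 := by
  simp only [tryTime]; omega

/-- The variables changed by `fullCmd`. -/
def fullVars : List ℕ := [1, 2, 3, 4, 7, 8, 9, 11, 12, 13, 14, 21, 22, 23, 24, 25, 26, 27, 28]

theorem guessCmd_spec (B : BG n A s) (hn : 0 < n) {w a t} {Q : St → Prop} {y q x : ℕ}
    (hy : A 0 y) (hx : A q x) (wn : w 0 = n) (wy : w 2 = y) (wq : w 3 = q) (wx : w 4 = x)
    (hw : Ans n A w)
    (hQ : ∀ w' a' t', Fr (fullVars.filter fun x => x ≠ 2 ∧ x ≠ 3 ∧ x ≠ 4) [6, 7, 8] w a w' a' →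
      Ans n A w' → (w 1 = 1 ∨ (∃ g, Good n A g ∧ g 0 = 1 ∧ g y = 2 ∧ A 0 q ∧ g q = 1 ∧ g x = 2) →
        w' 1 = 1) →
      t' ≤ t + 70000 * (n * n) + 70000 * n + 70000 → Q ⟨w', a', t'⟩) :
    wp n A (initCmd ;; roundCmd ;; roundCmd ;; tryCmd 8) Q ⟨w, a, t⟩ := by
  simp only [wp_seq]
  refine initCmd_spec hn (B.lt' hy) (B.lt hx) (B.lt' hx) wy wq wx fun w1 a1 t1 hF1 h1 ht1 => ?_
  refine roundCmd_spec B fun w2 a2 t2 hF2 h2 ht2 => ?_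
  refine roundCmd_spec B fun w3 a3 t3 hF3 h3 ht3 => ?_
  have hF : Fr [7, 8, 9, 11, 12, 13] [6, 7, 8] w a w3 a3 :=
    ((hF1.mono (by decide) (by decide)).trans hF2).trans hF3
  have e1 := hF.var 1 (by decide)
  refine tryCmd_spec B hn 8 ((hF.var 0 (by decide)).trans wn) (hw.congr e1)
    fun w4 t4 hF4 h4 h5 ht4 => ?_
  refine hQ _ _ _ ((hF.mono (by decide) (by decide)).trans (hF4.mono (by decide) (by decide)))
    h4 (fun h => h5 ?_) ?_
  · rw [e1]
    refine h.imp id ?_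
    rintro ⟨g, hg, g0, gy, hq, gq, gx⟩
    have ext0 : Ext n (a1 6) g := by
      intro v hv
      rw [h1 v hv]
      exact init_ext B hg g0 gy gq gx hy hx v hv
    refine ⟨g, hg, (h3.ext B hg (h2.ext B hg ext0)), ?_⟩
    refine (card_uncoloured B hg ext0 (fun v hv h0 k hk => ?_) h2 h3).trans' (le_of_eq ?_)
    · rw [h1 v hv] at h0
      obtain ⟨t, ht, htk⟩ := init_nb B hg g0 gy gq gx hy hq hx v hv h0 k hk
      exact ⟨t, ht, by rw [h1 t (B.lt' ht), htk]⟩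
    · congr
  · have := tryTime_eight n
    omega

theorem fullCmd_spec (B : BG n A s) (hn : 0 < n) {w a t} {Q : St → Prop}
    (hw : Ans n A w)
    (hQ : ∀ w' a' t', Fr fullVars [6, 7, 8] w a w' a' → Ans n A w' →
      (w 1 = 1 ∨ (∃ g, Good n A g ∧ g 0 = 1 ∧ ∃ y q, A 0 y ∧ g y = 2 ∧ A 0 q ∧ q ≠ y) →
        w' 1 = 1) →
      t' ≤ t + 1000000 * n ^ 4 → Q ⟨w', a', t'⟩) :
    wp n A fullCmd Q ⟨w, a, t⟩ := by
  refine wp_for_const (by decide) (fun i w' a' => Fr fullVars [6, 7, 8] w a w' a' ∧ Ans n A w' ∧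
    (w 1 = 1 → w' 1 = 1) ∧ ((∃ g, Good n A g ∧ g 0 = 1 ∧ ∃ y < i, ∃ q, A 0 y ∧ g y = 2 ∧ A 0 q ∧
      q ≠ y) → w' 1 = 1)) (70000 * (n * (n * n)) + 70000 * (n * n) + 71000 * n + 1000) ?_ ?_ ?_ ?_
  · rintro i w a y ⟨h, h2⟩
    exact ⟨h.set (by decide), by simpa [Ans] using h2⟩
  · exact ⟨Fr.rfl, hw, id, by simp⟩
  · rintro y w1 a1 t1 hy hn1 hy2 ⟨hF, hw1, h1, h2⟩
    simp only [wp_when, wp_seq, wp_set]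
    simp only [Cn.adj_ok, Ex.Ok, Cn.adj_holds, Ex.eval, hy2, Cn.adj_cost, Ex.cost]
    refine ⟨⟨by omega, trivial, hn, hy⟩, fun h0y => ⟨by decide, trivial, ?_⟩, fun h0y =>
      ⟨trivial, ⟨hF, hw1, h1, ?_⟩, by omega⟩⟩
    swap
    · rintro ⟨g, hg, g0, y', hy', q, q1, q2, q3⟩
      refine h2 ⟨g, hg, g0, y', ?_, q, q1, q2, q3⟩
      rcases Nat.lt_succ_iff_lt_or_eq.1 hy' with h | rfl
      · exact h
      · exact absurd q1 h0y
    refine wp_for_const (by decide) (fun i w' a' => Fr [3, 8] [] w1 a1 w' a' ∧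
      ((w' 3 = n ∧ ∀ q < i, A 0 q → q = y) ∨ (A 0 (w' 3) ∧ w' 3 ≠ y))) 60 ?_ ?_ ?_ ?_
    · rintro i w a y ⟨h, h2⟩
      exact ⟨h.set (by decide), by simpa using h2⟩
    · exact ⟨Fr.rfl.set (by decide), by simp [hn1]⟩
    · rintro z w2 a2 t2 hz hn2 hz8 ⟨hF2, h3⟩
      have e2 := (hF2.var 2 (by decide)).trans hy2
      have g3 : ∀ {k}, Fr [3, 8] [] w1 a1 (Function.update w2 3 k) a2 := hF2.set (by decide)
      simp [hz8, hn, hz, e2, hF2, g3, -Order.lt_add_one_iff, Nat.forall_lt_succ_right]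
      grind
    · rintro w2 a2 t2 hn2 - ⟨hF2, h3⟩ ht2
      have e2 := (hF2.var 2 (by decide)).trans hy2
      have e1 := hF2.var 1 (by decide)
      have hF3 : Fr fullVars [6, 7, 8] w a w2 a2 := hF.trans (hF2.mono (by decide) (by decide))
      simp only [wp_when]
      simp only [Cn.lt_ok, Cn.lt_holds, Ex.Ok, Ex.eval, hn2, Cn.lt_cost, Ex.cost]
      refine ⟨⟨trivial, trivial⟩, fun hq => ?_, fun hq =>
        ⟨e2, ⟨hF3, hw1.congr e1, fun h => e1.trans (h1 h), ?_⟩, by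
          have := Nat.zero_le (n * (n * n))
          have := Nat.zero_le (n * n)
          linarith⟩⟩
      swap
      · rintro ⟨g, hg, g0, y', hy', q, q1, q2, q3, q4⟩
        rw [e1]
        refine h2 ⟨g, hg, g0, y', ?_, q, q1, q2, q3, q4⟩
        rcases Nat.lt_succ_iff_lt_or_eq.1 hy' with h | rfl
        · exact h
        · rcases h3 with ⟨-, h3⟩ | ⟨h3, -⟩
          · exact absurd (h3 q (B.lt' q3) q3) q4
          · exact absurd (B.lt' h3) hq
      set q := w2 3 with hqdef
      have h3' := h3.resolve_left fun h => by omega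
      refine wp_for_const (by decide) (fun i w' a' =>
        Fr (fullVars.filter fun x => x ≠ 2 ∧ x ≠ 3) [6, 7, 8] w2 a2 w' a' ∧ Ans n A w' ∧
        (w2 1 = 1 → w' 1 = 1) ∧
        ((∃ g, Good n A g ∧ g 0 = 1 ∧ g y = 2 ∧ A 0 q ∧ g q = 1 ∧ ∃ x < i, A q x ∧ g x = 2) →
          w' 1 = 1)) (70000 * (n * n) + 70000 * n + 70900) ?_ ?_ ?_ ?_
      · rintro i w a y ⟨h, h2⟩
        exact ⟨h.set (by decide), by simpa [Ans] using h2⟩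
      · exact ⟨Fr.rfl, hw1.congr e1, id, by simp⟩
      · rintro x w3 a3 t3 hx hn3 hx4 ⟨hF4, hw3, h4, h5⟩
        have e3 : w3 3 = q := hF4.var 3 (by decide)
        have e2' := (hF4.var 2 (by decide)).trans e2
        have keep : (¬ A q x ∨ x = 0) → (∃ g, Good n A g ∧ g 0 = 1 ∧ g y = 2 ∧ A 0 q ∧ g q = 1 ∧
            ∃ x' < x + 1, A q x' ∧ g x' = 2) → w3 1 = 1 := by
          rintro hor ⟨g, hg, g0, gy, hq, gq, x', hx', hqx, gx⟩
          refine h5 ⟨g, hg, g0, gy, hq, gq, x', ?_, hqx, gx⟩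
          rcases Nat.lt_succ_iff_lt_or_eq.1 hx' with h | rfl
          · exact h
          · rcases hor with h | rfl
            · exact absurd hqx h
            · omega
        simp only [wp_when, wp_ite, wp_skip]
        simp only [Cn.adj_ok, Ex.Ok, Cn.adj_holds, Ex.eval, hx4, e3, Cn.adj_cost, Ex.cost,
          Cn.eq_ok, Cn.eq_holds, Cn.eq_cost]
        refine ⟨⟨trivial, trivial, hq, hx⟩, fun hqx => ⟨⟨trivial, by omega⟩, fun hx0 =>
          ⟨trivial, ⟨hF4, hw3, h4, keep (.inr hx0)⟩, by omega⟩, fun hx0 => ?_⟩, fun hqx =>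
          ⟨trivial, ⟨hF4, hw3, h4, keep (.inl hqx)⟩, by omega⟩⟩
        refine guessCmd_spec B hn h0y hqx hn3 e2' e3 hx4 hw3 fun w4 a4 t4 hF5 hw4 h6 ht4 =>
          ⟨(hF5.var 4 (by decide)).trans hx4,
            ⟨hF4.trans (hF5.mono (by decide) (by decide)), hw4, fun h => h6 (.inl (h4 h)), ?_⟩,
            by linarith⟩
        rintro ⟨g, hg, g0, gy, hq, gq, x', hx', hqx', gx⟩
        rcases Nat.lt_succ_iff_lt_or_eq.1 hx' with h | rfl
        · exact h6 (.inl (h5 ⟨g, hg, g0, gy, hq, gq, x', h, hqx', gx⟩))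
        · exact h6 (.inr ⟨g, hg, g0, gy, hq, gq, gx⟩)
      · rintro w3 a3 t3 hn3 - ⟨hF4, hw3, h4, h5⟩ ht3
        refine ⟨(hF4.var 2 (by decide)).trans e2,
          ⟨hF3.trans (hF4.mono (by decide) (by decide)), hw3, fun h => h4 (e1.trans (h1 h)), ?_⟩, ?_⟩
        · rintro ⟨g, hg, g0, y', hy', q', q1, q2, q3, q4⟩
          rcases Nat.lt_succ_iff_lt_or_eq.1 hy' with h | rfl
          · exact h4 (e1.trans (h2 ⟨g, hg, g0, y', h, q', q1, q2, q3, q4⟩))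
          · have gq : g q = 1 := by
              rcases hg.val q with h | h
              · exact h
              · exact absurd (hg.uniq h3'.1 q1 (by omega) (by omega)) h3'.2
            obtain ⟨x, x1, x2⟩ := hg.ex q hq
            have := hg.swap_eq x2
            exact h5 ⟨g, hg, g0, q2, h3'.1, gq, x, B.lt' x1, x1, by omega⟩
        · simp only [mul_add, mul_one, mul_left_comm n] at ht3 ht2 ⊢
          linarith
  · rintro w1 a1 t1 - - ⟨hF, hw1, h1, h2⟩ ht
    refine hQ _ _ _ hF hw1 ?_ ?_
    · rintro (h | ⟨g, hg, g0, y, q, q1, q2⟩)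
      · exact h1 h
      · exact h2 ⟨g, hg, g0, y, B.lt' q1, q, q1, q2⟩
    · have b1 : n ≤ n ^ 4 := Nat.le_self_pow (by norm_num) n
      have b2 : n * n ≤ n ^ 4 := by
        rw [← pow_two]; exact Nat.pow_le_pow_right hn (by norm_num)
      have b3 : n * (n * n) ≤ n ^ 4 := by
        rw [show n * (n * n) = n ^ 3 by ring]; exact Nat.pow_le_pow_right hn (by norm_num)
      have b4 : n * (n * (n * n)) = n ^ 4 := by ring
      have b5 : 1 ≤ n ^ 4 := Nat.one_le_pow _ _ hn
      simp only [mul_add, mul_left_comm n] at ht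
      linarith

end PMCut


/-! ### Bipartite matching by an auction. -/

namespace PMCut

variable {n : ℕ} {A : ℕ → ℕ → Prop} {s : ℕ → Prop}

/-- The vertices with mark `1` in `c` can be matched into those with mark `2`. -/
def MarkMatch (n : ℕ) (A : ℕ → ℕ → Prop) (c : ℕ → ℕ) : Prop :=
  ∃ f : ℕ → ℕ, (∀ x < n, c x = 1 → f x < n ∧ c (f x) = 2 ∧ A x (f x)) ∧
    ∀ x < n, ∀ y < n, c x = 1 → c y = 1 → f x = f y → x = y

/-- No vertex of mark `2` is matched to `x`. -/
def Free (n : ℕ) (c mate : ℕ → ℕ) (x : ℕ) : Prop := ∀ y < n, c y = 2 → mate y ≠ x + 1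

/-- The state of an auction in which the vertices of mark `1` buy vertices of mark `2`. A vertex
`y` is sold to `x` if `mate y = x + 1`, and unsold if `mate y = 0`. -/
structure Auc (n : ℕ) (A : ℕ → ℕ → Prop) (c : ℕ → ℕ) (k : ℕ) (mate price : ℕ → ℕ) : Prop where
  val : ∀ y < n, c y = 2 → mate y ≠ 0 → ∃ x < n, c x = 1 ∧ mate y = x + 1 ∧ A x y ∧
    ∀ z < n, c z = 2 → A x z → price y ≤ price z + 1
  zero : ∀ y < n, c y = 2 → mate y = 0 → price y = 0
  inj : ∀ y < n, ∀ z < n, c y = 2 → c z = 2 → mate y ≠ 0 → mate y = mate z → y = z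
  le : ∀ y < n, c y = 2 → price y ≤ k

/-- The sum of the prices. -/
def pot (n : ℕ) (c price : ℕ → ℕ) : ℕ :=
  ∑ y ∈ (Finset.range n).filter fun y => c y = 2, price y

variable {c mate price : ℕ → ℕ} {k : ℕ}

theorem Auc.pot_le (h : Auc n A c k mate price) (hk : Nat.count (fun y => c y = 2) n = k) :
    pot n c price ≤ k * k := by
  refine (Finset.sum_le_card_nsmul _ _ k ?_).trans ?_
  · intro y hy
    simp only [Finset.mem_filter, Finset.mem_range] at hy
    exact h.le y hy.1 hy.2
  · rw [← count_eq_card, hk, smul_eq_mul]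

theorem pot_update {b : ℕ} (hb : b < n) (hc : c b = 2) :
    pot n c (Function.update price b (price b + 1)) = pot n c price + 1 := by
  have hm : b ∈ (Finset.range n).filter fun y => c y = 2 := by simp [hb, hc]
  rw [pot, pot, ← Finset.add_sum_erase _ _ hm, ← Finset.add_sum_erase _ price hm,
    Function.update_self]
  rw [Finset.sum_congr rfl fun y hy => Function.update_of_ne (Finset.ne_of_mem_erase hy) _ _]
  omega

/-- If a free vertex cannot afford any neighbour, then there is no matching. -/
theorem Auc.fail (h : Auc n A c k mate price) (hk : Nat.count (fun y => c y = 2) n = k)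
    {x : ℕ} (hx : x < n) (cx : c x = 1) (hf : Free n c mate x)
    (hp : ∀ y < n, c y = 2 → A x y → k ≤ price y) : ¬ MarkMatch n A c := by
  rintro ⟨f, f1, f2⟩
  rw [count_eq_card] at hk
  have hmate : ∀ y, ∃ u, y < n → c y = 2 → price y ≠ 0 → u < n ∧ c u = 1 ∧ mate y = u + 1 ∧
      ∀ z < n, c z = 2 → A u z → price y ≤ price z + 1 := by
    intro y
    by_cases hy : y < n ∧ c y = 2 ∧ price y ≠ 0
    · obtain ⟨u, u1, u2, u3, -, u4⟩ := h.val y hy.1 hy.2.1 fun h0 => hy.2.2 (h.zero y hy.1 hy.2.1 h0)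
      exact ⟨u, fun _ _ _ => ⟨u1, u2, u3, u4⟩⟩
    · exact ⟨0, fun h1 h2 h3 => absurd ⟨h1, h2, h3⟩ hy⟩
  choose u hu using hmate
  set R := (Finset.range n).filter fun y => c y = 2 with hR
  have memR : ∀ {y}, y ∈ R ↔ y < n ∧ c y = 2 := by simp [hR]
  -- Items of nonzero price are sold, to distinct owners. Thus `f` sends the owners of `S`, and in
  -- addition the free vertex `x`, to distinct elements of `T`.
  have key : ∀ S ⊆ R, (∀ y ∈ S, price y ≠ 0) → ∀ T ⊆ R, (∀ y ∈ S, f (u y) ∈ T) → f x ∈ T →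
      S.card < T.card := by
    intro S hS h0 T hT h1 h2
    have hcard : (S.image fun y => f (u y)).card = S.card := by
      refine Finset.card_image_of_injOn fun y hy z hz hyz => ?_
      obtain ⟨y1, y2⟩ := memR.1 (hS hy)
      obtain ⟨z1, z2⟩ := memR.1 (hS hz)
      have hy' := hu y y1 y2 (h0 y hy)
      have hz' := hu z z1 z2 (h0 z hz)
      have := f2 _ hy'.1 _ hz'.1 hy'.2.1 hz'.2.1 hyz
      exact h.inj y y1 z z1 y2 z2 (by omega) (by rw [hy'.2.2.1, hz'.2.2.1, this])
    rw [← hcard]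
    refine Finset.card_lt_card (Finset.ssubset_iff_of_subset ?_ |>.2 ⟨f x, h2, ?_⟩)
    · intro z hz
      obtain ⟨y, hy, rfl⟩ := Finset.mem_image.1 hz
      exact h1 y hy
    · intro hz
      obtain ⟨y, hy, hyx⟩ := Finset.mem_image.1 hz
      obtain ⟨y1, y2⟩ := memR.1 (hS hy)
      have hy' := hu y y1 y2 (h0 y hy)
      have := f2 _ hy'.1 _ hx hy'.2.1 cx hyx
      exact hf y y1 y2 (by rw [hy'.2.2.1, this])
  -- If all prices `1, …, k` occurred, each of the `k` items would be sold, and their owners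
  -- together with `x` would be too many to be matched. So there is a gap `j` in the prices.
  obtain ⟨j, j1, j2, j3⟩ : ∃ j, 1 ≤ j ∧ j ≤ k ∧ ∀ y ∈ R, price y ≠ j := by
    by_contra hcon
    push Not at hcon
    have h1 := key (R.filter fun y => price y ≠ 0) (Finset.filter_subset _ _)
      (fun y hy => (Finset.mem_filter.1 hy).2) R subset_rfl
      (fun y hy => by
        obtain ⟨h1, h2⟩ := Finset.mem_filter.1 hy
        obtain ⟨h3, h4⟩ := memR.1 h1
        have h5 := hu y h3 h4 h2
        exact memR.2 ⟨(f1 _ h5.1 h5.2.1).1, (f1 _ h5.1 h5.2.1).2.1⟩)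
      (memR.2 ⟨(f1 x hx cx).1, (f1 x hx cx).2.1⟩)
    have h2 : Finset.Icc 1 k ⊆ (R.filter fun y => price y ≠ 0).image price := by
      intro j hj
      rw [Finset.mem_Icc] at hj
      obtain ⟨y, hy, rfl⟩ := hcon j hj.1 hj.2
      exact Finset.mem_image_of_mem _ (Finset.mem_filter.2 ⟨hy, by omega⟩)
    have h3 := (Finset.card_le_card h2).trans Finset.card_image_le
    rw [Nat.card_Icc] at h3
    omega
  -- An owner in the part above the gap paid at most one more than the price of any neighbour.
  -- Because of the gap all its neighbours lie above it too, as do those of `x` by `hp`; so `f` maps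
  -- these owners and `x` into a set that is too small.
  refine (key (R.filter fun y => j ≤ price y) (Finset.filter_subset _ _) ?_
    (R.filter fun y => j ≤ price y) (Finset.filter_subset _ _) ?_ ?_).false
  · intro y hy
    have := (Finset.mem_filter.1 hy).2
    omega
  · intro y hy
    obtain ⟨h1, h2⟩ := Finset.mem_filter.1 hy
    obtain ⟨h3, h4⟩ := memR.1 h1
    obtain ⟨h5, h6, -, h8⟩ := hu y h3 h4 (by omega)
    obtain ⟨g1, g2, g3⟩ := f1 _ h5 h6
    have := h8 _ g1 g2 g3
    have := j3 y h1
    have := j3 _ (memR.2 ⟨g1, g2⟩)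
    exact Finset.mem_filter.2 ⟨memR.2 ⟨g1, g2⟩, by omega⟩
  · obtain ⟨g1, g2, g3⟩ := f1 x hx cx
    exact Finset.mem_filter.2 ⟨memR.2 ⟨g1, g2⟩, j2.trans (hp _ g1 g2 g3)⟩

/-- The bid raises a cheapest price by one, which is the slack allowed to the new owner. For other
owners the inequalities persist because prices never fall. -/
theorem Auc.bid (h : Auc n A c k mate price) {x b : ℕ} (hx : x < n) (cx : c x = 1)
    (hf : Free n c mate x) (hb : b < n) (cb : c b = 2) (hA : A x b) (hbk : price b < k)
    (hmin : ∀ y < n, c y = 2 → A x y → price b ≤ price y) :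
    Auc n A c k (Function.update mate b (x + 1)) (Function.update price b (price b + 1)) := by
  have hge : ∀ z, price z ≤ Function.update price b (price b + 1) z := fun z => by
    rw [Function.update_apply]; split_ifs with h
    · rw [h]; omega
    · rfl
  constructor
  · intro y hy cy h0
    by_cases hyb : y = b
    · subst hyb
      refine ⟨x, hx, cx, by simp, hA, fun z hz cz hxz => ?_⟩
      have := hmin z hz cz hxz
      have := hge z
      rw [Function.update_self]
      omega
    · rw [Function.update_of_ne hyb] at h0 ⊢
      obtain ⟨u, u1, u2, u3, u4, u5⟩ := h.val y hy cy h0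
      refine ⟨u, u1, u2, u3, u4, fun z hz cz hz' => ?_⟩
      have := u5 z hz cz hz'
      have := hge z
      rw [Function.update_of_ne hyb]
      omega
  · intro y hy cy h0
    by_cases hyb : y = b
    · subst hyb; simp at h0
    · rw [Function.update_of_ne hyb] at h0 ⊢
      exact h.zero y hy cy h0
  · intro y hy z hz cy cz h0 hyz
    by_cases hyb : y = b
    · by_cases hzb : z = b
      · rw [hyb, hzb]
      · subst hyb
        rw [Function.update_self, Function.update_of_ne hzb] at hyz
        exact absurd hyz.symm (hf z hz cz)
    · by_cases hzb : z = b
      · subst hzb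
        rw [Function.update_self, Function.update_of_ne hyb] at hyz
        exact absurd hyz (hf y hy cy)
      · rw [Function.update_of_ne hyb] at h0 hyz
        rw [Function.update_of_ne hzb] at hyz
        exact h.inj y hy z hz cy cz h0 hyz
  · intro y hy cy
    rw [Function.update_apply]
    split_ifs with h'
    · omega
    · exact h.le y hy cy

/-- After a bid the previous owner is the only further free vertex. -/
theorem Auc.bid_free (h : Auc n A c k mate price) {x b : ℕ}
    (hf : Free n c mate x) (hb : b < n) (cb : c b = 2) {i : ℕ}
    (hi : ∀ x' < i, c x' = 1 → x' ≠ x → ¬ Free n c mate x') :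
    (mate b = 0 ∧ ∀ x' < i, c x' = 1 → ¬ Free n c (Function.update mate b (x + 1)) x') ∨
    ∃ o, mate b = o + 1 ∧ o < n ∧ c o = 1 ∧ Free n c (Function.update mate b (x + 1)) o ∧
      ∀ x' < i, c x' = 1 → x' ≠ o → ¬ Free n c (Function.update mate b (x + 1)) x' := by
  have key : ∀ x' < i, c x' = 1 → mate b ≠ x' + 1 →
      ¬ Free n c (Function.update mate b (x + 1)) x' := by
    intro x' hx' cx' hne hfree
    by_cases hxx : x' = x
    · subst hxx
      exact hfree b hb cb (by simp)
    · refine hi x' hx' cx' hxx fun y hy cy => ?_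
      by_cases hyb : y = b
      · rw [hyb]; exact hne
      · have := hfree y hy cy
        rwa [Function.update_of_ne hyb] at this
  by_cases h0 : mate b = 0
  · exact .inl ⟨h0, fun x' hx' cx' => key x' hx' cx' (by omega)⟩
  · obtain ⟨o, o1, o2, o3, -⟩ := h.val b hb cb h0
    refine .inr ⟨o, o3, o1, o2, fun y hy cy => ?_, fun x' hx' cx' hne => key x' hx' cx' (by omega)⟩
    by_cases hyb : y = b
    · subst hyb
      have := hf y hy cy
      rw [Function.update_self]
      omega
    · rw [Function.update_of_ne hyb]
      exact fun hyo => hyb (h.inj y hy b hb cy cb (by omega) (by omega))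

theorem Auc.success (h : Auc n A c k mate price)
    (hs : ∀ x < n, c x = 1 → ¬ Free n c mate x) : MarkMatch n A c := by
  have : ∀ x, ∃ y, x < n → c x = 1 → y < n ∧ c y = 2 ∧ mate y = x + 1 := fun x => by
    by_cases hx : x < n ∧ c x = 1
    · have := hs x hx.1 hx.2
      simp only [Free] at this
      push Not at this
      obtain ⟨y, h1, h2, h3⟩ := this
      exact ⟨y, fun _ _ => ⟨h1, h2, h3⟩⟩
    · exact ⟨0, fun h1 h2 => absurd ⟨h1, h2⟩ hx⟩
  choose f hf using this
  refine ⟨f, fun x hx cx => ?_, fun x hx y hy cx cy hxy => ?_⟩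
  · obtain ⟨h1, h2, h3⟩ := hf x hx cx
    refine ⟨h1, h2, ?_⟩
    obtain ⟨u, -, -, u3, u4, -⟩ := h.val _ h1 h2 (by omega)
    have : u = x := by omega
    exact this ▸ u4
  · have h1 := (hf x hx cx).2.2
    have h2 := (hf y hy cy).2.2
    rw [hxy] at h1
    omega

end PMCut


/-! ### The auction program. -/

namespace PMCut

variable {n : ℕ} {A : ℕ → ℕ → Prop} {s : ℕ → Prop} {c : ℕ → ℕ} {k : ℕ}

/-- The bidder in variable `12` bids for a cheapest neighbour. -/
def bidCmd : Cmd :=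
  -- Starting the minimum at `k` restricts the search to prices below `k`; if `14` keeps the value
  -- `n`, the bidder can afford nothing.
  .set 14 (.v 0) ;; .set 15 (.v 18) ;;
  .for 8 (.when (.eq (.get 9 (.v 8)) (.c 2)) (.when (.adj (.v 12) (.v 8))
    (.when (.lt (.get 5 (.v 8)) (.v 15)) (.set 14 (.v 8) ;; .set 15 (.get 5 (.v 8)))))) ;;
  .ite (.lt (.v 14) (.v 0))
    (.set 17 (.get 4 (.v 14)) ;;
      .put 4 (.v 14) (.add (.v 12) (.c 1)) ;;
      .put 5 (.v 14) (.add (.v 15) (.c 1)) ;;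
      .ite (.eq (.v 17) (.c 0)) (.set 13 (.c 0)) (.set 12 (.sub (.v 17) (.c 1))))
    (.set 16 (.c 1) ;; .set 13 (.c 0))

/-- The bidders below `i` are served, except for the one in variable `12` if variable `13` is set.
Variable `16` signals a failure. -/
structure Bidding (n : ℕ) (A : ℕ → ℕ → Prop) (c : ℕ → ℕ) (k i : ℕ) (w : ℕ → ℕ)
    (a : ℕ → ℕ → ℕ) : Prop where
  auc : Auc n A c k (a 4) (a 5)
  -- All owners are below `i`, so vertex `i` is free when it enters the auction.
  old : ∀ y < n, c y = 2 → a 4 y ≤ i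
  cur : w 13 = 1 → w 16 = 0 ∧ w 12 < i ∧ w 12 < n ∧ c (w 12) = 1 ∧ Free n c (a 4) (w 12) ∧
    ∀ x < i, c x = 1 → x ≠ w 12 → ¬ Free n c (a 4) x
  done : w 13 = 0 → w 16 = 0 → ∀ x < i, c x = 1 → ¬ Free n c (a 4) x
  fail : w 16 ≠ 0 → ¬ MarkMatch n A c
  go : w 13 ≤ 1
  failed : w 16 ≤ 1

theorem bidCmd_spec {w a t i} {Q : St → Prop} (hw0 : w 0 = n) (hk : Nat.count (fun y => c y = 2) n = k)
    (hc : a 9 = c) (h18 : w 18 = k) (h : Bidding n A c k i w a) (hgo : w 13 = 1)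
    (hQ : ∀ w' a' t', Fr [8, 12, 13, 14, 15, 16, 17] [4, 5] w a w' a' → Bidding n A c k i w' a' →
      ((pot n c (a' 5) = pot n c (a 5) + 1 ∧ w' 16 = 0) ∨
        (pot n c (a' 5) = pot n c (a 5) ∧ w' 16 = 1 ∧ w' 13 = 0)) →
      t' ≤ t + 100 * n + 100 → Q ⟨w', a', t'⟩) :
    wp n A bidCmd Q ⟨w, a, t⟩ := by
  have hkn : k ≤ n := hk ▸ Nat.count_le _
  obtain ⟨h16, hxi, hx, cx, hfree, hothers⟩ := h.cur hgo
  set x := w 12 with hxdef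
  simp only [bidCmd, wp_seq, wp_set]
  refine ⟨by decide, by simp, by decide, by simp, ?_⟩
  refine wp_for_const (by decide) (fun i w' a' => Fr [8, 14, 15] [] w a w' a' ∧
    ((w' 14 = n ∧ w' 15 = k ∧ ∀ z < i, c z = 2 → A x z → k ≤ a 5 z) ∨
    (w' 14 < n ∧ c (w' 14) = 2 ∧ A x (w' 14) ∧ w' 15 = a 5 (w' 14) ∧ w' 15 < k ∧
      ∀ z < i, c z = 2 → A x z → w' 15 ≤ a 5 z))) 60 ?_ ?_ ?_ ?_
  · rintro i w a y ⟨h, h2⟩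
    exact ⟨h.set (by decide), by simpa using h2⟩
  · exact ⟨(Fr.rfl.set (by decide)).set (by decide), .inl (by simp [hw0, h18])⟩
  · rintro z w1 a1 t1 hz hn1 hz8 ⟨hF, h1⟩
    have e12 : w1 12 = x := hF.var 12 (by decide)
    have e9 := (hF.arr 9 (by decide)).trans hc
    have e5 := hF.arr 5 (by decide)
    have g : ∀ {j l}, Fr [8, 14, 15] [] w a (Function.update (Function.update w1 14 j) 15 l) a1 :=
      (hF.set (by decide)).set (by decide)
    simp [hz8, e12, e9, e5, hx, hz, hF, g, -Order.lt_add_one_iff, Nat.forall_lt_succ_right]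
    by_cases hcz : c z = 2 <;> simp [hcz]
    · by_cases hA : A x z <;> simp [hA]
      · grind
      · exact h1
    · exact h1
  · rintro w1 a1 t1 hn1 - ⟨hF, h1⟩ ht
    have e12 : w1 12 = x := hF.var 12 (by decide)
    have e13 := (hF.var 13 (by decide)).trans hgo
    have e16 := (hF.var 16 (by decide)).trans h16
    have e4 := hF.arr 4 (by decide)
    have e5 := hF.arr 5 (by decide)
    have hF' : Fr [8, 12, 13, 14, 15, 16, 17] [4, 5] w a w1 a1 := hF.mono (by decide) (by decide)
    simp only [Ex.cost] at ht
    simp only [wp_ite, wp_set, wp_seq, wp_put]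
    refine ⟨by simp, fun hb => ?_, fun hb => ?_⟩
    · simp only [Cn.lt_holds, Ex.eval, hn1] at hb
      obtain ⟨b1, b2, b3, b4, b5, b6⟩ := h1.resolve_left fun h => by omega
      rw [b4] at b5 b6
      set b := w1 14 with hbdef
      have auc' := h.auc.bid hx cx hfree b1 b2 b3 b5 b6
      have hfr := h.auc.bid_free hfree b1 b2 hothers
      have hold : ∀ y < n, c y = 2 → Function.update (a 4) b (x + 1) y ≤ i := by
        intro y hy cy
        rw [Function.update_apply]
        split_ifs
        · omega
        · exact h.old y hy cy
      have hob := h.old b b1 b2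
      have hpot := pot_update (price := a 5) b1 b2
      simp [e12, b4, e4, e5, ← hbdef]
      refine ⟨by omega, by omega, fun h0 => ?_, fun h0 => ?_⟩
      · refine hQ _ _ _ (((hF'.set (by decide)).put (by decide)).put (by decide)
          |>.set (by decide)) ?_ (.inl ⟨by simpa using hpot, by simp [e16]⟩) (by linarith)
        rcases hfr with ⟨-, h2⟩ | ⟨o, h2, -⟩
        · exact ⟨by simpa using auc', by simpa using hold, by simp, fun _ _ => by simpa using h2,
            by simp [e16], by simp, by simp [e16]⟩
        · omega
      · refine hQ _ _ _ (((hF'.set (by decide)).put (by decide)).put (by decide)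
          |>.set (by decide)) ?_ (.inl ⟨by simpa using hpot, by simp [e16]⟩) (by linarith)
        rcases hfr with ⟨h2, -⟩ | ⟨o, o1, o2, o3, o4, o5⟩
        · omega
        · refine ⟨by simpa using auc', by simpa using hold, fun _ => ?_, by simp [e13],
            by simp [e16], by simp [e13], by simp [e16]⟩
          simp [e16, o1, o2, o3, o4, -Order.lt_add_one_iff]
          exact ⟨by omega, by simpa using o5⟩
    · simp only [Cn.lt_holds, Ex.eval, hn1] at hb
      obtain ⟨-, -, h2⟩ := h1.resolve_right fun h => hb h.1
      have hno := h.auc.fail hk hx cx hfree h2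
      refine ⟨by decide, by simp, by decide, by simp, ?_⟩
      refine hQ _ _ _ ((hF'.set (by decide)).set (by decide)) ?_
        (.inr ⟨by simp [e5], by simp, by simp⟩) (by simp; linarith)
      exact ⟨by simpa [e4, e5] using h.auc, by simpa [e4] using h.old, by simp, by simp, fun _ => hno, by simp, by simp⟩

/-- Run the auction, and set the answer to `1` if it succeeds. -/
def auctionCmd : Cmd :=
  .for 8 (.put 4 (.v 8) (.c 0) ;; .put 5 (.v 8) (.c 0)) ;;
  .set 16 (.c 0) ;; .set 20 (.c 0) ;; .set 13 (.c 0) ;;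
  .for 11 (.when (.eq (.v 16) (.c 0)) (.when (.eq (.get 9 (.v 11)) (.c 1))
    -- Variable `20` is constantly `0`, so the loop runs while the flag in `13` is set.
    (.set 12 (.v 11) ;; .set 13 (.c 1) ;; .loop 20 13 bidCmd))) ;;
  .when (.eq (.v 16) (.c 0)) (.set 1 (.c 1))

theorem auctionCmd_spec {w a t} {Q : St → Prop} (hk : Nat.count (fun y => c y = 2) n = k)
    (hc : a 9 = c) (h18 : w 18 = k)
    (hQ : ∀ w' a' t', Fr [1, 8, 11, 12, 13, 14, 15, 16, 17, 20] [4, 5] w a w' a' →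
      (MarkMatch n A c → w' 1 = 1) → (w' 1 = w 1 ∨ w' 1 = 1 ∧ MarkMatch n A c) →
      t' ≤ t + (200 * n + 200) * (k * k + 2) → Q ⟨w', a', t'⟩) :
    wp n A auctionCmd Q ⟨w, a, t⟩ := by
  refine wp_for_const (by decide) (fun i w' a' => Fr [8] [4, 5] w a w' a' ∧
    ∀ z < i, a' 4 z = 0 ∧ a' 5 z = 0) 30 ?_ ?_ ?_ ?_
  · exact fun i w a y h => ⟨h.1.set (by decide), h.2⟩
  · exact ⟨Fr.rfl, by simp⟩
  · rintro z w1 a1 t1 hz hn1 hz8 ⟨hF, h1⟩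
    simp [hz8, -Order.lt_add_one_iff]
    refine ⟨(hF.put (by decide)).put (by decide), fun v hv => ?_⟩
    simp only [Function.update_apply]
    split_ifs
    · simp
    · exact h1 v (by omega)
  rintro w1 a1 t1 hn1 - ⟨hF1, h1⟩ ht1
  simp only [wp_seq, wp_set]
  refine ⟨by decide, by simp, by decide, by simp, by decide, by simp, ?_⟩
  simp only [Ex.eval, Ex.cost]
  set T := t1 + (1 + 1) + (1 + 1) + (1 + 1) with hT
  set w1' := Function.update (Function.update (Function.update w1 16 0) 20 0) 13 0 with hw1'
  have hF1' : Fr [8, 11, 12, 13, 14, 15, 16, 17, 20] [4, 5] w a w1' a1 :=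
    (((hF1.mono (by decide) (by decide)).set (by decide)).set (by decide)).set (by decide)
  have pot0 : pot n c (a1 5) = 0 := by
    refine Finset.sum_eq_zero fun y hy => ?_
    simp only [Finset.mem_filter, Finset.mem_range] at hy
    exact (h1 y hy.1).2
  -- Each bid raises the sum of the prices by one or sets the failure flag, so this potential, which
  -- is at most `k * k + 1`, pays for all bids together.
  refine wp_for (by decide) (fun i τ => Fr [8, 11, 12, 13, 14, 15, 16, 17, 20] [4, 5] w a τ.v τ.a ∧
    Bidding n A c k i τ.v τ.a ∧ τ.v 13 = 0 ∧ τ.v 20 = 0 ∧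
    τ.t ≤ T + 2 + 50 * i + (101 * n + 120) * (pot n c (τ.a 5) + τ.v 16)) ?_ ?_ ?_
  · refine ⟨hF1'.set (by decide), ⟨⟨?_, ?_, ?_, ?_⟩, ?_, ?_, ?_, ?_, ?_, ?_⟩, ?_, ?_, ?_⟩
    · exact fun y hy _ h0 => absurd (h1 y hy).1 h0
    · exact fun y hy _ _ => (h1 y hy).2
    · exact fun y hy _ _ _ _ h0 => absurd (h1 y hy).1 h0
    · exact fun y hy _ => (h1 y hy).2.trans_le (Nat.zero_le _)
    · exact fun y hy _ => (h1 y hy).1.le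
    all_goals simp [hw1', pot0]
  · rintro i w2 a2 t2 hi hn2 hi11 ⟨hF2, hb, h13, h20, ht2⟩
    simp only at hF2 hb h13 h20 ht2
    have e9 := (hF2.arr 9 (by decide)).trans hc
    have skip : (w2 16 = 0 → c i ≠ 1) → ∀ t3 ≤ t2 + 20, w2 11 = i ∧
        Fr [8, 11, 12, 13, 14, 15, 16, 17, 20] [4, 5] w a (Function.update w2 11 (i + 1)) a2 ∧
        Bidding n A c k (i + 1) (Function.update w2 11 (i + 1)) a2 ∧
        Function.update w2 11 (i + 1) 13 = 0 ∧ Function.update w2 11 (i + 1) 20 = 0 ∧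
        t3 + 4 ≤ T + 2 + 50 * (i + 1) + (101 * n + 120) *
          (pot n c (a2 5) + Function.update w2 11 (i + 1) 16) := by
      intro hci t3 ht3
      refine ⟨hi11, hF2.set (by decide), ⟨hb.auc, fun y hy cy => (hb.old y hy cy).trans (by omega),
        by simp [h13], fun _ h0 x hx cx => ?_, hb.fail, hb.go, hb.failed⟩, by simpa using h13,
        by simpa using h20, ?_⟩
      · rcases Nat.lt_succ_iff_lt_or_eq.1 hx with hx | rfl
        · exact hb.done h13 h0 x hx cx
        · exact absurd cx (hci h0)
      · simp only [Function.update_of_ne (show 16 ≠ 11 by decide)]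
        omega
    simp only [wp_when, wp_seq, wp_set]
    refine ⟨by simp, fun h16 => ⟨by simp, fun hci => ?_, fun hci => ?_⟩, fun h16 => ?_⟩
    · simp only [Cn.eq_holds, Ex.eval] at h16 hci
      rw [hi11, e9] at hci
      refine ⟨by decide, by simp, by decide, by simp, ?_⟩
      simp only [Ex.eval, Ex.cost, Cn.eq_cost, hi11]
      let I : St → Prop := fun τ =>
        Fr [8, 11, 12, 13, 14, 15, 16, 17, 20] [4, 5] w a τ.v τ.a ∧
        Bidding n A c k (i + 1) τ.v τ.a ∧ τ.v 11 = i ∧ τ.v 20 = 0 ∧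
        τ.t ≤ T + 2 + 50 * i + 33 + (101 * n + 120) * (pot n c (τ.a 5) + τ.v 16)
      -- A successful bid lowers the first summand; a failure leaves it unchanged and clears the
      -- flag.
      refine ⟨I, fun τ => (k * k - pot n c (τ.a 5)) + τ.v 13, ?_, ?_, ?_⟩
      · refine ⟨(hF2.set (by decide)).set (by decide), ⟨hb.auc, fun y hy cy =>
          (hb.old y hy cy).trans (by omega), ?_, ?_, ?_, ?_, ?_⟩, ?_, ?_, ?_⟩
        · intro _
          simp [h16, hi, hci, -Order.lt_add_one_iff]
          refine ⟨fun y hy cy => ?_, fun x hx cx hxi => hb.done h13 h16 x (by omega) cx⟩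
          have := hb.old y hy cy
          omega
        · simp
        · simp [h16]
        · simp
        · simp [h16]
        · simpa using hi11
        · simpa using h20
        · simp [h16] at ht2 ⊢
          omega
      · rintro ⟨w3, a3, t3⟩ ⟨hF3, hb3, h11, h20', ht3⟩ hn3 hlt
        simp only at hF3 hb3 h11 h20' ht3 hlt
        have h13' : w3 13 = 1 := by have := hb3.go; omega
        refine bidCmd_spec hn3 hk ((hF3.arr 9 (by decide)).trans hc)
          ((hF3.var 18 (by decide)).trans h18) hb3 h13' fun w4 a4 t4 hF4 hb4 h4 ht4 => ?_
        simp only at h4 ht4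
        have h16' := (hb3.cur h13').1
        have hle := hb4.auc.pot_le hk
        refine ⟨⟨hF3.trans (hF4.mono (by decide) (by decide)), hb4,
          (hF4.var 11 (by decide)).trans h11, (hF4.var 20 (by decide)).trans h20', ?_⟩, ?_⟩
        · have : pot n c (a4 5) + w4 16 = pot n c (a3 5) + w3 16 + 1 := by
            rcases h4 with ⟨p1, p2⟩ | ⟨p1, p2, -⟩ <;> omega
          show t4 ≤ T + 2 + 50 * i + 33 + (101 * n + 120) * (pot n c (a4 5) + w4 16)
          rw [this, Nat.mul_succ]
          omega
        · have := hb4.go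
          simp only
          rcases h4 with ⟨p1, p2⟩ | ⟨p1, p2, p3⟩ <;> omega
      · rintro ⟨w3, a3, t3⟩ ⟨hF3, hb3, h11, h20', ht3⟩ hn3 hlt
        simp only at hF3 hb3 h11 h20' ht3 hlt
        have h13' : w3 13 = 0 := by omega
        refine ⟨h11, hF3.set (by decide), ⟨hb3.auc, hb3.old, ?_, ?_, hb3.fail, hb3.go, hb3.failed⟩,
          ?_, ?_, ?_⟩
        · simp [h13']
        · exact hb3.done
        · simpa using h13'
        · simpa using h20'
        · simp only [Function.update_of_ne (show 16 ≠ 11 by decide)]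
          omega
    · simp only [Cn.eq_holds, Ex.eval] at hci
      rw [hi11, e9] at hci
      exact skip (fun _ => hci) _ (by simp)
    · exact skip (fun h => absurd h h16) _ (by simp)
  · rintro w2 a2 t2 hn2 - ⟨hF2, hb, h13, h20, ht2⟩
    simp only at hF2 hb h13 h20 ht2
    have hle := hb.auc.pot_le hk
    have hfl := hb.failed
    have htime : t2 ≤ T + 2 + 50 * n + (101 * n + 120) * (k * k + 1) :=
      ht2.trans (Nat.add_le_add_left (Nat.mul_le_mul_left _ (add_le_add hle hfl)) _)
    have htime' : t2 + 10 ≤ t + (200 * n + 200) * (k * k + 2) := by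
      have := Nat.zero_le (n * (k * k))
      nlinarith
    have hF2' : Fr [1, 8, 11, 12, 13, 14, 15, 16, 17, 20] [4, 5] w a w2 a2 :=
      hF2.mono (by decide) (by decide)
    simp only [wp_when, wp_set]
    refine ⟨by simp, fun h16 => ⟨by decide, by simp, ?_⟩, fun h16 => ?_⟩
    · exact hQ _ _ _ (hF2'.set (by decide)) (fun _ => by simp)
        (.inr ⟨by simp, hb.auc.success (hb.done h13 h16)⟩) (by simp; omega)
    · exact hQ _ _ _ hF2' (fun h => absurd h (hb.fail h16)) (.inl (hF2.var 1 (by decide)))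
        (by simp; omega)

end PMCut


/-! ### Breadth first search. -/

namespace PMCut
open Relation

variable {n : ℕ} {A : ℕ → ℕ → Prop} {s : ℕ → Prop}

theorem count_update {f : ℕ → ℕ} {z k : ℕ} (hz : z < n) (h0 : f z = 0) (hk : k ≠ 0) :
    Nat.count (fun v => Function.update f z k v ≠ 0) n = Nat.count (fun v => f v ≠ 0) n + 1 := by
  have hn : z ∉ (Finset.range n).filter fun v => f v ≠ 0 := by simp [h0]
  rw [count_eq_card, count_eq_card, ← Finset.card_insert_of_notMem hn]
  congr 1
  ext v
  simp only [Finset.mem_filter, Finset.mem_range, Finset.mem_insert, Function.update_apply]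
  split_ifs with h
  · simp [h, hz, hk]
  · simp [h]

/-- The state of a breadth first search from `r` in the graph of the vertices with label `0` in
`l0`. The reached vertices have label `r + 1` in `l`, and the queue `q` holds those still to be
treated in its cells from `hd` to `tl`. The vertices in `X` are being treated. -/
structure Bfs (n : ℕ) (A : ℕ → ℕ → Prop) (C : ℕ → Prop) (l0 : ℕ → ℕ) (r : ℕ) (X : ℕ → Prop)
    (hd tl : ℕ) (l q : ℕ → ℕ) : Prop where
  lab : ∀ v < n, l v = l0 v ∨ l v = r + 1 ∧ l0 v = 0 ∧ C v
  cl : ∀ v < n, l v = r + 1 → X v ∨ (∃ j, hd ≤ j ∧ j < tl ∧ q j = v) ∨ ∀ z, A v z → l z ≠ 0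
  que : ∀ j < tl, q j < n ∧ l (q j) = r + 1
  root : l r = r + 1
  -- Thus `tl` is the number of newly labelled vertices: the queue never has more than `n` entries,
  -- and its final length is the size of the component.
  num : Nat.count (fun v => l v ≠ 0) n = Nat.count (fun v => l0 v ≠ 0) n + tl

variable {C : ℕ → Prop} {l0 : ℕ → ℕ} {r : ℕ} {X : ℕ → Prop} {hd tl : ℕ} {l q : ℕ → ℕ}

theorem Bfs.init (hr : r < n) (h0 : l0 r = 0) (hC : C r) (hl : ∀ v < n, l0 v ≠ r + 1) :
    Bfs n A C l0 r (fun _ => False) 0 1 (Function.update l0 r (r + 1)) (Function.update q 0 r) := by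
  constructor
  · intro v hv
    by_cases h : v = r
    · subst h; simp [h0, hC]
    · simp [h]
  · intro v hv
    by_cases h : v = r
    · subst h
      exact fun _ => .inr (.inl ⟨0, le_rfl, Nat.one_pos, by simp⟩)
    · rw [Function.update_of_ne h]
      exact fun h' => absurd h' (hl v hv)
  · intro j hj
    obtain rfl : j = 0 := by omega
    simp [hr]
  · simp
  · exact count_update hr h0 (by omega)

theorem Bfs.push (h : Bfs n A C l0 r X hd tl l q) {z : ℕ} (hz : z < n) (h0 : l z = 0) (hC : C z)
    (hle : hd ≤ tl) :
    Bfs n A C l0 r X hd (tl + 1) (Function.update l z (r + 1)) (Function.update q tl z) := by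
  constructor
  · intro v hv
    by_cases hvz : v = z
    · subst hvz
      rcases h.lab v hv with h1 | h1
      · simp [← h1, h0, hC]
      · omega
    · rw [Function.update_of_ne hvz]
      exact h.lab v hv
  · intro v hv
    by_cases hvz : v = z
    · subst hvz
      exact fun _ => .inr (.inl ⟨tl, hle, Nat.lt_succ_self _, by simp⟩)
    · rw [Function.update_of_ne hvz]
      intro hl
      refine (h.cl v hv hl).imp id (Or.imp ?_ ?_)
      · rintro ⟨j, j1, j2, j3⟩
        exact ⟨j, j1, by omega, by rwa [Function.update_of_ne (by omega)]⟩
      · intro h' y hy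
        rw [Function.update_apply]
        split_ifs
        · omega
        · exact h' y hy
  · intro j hj
    by_cases hjt : j = tl
    · subst hjt; simp [hz]
    · rw [Function.update_of_ne hjt]
      obtain ⟨h1, h2⟩ := h.que j (by omega)
      refine ⟨h1, ?_⟩
      rw [Function.update_of_ne (by rintro h3; rw [h3] at h2; omega)]
      exact h2
  · have := h.root
    rw [Function.update_of_ne (by rintro h3; rw [h3] at this; omega)]
    exact this
  · rw [count_update hz h0 (by omega), h.num, add_assoc]

/-- The vertex taken from the queue is exempt from the closure condition until all its neighbours
have been scanned. -/
theorem Bfs.pop (h : Bfs n A C l0 r (fun _ => False) hd tl l q) :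
    Bfs n A C l0 r (· = q hd) (hd + 1) tl l q := by
  refine ⟨h.lab, fun v hv hl => ?_, h.que, h.root, h.num⟩
  rcases h.cl v hv hl with h1 | ⟨j, j1, j2, j3⟩ | h1
  · exact h1.elim
  · rcases j1.eq_or_lt with rfl | j1
    · exact .inl j3.symm
    · exact .inr (.inl ⟨j, j1, j2, j3⟩)
  · exact .inr (.inr h1)

theorem Bfs.treated {v : ℕ} (h : Bfs n A C l0 r (· = v) hd tl l q)
    (hv : ∀ z, A v z → l z ≠ 0) : Bfs n A C l0 r (fun _ => False) hd tl l q := by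
  refine ⟨h.lab, fun v hv hl => ?_, h.que, h.root, h.num⟩
  rcases h.cl v hv hl with rfl | h1
  · exact .inr (.inr ‹_›)
  · exact .inr h1

open Classical in
/-- At the end of the search exactly the component of `r` is labelled. -/
theorem Bfs.result {u w : ℕ}
    (h : Bfs n A (Cp n A u w r) l0 r (fun _ => False) tl tl l q)
    (hr : Un n A u w r) (hl : ∀ v < n, l0 v ≠ r + 1)
    (hcl : ∀ v < n, l0 v = 0 → ∀ z, A v z → Un n A u w z → l0 z = 0) :
    (∀ v < n, l v = if Cp n A u w r v then r + 1 else l0 v) ∧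
      tl = Nat.count (Cp n A u w r) n ∧
      Nat.count (fun v => l v ≠ 0) n =
        Nat.count (fun v => l0 v ≠ 0) n + Nat.count (Cp n A u w r) n := by
  have key : ∀ v, Cp n A u w r v → l v = r + 1 := by
    intro v hv
    induction hv with
    | refl => exact h.root
    | @tail b z hb hz ih =>
      have hbn := (Cp.un hr hb).1
      obtain ⟨-, hb0, -⟩ := (h.lab b hbn).resolve_left fun h' => hl b hbn (by omega)
      have hz0 := hcl b hbn hb0 z hz.1 hz.2
      have hne : l z ≠ 0 := by
        rcases h.cl b hbn ih with h1 | ⟨j, j1, j2, -⟩ | h1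
        · exact h1.elim
        · omega
        · exact h1 z hz.1
      exact ((h.lab z hz.2.1).resolve_left fun h' => hne (by omega)).1
  have h1 : ∀ v < n, l v = if Cp n A u w r v then r + 1 else l0 v := by
    intro v hv
    split_ifs with hC
    · exact key v hC
    · exact (h.lab v hv).resolve_right fun h' => hC h'.2.2
  have h0 : ∀ v, Cp n A u w r v → l0 v = 0 := by
    intro v hv
    have hvn := (Cp.un hr hv).1
    exact ((h.lab v hvn).resolve_left fun h' => hl v hvn (by rw [← h', key v hv])).2.1
  have h2 : Nat.count (fun v => l v ≠ 0) n =
      Nat.count (fun v => l0 v ≠ 0) n + Nat.count (Cp n A u w r) n := by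
    rw [count_eq_card, count_eq_card, count_eq_card, ← Finset.card_union_of_disjoint]
    · congr 1
      ext v
      simp only [Finset.mem_filter, Finset.mem_range, Finset.mem_union]
      by_cases hv : v < n
      · by_cases hC : Cp n A u w r v
        · simp [hv, hC, h1 v hv]
        · simp [hv, hC, h1 v hv]
      · simp [hv]
    · rw [Finset.disjoint_filter]
      exact fun v _ h3 h4 => h3 (h0 v h4)
  exact ⟨h1, by have := h.num; omega, h2⟩

/-- Breadth first search from vertex `v4`. -/
def bfsCmd : Cmd :=
  .put 2 (.c 0) (.v 4) ;; .put 1 (.v 4) (.add (.v 4) (.c 1)) ;; .set 5 (.c 0) ;; .set 6 (.c 1) ;;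
  .loop 5 6 (.set 7 (.get 2 (.v 5)) ;; .inc 5 ;;
    .for 8 (.when (.adj (.v 7) (.v 8)) (.when (.eq (.get 1 (.v 8)) (.c 0))
      (.put 1 (.v 8) (.add (.v 4) (.c 1)) ;; .put 2 (.v 6) (.v 8) ;; .inc 6))))

-- Only vertices of the component enter the queue, each once, so the time is `O(n)` per vertex of
-- the component. The hypothesis `hcl` says that earlier searches labelled whole components.
open Classical in
theorem bfsCmd_spec (B : BG n A s) {u w' : ℕ} {w a t} {Q : St → Prop} (h4 : w 4 = r)
    (hr0 : a 1 r = 0) (hr : Un n A u w' r) (hl : ∀ v < n, a 1 v ≠ r + 1)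
    (hun : ∀ v < n, a 1 v = 0 → Un n A u w' v)
    (hcl : ∀ v < n, a 1 v = 0 → ∀ z, A v z → Un n A u w' z → a 1 z = 0)
    (hQ : ∀ w2 a2 t2, Fr [5, 6, 7, 8] [1, 2] w a w2 a2 →
      (∀ v < n, a2 1 v = if Cp n A u w' r v then r + 1 else a 1 v) →
      Nat.count (fun v => a2 1 v ≠ 0) n =
        Nat.count (fun v => a 1 v ≠ 0) n + Nat.count (Cp n A u w' r) n →
      t2 ≤ t + (100 * n + 50) * Nat.count (Cp n A u w' r) n + 50 → Q ⟨w2, a2, t2⟩) :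
    wp n A bfsCmd Q ⟨w, a, t⟩ := by
  have hrn : r < n := hr.1
  simp only [bfsCmd, wp_seq, wp_set, wp_put]
  simp only [Ex.Ok, Ex.eval, Ex.cost, h4]
  refine ⟨by decide, by simp, trivial, by decide, trivial, ⟨trivial, by omega, by omega⟩, by decide,
    by simp, by decide, by omega, ?_⟩
  let I : St → Prop := fun τ => Fr [5, 6, 7, 8] [1, 2] w a τ.v τ.a ∧
    Bfs n A (Cp n A u w' r) (a 1) r (fun _ => False) (τ.v 5) (τ.v 6) (τ.a 1) (τ.a 2) ∧
    τ.v 5 ≤ τ.v 6 ∧ τ.t ≤ t + 40 + (100 * n + 50) * τ.v 5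
  refine ⟨I, fun τ => n - τ.v 5, ?_, ?_, ?_⟩
  · refine ⟨(((Fr.rfl.put (by decide)).put (by decide)).set (by decide)).set (by decide), ?_, ?_, ?_⟩
    · simpa using Bfs.init hrn hr0 (Cp.self _ _ _) hl
    · simp
    · simp
  · rintro ⟨w1, a1, t1⟩ ⟨hF1, hb, hle, ht⟩ hn1 hlt
    simp only at hF1 hb hle ht hn1 hlt
    have e4 := (hF1.var 4 (by decide)).trans h4
    have htl : w1 6 ≤ n := by
      have h1 := hb.num
      have h2 : Nat.count (fun v => a1 1 v ≠ 0) n ≤ n := Nat.count_le _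
      omega
    have hpop := hb.pop
    obtain ⟨hvn, hvl⟩ := hb.que _ hlt
    set v := a1 2 (w1 5) with hv
    have hvC : Cp n A u w' r v := by
      rcases hb.lab v hvn with h1 | h1
      · exact absurd (h1.symm.trans hvl) (hl v hvn)
      · exact h1.2.2
    simp only [wp_seq, wp_set, wp_inc]
    simp only [Ex.Ok, Ex.eval, Ex.cost, ← hv]
    refine ⟨by decide, ⟨trivial, by decide⟩, by decide, by simp; omega, ?_⟩
    refine wp_for_const (by decide) (fun i w2 a2 => Fr [6, 7, 8] [1, 2]
      (Function.update w1 5 (w1 5 + 1)) a1 w2 a2 ∧ w2 7 = v ∧ w1 5 + 1 ≤ w2 6 ∧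
      Bfs n A (Cp n A u w' r) (a 1) r (· = v) (w1 5 + 1) (w2 6) (a2 1) (a2 2) ∧
      ∀ z < i, A v z → a2 1 z ≠ 0) 60 ?_ ?_ ?_ ?_
    · rintro i w a y ⟨h, h2⟩
      exact ⟨h.set (by decide), by simpa using h2⟩
    · refine ⟨?_, by simp, by simpa using hlt, by simpa using hpop, by simp⟩
      rw [Function.update_of_ne (show 5 ≠ 7 by decide), Function.update_comm (by decide)]
      exact Fr.rfl.set (by decide)
    · rintro z w2 a2 t2 hz hn2 hz8 ⟨hF2, h7, hle2, hb2, h2⟩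
      have e4' : w2 4 = r := (hF2.var 4 (by decide)).trans (by simpa using e4)
      have keep : (A v z → a2 1 z ≠ 0) → ∀ z' < z + 1, A v z' → a2 1 z' ≠ 0 := by
        intro h z' hz' hA
        rcases Nat.lt_succ_iff_lt_or_eq.1 hz' with h' | rfl
        · exact h2 z' h' hA
        · exact h hA
      simp only [wp_when, wp_seq, wp_put, wp_inc]
      simp only [Cn.adj_ok, Ex.Ok, Ex.eval, Cn.adj_holds, Cn.adj_cost, Ex.cost, Cn.eq_ok,
        Cn.eq_holds, Cn.eq_cost, hz8, h7, e4']
      refine ⟨⟨trivial, trivial, hvn, hz⟩, fun hA => ⟨⟨⟨trivial, by decide⟩, by omega⟩,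
        fun hz0 => ?_, fun hz0 => ?_⟩, fun hA => ?_⟩
      · have htl2 : w2 6 ≤ n := by
          have h1 := hb2.num
          have h2 : Nat.count (fun v => a2 1 v ≠ 0) n ≤ n := Nat.count_le _
          omega
        have hz00 : a 1 z = 0 := by
          rcases hb2.lab z hz with h1 | h1
          · omega
          · exact h1.2.1
        have hzC : Cp n A u w' r z := ReflTransGen.tail hvC ⟨hA, hun z hz hz00⟩
        refine ⟨by decide, trivial, ⟨trivial, by omega, by omega⟩, by decide, trivial, trivial,
          by decide, by omega, ?_⟩
        refine ⟨by simpa using hz8, ⟨((hF2.put (by decide)).put (by decide)).set (by decide),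
          by simpa using h7, by simp; omega, by simpa using hb2.push hz hz0 hzC hle2, ?_⟩, by omega⟩
        intro z' hz' hA'
        simp only [Function.update_of_ne (show 1 ≠ 2 by decide), Function.update_self]
        rw [Function.update_apply]
        split_ifs with h
        · omega
        · exact h2 z' (by omega) hA'
      · exact ⟨trivial, ⟨hF2, trivial, hle2, hb2, keep fun _ => hz0⟩, by omega⟩
      · exact ⟨trivial, ⟨hF2, trivial, hle2, hb2, keep fun h => absurd h hA⟩, by omega⟩
    · rintro w2 a2 t2 hn2 - ⟨hF2, h7, hle2, hb2, h2⟩ ht2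
      have e5 : w2 5 = w1 5 + 1 := (hF2.var 5 (by decide)).trans (by simp)
      have hb3 := hb2.treated fun z hz => h2 z (B.lt' hz) hz
      refine ⟨⟨(hF1.set (by decide)).trans (hF2.mono (by decide) (by decide)), ?_, ?_, ?_⟩, ?_⟩
      · simpa only [e5] using hb3
      · simp only [e5]; exact hle2
      · simp only [e5, Nat.mul_succ]
        omega
      · simp only [e5]
        omega
  · rintro ⟨w1, a1, t1⟩ ⟨hF1, hb, hle, ht⟩ hn1 hlt
    simp only at hF1 hb hle ht hn1 hlt
    have e : w1 5 = w1 6 := by omega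
    rw [e] at hb ht
    obtain ⟨h1, h2, h3⟩ := hb.result hr hl hcl
    rw [h2] at ht
    exact hQ _ _ _ hF1 h1 h3 (by show t1 + 1 ≤ _; omega)

end PMCut


/-! ### Edges leaving a component. -/

namespace PMCut
open Relation

variable {n : ℕ} {A : ℕ → ℕ → Prop} {s : ℕ → Prop} {C : ℕ → Prop} {r : ℕ}

/-- Array `3` counts the neighbours with label `r + 1`, and variable `10` is set if some vertex
with this label does not have exactly one neighbour without it. -/
def leaveCmd : Cmd :=
  .set 10 (.c 0) ;; .set 9 (.add (.v 4) (.c 1)) ;; .for 8 (.put 3 (.v 8) (.c 0)) ;;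
  .for 7 (.when (.eq (.get 1 (.v 7)) (.v 9)) (.set 11 (.c 0) ;;
    .for 8 (.when (.adj (.v 7) (.v 8)) (
      .put 3 (.v 8) (.add (.get 3 (.v 8)) (.c 1)) ;;
      .ite (.eq (.get 1 (.v 8)) (.v 9)) .skip (.inc 11))) ;;
    .ite (.eq (.v 11) (.c 1)) .skip (.set 10 (.c 1))))

open Classical in
theorem leaveCmd_spec (B : BG n A s) {w a t} {Q : St → Prop} (h4 : w 4 = r) (hr : r < n)
    (hC : ∀ v < n, a 1 v = r + 1 ↔ C v)
    (hQ : ∀ w' a' t', Fr [7, 8, 9, 10, 11] [3] w a w' a' → w' 9 = r + 1 →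
      (∀ z < n, a' 3 z = Nat.count (fun v => C v ∧ A v z) n) →
      (w' 10 = 0 ↔ ∀ v < n, C v → ∃! z, A v z ∧ ¬ C z) →
      t' ≤ t + (100 * n + 50) * Nat.count C n + 100 * n + 50 → Q ⟨w', a', t'⟩) :
    wp n A leaveCmd Q ⟨w, a, t⟩ := by
  simp only [leaveCmd, wp_seq, wp_set]
  simp only [Ex.Ok, Ex.eval, Ex.cost]
  refine ⟨by decide, by simp, by decide, ⟨trivial, by simp, by simp; omega⟩, ?_⟩
  refine wp_for_const (by decide) (fun i w' a' => Fr [8, 9, 10] [3] w a w' a' ∧ w' 9 = r + 1 ∧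
    w' 10 = 0 ∧ ∀ z < i, a' 3 z = 0) 12 ?_ ?_ ?_ ?_
  · rintro i w a y ⟨h, h2⟩
    exact ⟨h.set (by decide), by simpa using h2⟩
  · exact ⟨(Fr.rfl.set (by decide)).set (by decide), by simp [h4], by simp, by simp⟩
  · rintro z w1 a1 t1 hz hn1 hz8 ⟨hF, h9, h10, h1⟩
    simp [hz8, h9, h10, -Order.lt_add_one_iff]
    refine ⟨hF.put (by decide), fun v hv => ?_⟩
    rw [Function.update_apply]
    split_ifs
    · rfl
    · exact h1 v (by omega)
  rintro w1 a1 t1 hn1 - ⟨hF1, h9, h10, h1⟩ ht1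
  -- Only members of `C` scan a row of the matrix. With a uniform bound per iteration the components
  -- of one pair could cost `n ^ 3`.
  refine wp_for_sum (by decide) (fun i w' a' => Fr [7, 8, 9, 10, 11] [3] w a w' a' ∧
    w' 9 = r + 1 ∧ (∀ z < n, a' 3 z = Nat.count (fun v => C v ∧ A v z) i) ∧
    (w' 10 = 0 ↔ ∀ v < i, C v → ∃! z, A v z ∧ ¬ C z))
    (fun v => if C v then 90 * n + 50 else 20) ?_ ?_ ?_ ?_
  · rintro i w a y ⟨h, h2⟩
    exact ⟨h.set (by decide), by simpa using h2⟩
  · exact ⟨hF1.mono (by decide) (by decide), h9, fun z hz => by simp [h1 z hz], by simp [h10]⟩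
  · rintro v w2 a2 t2 hv hn2 hv7 ⟨hF2, h9, h2, h3⟩
    have e1 := hF2.arr 1 (by decide)
    simp only [wp_when, wp_seq, wp_set]
    simp only [Cn.eq_ok, Ex.Ok, Ex.eval, Cn.eq_holds, Cn.eq_cost, Ex.cost, hv7, e1, h9, hC v hv]
    refine ⟨⟨⟨trivial, by decide⟩, trivial⟩, fun hCv => ⟨by decide, by simp, ?_⟩, fun hCv =>
      ⟨trivial, ⟨hF2, trivial, fun z hz => ?_, ?_⟩, ?_⟩⟩
    · refine wp_for_const (by decide) (fun i w' a' => Fr [8, 11] [3] w2 a2 w' a' ∧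
        (∀ z < n, a' 3 z = Nat.count (fun v => C v ∧ A v z) v + if z < i ∧ A v z then 1 else 0) ∧
        w' 11 = Nat.count (fun z => A v z ∧ ¬ C z) i) 70 ?_ ?_ ?_ ?_
      · rintro i w a y ⟨h, h2⟩
        exact ⟨h.set (by decide), by simpa using h2⟩
      · exact ⟨Fr.rfl.set (by decide), fun z hz => by simp [h2 z hz], by simp⟩
      · rintro z w3 a3 t3 hz hn3 hz8 ⟨hF3, h4, h11⟩
        have e7 := (hF3.var 7 (by decide)).trans hv7
        have e9 := (hF3.var 9 (by decide)).trans h9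
        have e1' := (hF3.arr 1 (by decide)).trans e1
        have hle : Nat.count (fun z => A v z ∧ ¬ C z) z ≤ z := Nat.count_le _
        have hle3 : a3 3 z ≤ n := by
          have : Nat.count (fun v => C v ∧ A v z) v ≤ v := Nat.count_le _
          rw [h4 z hz]
          simp
          omega
        have h4' : A v z → ∀ y < n, Function.update (a3 3) z (a3 3 z + 1) y =
            Nat.count (fun v => C v ∧ A v y) v + if y < z + 1 ∧ A v y then 1 else 0 := by
          intro hA y hy
          by_cases hyz : y = z
          · subst hyz
            simp [h4 y hy, hA]
          · rw [Function.update_of_ne hyz, h4 y hy]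
            have : y < z + 1 ↔ y < z := by omega
            simp only [this]
        have h4'' : ¬ A v z → ∀ y < n, a3 3 y =
            Nat.count (fun v => C v ∧ A v y) v + if y < z + 1 ∧ A v y then 1 else 0 := by
          intro hA y hy
          by_cases hyz : y = z
          · subst hyz
            simp [h4 y hy, hA]
          · rw [h4 y hy]
            have : y < z + 1 ↔ y < z := by omega
            simp only [this]
        simp only [wp_when, wp_seq, wp_put, wp_ite, wp_skip, wp_inc]
        simp only [Cn.adj_ok, Cn.adj_holds, Cn.adj_cost, Cn.eq_ok, Ex.Ok, Ex.eval, Cn.eq_holds,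
          Cn.eq_cost, Ex.cost, hz8, e7, e9, Function.update_of_ne (show 1 ≠ 3 by decide), e1', hC z hz,
          Nat.count_succ]
        refine ⟨⟨trivial, trivial, hv, hz⟩, fun hA => ⟨by decide, trivial, ⟨⟨trivial, by decide⟩,
          by omega, by omega⟩, ⟨⟨trivial, by decide⟩, trivial⟩, fun hCz => ?_, fun hCz => ?_⟩,
          fun hA => ?_⟩
        · exact ⟨trivial, ⟨hF3.put (by decide), by simpa using h4' hA, by simp [h11, hCz]⟩, by omega⟩
        · exact ⟨by decide, by omega, by simpa using hz8, ⟨(hF3.put (by decide)).set (by decide),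
            by simpa using h4' hA, by simp [h11, hCz, hA]⟩, by omega⟩
        · exact ⟨trivial, ⟨hF3, h4'' hA, by simp [h11, hA]⟩, by omega⟩
      · rintro w3 a3 t3 hn3 - ⟨hF3, h4, h11⟩ ht3
        have e7 := (hF3.var 7 (by decide)).trans hv7
        have e9 := (hF3.var 9 (by decide)).trans h9
        have e10 := hF3.var 10 (by decide)
        have h11' : w3 11 = 1 ↔ ∃! z, A v z ∧ ¬ C z := by rw [h11]; exact count_eq_one B
        have hF4 : Fr [7, 8, 9, 10, 11] [3] w a w3 a3 := hF2.trans (hF3.mono (by decide) (by decide))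
        have h5 : ∀ z < n, a3 3 z = Nat.count (fun v => C v ∧ A v z) (v + 1) := fun z hz => by
          rw [h4 z hz, Nat.count_succ]
          simp [hCv, hz]
        simp only [wp_ite, wp_skip, wp_set]
        simp only [Cn.eq_ok, Ex.Ok, Ex.eval, Cn.eq_holds, Cn.eq_cost, Ex.cost, h11', if_pos hCv]
        refine ⟨⟨trivial, by omega⟩, fun h => ?_, fun h => ?_⟩
        · refine ⟨e7, ⟨hF4, e9, h5, ?_⟩, by omega⟩
          rw [e10, h3]
          simp only [Nat.forall_lt_succ_right]
          tauto
        · refine ⟨by decide, by omega, by simpa using e7, ⟨hF4.set (by decide), by simpa using e9,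
            h5, ?_⟩, by omega⟩
          simp only [Function.update_self, Nat.forall_lt_succ_right]
          tauto
    · rw [h2 z hz, Nat.count_succ]
      simp [hCv]
    · rw [h3]
      simp only [Nat.forall_lt_succ_right]
      tauto
    · simp [hCv]
  · rintro w2 a2 t2 hn2 - ⟨hF2, h9, h2, h3⟩ ht2
    refine hQ _ _ _ hF2 h9 h2 h3 (ht2.trans ?_)
    rw [Finset.sum_add_distrib, Finset.sum_ite, Finset.sum_const, Finset.sum_const,
      Finset.sum_const, ← count_eq_card, ← count_eq_card, Finset.card_range]
    have h1 : Nat.count (fun x => ¬ C x) n ≤ n := Nat.count_le _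
    have h2 : Nat.count C n * (90 * n + 50) ≤ (100 * n + 50) * Nat.count C n := by
      rw [mul_comm]
      exact Nat.mul_le_mul_right _ (by omega)
    simp only [smul_eq_mul]
    change t1 + (Nat.count C n * (90 * n + 50) + _ + _) + 3 ≤ _
    omega

end PMCut


/-! ### The kernel of a component, and the complete test. -/

namespace PMCut
open Relation

variable {n : ℕ} {A : ℕ → ℕ → Prop} {s : ℕ → Prop} {C : ℕ → Prop} {r : ℕ}

open Classical in
/-- The marks of the vertices without neighbours in `C`: `1` on the left side, `2` on the right. -/
noncomputable def mark (n : ℕ) (A : ℕ → ℕ → Prop) (s C : ℕ → Prop) (z : ℕ) : ℕ :=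
  if Kp n A C z then if s z then 1 else 2 else 0

/-- Mark and count the vertices without neighbours in the labelled set, and set variable `10` if
some vertex has several such neighbours or `v2` or `v3` is not minimal. -/
def kernelCmd : Cmd :=
  .set 18 (.c 0) ;; .set 19 (.c 0) ;;
  .for 8 (.ite (.eq (.get 1 (.v 8)) (.v 9)) (.put 9 (.v 8) (.c 0))
    (.ite (.eq (.get 3 (.v 8)) (.c 0))
      (.ite (.eq (.get 0 (.v 8)) (.c 1))
        (.put 9 (.v 8) (.c 1) ;; .inc 19 ;; .when (.lt (.v 8) (.v 2)) (.set 10 (.c 1)))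
        (.put 9 (.v 8) (.c 2) ;; .inc 18 ;; .when (.lt (.v 8) (.v 3)) (.set 10 (.c 1))))
      (.put 9 (.v 8) (.c 0) ;; .ite (.eq (.get 3 (.v 8)) (.c 1)) .skip (.set 10 (.c 1)))))

-- Variable `10` inherits the flag of `leaveCmd`; after this pass it is `0` exactly if the triple is
-- canonical, see `hcanon` in `compCmd_spec`.
open Classical in
theorem kernelCmd_spec {w a t u u'} {Q : St → Prop} (h2 : w 2 = u) (h3 : w 3 = u')
    (h9 : w 9 = r + 1) (hC : ∀ v < n, a 1 v = r + 1 ↔ C v) (hs : ∀ v < n, a 0 v = 1 ↔ s v)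
    (hK : ∀ z < n, ¬ C z → (a 3 z = 0 ↔ Kp n A C z))
    (hQ : ∀ w' a' t', Fr [8, 10, 18, 19] [9] w a w' a' →
      (∀ z < n, a' 9 z = mark n A s C z) → w' 19 = kx n A s C → w' 18 = ky n A s C →
      (w' 10 = 0 ↔ w 10 = 0 ∧ ∀ z < n, (¬ C z → a 3 z ≤ 1) ∧ (Kp n A C z → s z → u ≤ z) ∧
        (Kp n A C z → ¬ s z → u' ≤ z)) →
      t' ≤ t + 100 * n + 50 → Q ⟨w', a', t'⟩) :
    wp n A kernelCmd Q ⟨w, a, t⟩ := by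
  simp only [kernelCmd, wp_seq, wp_set]
  refine ⟨by decide, by simp, by decide, by simp, ?_⟩
  refine wp_for_const (by decide) (fun i w' a' => Fr [8, 10, 18, 19] [9] w a w' a' ∧
    (∀ z < i, a' 9 z = mark n A s C z) ∧ w' 19 = Nat.count (fun z => Kp n A C z ∧ s z) i ∧
    w' 18 = Nat.count (fun z => Kp n A C z ∧ ¬ s z) i ∧
    (w' 10 = 0 ↔ w 10 = 0 ∧ ∀ z < i, (¬ C z → a 3 z ≤ 1) ∧ (Kp n A C z → s z → u ≤ z) ∧
        (Kp n A C z → ¬ s z → u' ≤ z))) 80 ?_ ?_ ?_ ?_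
  · rintro i w a y ⟨h, h2⟩
    exact ⟨h.set (by decide), by simpa using h2⟩
  · exact ⟨(Fr.rfl.set (by decide)).set (by decide), by simp⟩
  · rintro z w1 a1 t1 hz hn1 hz8 ⟨hF, h4, h5, h6, h7⟩
    have e9 := (hF.var 9 (by decide)).trans h9
    have e2 := (hF.var 2 (by decide)).trans h2
    have e3 := (hF.var 3 (by decide)).trans h3
    have e1 := hF.arr 1 (by decide)
    have e0 := hF.arr 0 (by decide)
    have e3' := hF.arr 3 (by decide)
    have hle1 : Nat.count (fun z => Kp n A C z ∧ s z) z ≤ z := Nat.count_le _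
    have hle2 : Nat.count (fun z => Kp n A C z ∧ ¬ s z) z ≤ z := Nat.count_le _
    have upd : ∀ k, k = mark n A s C z → ∀ y < z + 1,
        Function.update (a1 9) z k y = mark n A s C y := by
      rintro k rfl y hy
      rw [Function.update_apply]
      split_ifs with h
      · rw [h]
      · exact h4 y (by omega)
    have hKC : C z → ¬ Kp n A C z := fun h h' => h'.2.1 h
    simp only [wp_ite, wp_seq, wp_put, wp_inc, wp_when, wp_set, wp_skip]
    simp only [Cn.eq_ok, Cn.eq_holds, Cn.eq_cost, Cn.lt_ok, Cn.lt_holds, Cn.lt_cost, Ex.Ok, Ex.eval,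
      Ex.cost, hz8, e9, e1, e0, e3', hC z hz, hs z hz, Function.update_self,
      Function.update_of_ne (show 3 ≠ 9 by decide), Function.update_of_ne (show 8 ≠ 18 by decide),
      Function.update_of_ne (show 8 ≠ 19 by decide), Function.update_of_ne (show 2 ≠ 19 by decide),
      Function.update_of_ne (show 3 ≠ 18 by decide), e2, e3, Nat.forall_lt_succ_right,
      Nat.count_succ]
    refine ⟨⟨⟨trivial, by decide⟩, trivial⟩, fun hCz => ?_, fun hCz => ⟨⟨⟨trivial, by decide⟩,
      by omega⟩, fun h0 => ⟨⟨⟨trivial, by decide⟩, by omega⟩, fun hsz => ?_, fun hsz => ?_⟩,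
      fun h0 => ?_⟩⟩
    · have hk := hKC hCz
      refine ⟨by decide, trivial, by omega, trivial, ⟨hF.put (by decide), ?_, ?_, ?_, ?_⟩, by omega⟩
      · simpa using Nat.forall_lt_succ_right.1 (upd 0 (by simp [mark, hk]))
      · simp [hk, h5]
      · simp [hk, h6]
      · rw [h7]; simp [hk, hCz]
    · have hk := (hK z hz hCz).1 h0
      have hm := Nat.forall_lt_succ_right.1 (upd 1 (by simp [mark, hk, hsz]))
      refine ⟨by decide, trivial, by omega, by decide, by omega, ⟨trivial, trivial⟩,
        fun hlt => ⟨by decide, by omega, ?_⟩, fun hlt => ?_⟩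
      · refine ⟨by simpa using hz8, ⟨((hF.put (by decide)).set (by decide)).set (by decide), ?_, ?_,
          ?_, ?_⟩, by omega⟩
        · simpa using hm
        · simp [h5, hk, hsz]
        · simp [h6, hsz]
        · simp [hk, hsz, hlt]
      · refine ⟨by simp, ⟨(hF.put (by decide)).set (by decide), ?_, ?_, ?_, ?_⟩,
          by omega⟩
        · simpa using hm
        · simp [h5, hk, hsz]
        · simp [h6, hsz]
        · simp [h7, hk, hsz, hCz, h0, not_lt.1 hlt]
    · have hk := (hK z hz hCz).1 h0
      have hm := Nat.forall_lt_succ_right.1 (upd 2 (by simp [mark, hk, hsz]))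
      refine ⟨by decide, trivial, by omega, by decide, by omega, ⟨trivial, trivial⟩,
        fun hlt => ⟨by decide, by omega, ?_⟩, fun hlt => ?_⟩
      · refine ⟨by simpa using hz8, ⟨((hF.put (by decide)).set (by decide)).set (by decide), ?_, ?_,
          ?_, ?_⟩, by omega⟩
        · simpa using hm
        · simp [h5, hsz]
        · simp [h6, hk, hsz]
        · simp [hk, hsz, hlt]
      · refine ⟨by simp, ⟨(hF.put (by decide)).set (by decide), ?_, ?_, ?_, ?_⟩,
          by omega⟩
        · simpa using hm
        · simp [h5, hsz]
        · simp [h6, hk, hsz]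
        · simp [h7, hk, hsz, hCz, h0, not_lt.1 hlt]
    · have hk : ¬ Kp n A C z := fun h => h0 ((hK z hz hCz).2 h)
      have hm := Nat.forall_lt_succ_right.1 (upd 0 (by simp [mark, hk]))
      refine ⟨by decide, trivial, by omega, ⟨⟨trivial, by decide⟩, by omega⟩, fun h1 => ?_,
        fun h1 => ⟨by decide, by omega, ?_⟩⟩
      · refine ⟨trivial, ⟨hF.put (by decide), by simpa using hm, ?_, ?_, ?_⟩, by omega⟩
        · simp [h5, hk]
        · simp [h6, hk]
        · simp [h7, hk, h1]
      · refine ⟨by simpa using hz8, ⟨(hF.put (by decide)).set (by decide), by simpa using hm, ?_, ?_, ?_⟩,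
          by omega⟩
        · simp [h5, hk]
        · simp [h6, hk]
        · have : ¬ a 3 z ≤ 1 := by omega
          simp [hk, hCz, this]
  · rintro w1 a1 t1 hn1 - ⟨hF, h4, h5, h6, h7⟩ ht
    simp only [Ex.cost] at ht
    exact hQ _ _ _ hF h4 h5 h6 h7 (by omega)

/-- The test of the component of `r` succeeds. -/
def Test (n : ℕ) (A : ℕ → ℕ → Prop) (s : ℕ → Prop) (u w r : ℕ) : Prop :=
  Canon n A s u w r ∧ kx n A s (Cp n A u w r) = ky n A s (Cp n A u w r) ∧
    KMatch n A s (Cp n A u w r)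

/-- The program tests a component only from the first of its vertices that it meets; this transfers
the result from any other root. -/
theorem Test.root (B : BG n A s) {u w r v : ℕ} (hr : Un n A u w r) (hv : Cp n A u w r v)
    (h : Test n A s u w v) : Test n A s u w r := by
  obtain ⟨h1, h2, h3⟩ := h
  have e := Cp.eq B hr hv
  rw [e] at h2 h3
  exact ⟨⟨hr, e ▸ h1.valid, e ▸ h1.left, e ▸ h1.right⟩, h2, h3⟩

theorem markMatch_iff {c : ℕ → ℕ} (hc : ∀ z < n, c z = mark n A s C z) :
    MarkMatch n A c ↔ KMatch n A s C := by
  have h1 : ∀ z < n, c z = 1 ↔ Kp n A C z ∧ s z := fun z hz => by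
    rw [hc z hz, mark]; split_ifs <;> simp_all
  have h2 : ∀ z < n, c z = 2 ↔ Kp n A C z ∧ ¬ s z := fun z hz => by
    rw [hc z hz, mark]; split_ifs <;> simp_all
  refine exists_congr fun f => ⟨?_, ?_⟩
  · rintro ⟨f1, f2⟩
    refine ⟨fun x hx sx => ?_, fun x y hx sx hy sy => f2 x hx.1 y hy.1 ((h1 x hx.1).2 ⟨hx, sx⟩)
      ((h1 y hy.1).2 ⟨hy, sy⟩)⟩
    obtain ⟨g1, g2, g3⟩ := f1 x hx.1 ((h1 x hx.1).2 ⟨hx, sx⟩)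
    have := (h2 _ g1).1 g2
    exact ⟨this.1, this.2, g3⟩
  · rintro ⟨f1, f2⟩
    refine ⟨fun x hx cx => ?_, fun x hx y hy cx cy => ?_⟩
    · obtain ⟨g1, g2⟩ := (h1 x hx).1 cx
      obtain ⟨g3, g4, g5⟩ := f1 x g1 g2
      exact ⟨g3.1, (h2 _ g3.1).2 ⟨g3, g4⟩, g5⟩
    · obtain ⟨g1, g2⟩ := (h1 x hx).1 cx
      obtain ⟨g3, g4⟩ := (h1 y hy).1 cy
      exact f2 x y g1 g2 g3 g4

/-- Find and test the component of `v4`. -/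
def compCmd : Cmd :=
  bfsCmd ;; leaveCmd ;; kernelCmd ;;
  .when (.eq (.v 10) (.c 0)) (.when (.eq (.v 18) (.v 19)) auctionCmd)

/-- The variables changed by `compCmd`. -/
def compVars : List ℕ := [1, 5, 6, 7, 8, 9, 10, 11, 12, 13, 14, 15, 16, 17, 18, 19, 20]

/-- The arrays changed by `compCmd`. -/
def compArrs : List ℕ := [1, 2, 3, 4, 5, 9]

open Classical in
theorem compCmd_spec (B : BG n A s) {u u' : ℕ} {w a t} {Q : St → Prop} (h2 : w 2 = u)
    (h3 : w 3 = u') (h4 : w 4 = r) (hs : ∀ v < n, a 0 v = 1 ↔ s v) (su : s u) (su' : ¬ s u')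
    (hr0 : a 1 r = 0) (hr : Un n A u u' r) (hl : ∀ v < n, a 1 v ≠ r + 1)
    (hun : ∀ v < n, a 1 v = 0 → Un n A u u' v)
    (hcl : ∀ v < n, a 1 v = 0 → ∀ z, A v z → Un n A u u' z → a 1 z = 0) (hw : Ans n A w)
    (hQ : ∀ w2 a2 t2, Fr compVars compArrs w a w2 a2 →
      (∀ v < n, a2 1 v = if Cp n A u u' r v then r + 1 else a 1 v) →
      Nat.count (fun v => a2 1 v ≠ 0) n =
        Nat.count (fun v => a 1 v ≠ 0) n + Nat.count (Cp n A u u' r) n →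
      Ans n A w2 → (w 1 = 1 ∨ Test n A s u u' r → w2 1 = 1) →
      t2 ≤ t + (200 * n + 100) * Nat.count (Cp n A u u' r) n + 600 * n + 600 +
        (200 * n + 200) * testCost n A s u u' r → Q ⟨w2, a2, t2⟩) :
    wp n A compCmd Q ⟨w, a, t⟩ := by
  have hrn : r < n := hr.1
  simp only [compCmd, wp_seq]
  refine bfsCmd_spec B h4 hr0 hr hl hun hcl fun w1 a1 t1 hF1 hlab hcnt ht1 => ?_
  set C := Cp n A u u' r with hCdef
  have hC : ∀ v < n, a1 1 v = r + 1 ↔ C v := fun v hv => by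
    rw [hlab v hv]
    have := hl v hv
    split_ifs with h <;> simp [h, this]
  have hCn : ∀ v, C v → v < n := fun v hv => (Cp.un hr hv).1
  refine leaveCmd_spec B ((hF1.var 4 (by decide)).trans h4) hrn hC
    fun w2 a2 t2 hF2 h9 hnb hout ht2 => ?_
  have hF12 : Fr [5, 6, 7, 8, 9, 10, 11] [1, 2, 3] w a w2 a2 :=
    (hF1.mono (by decide) (by decide)).trans (hF2.mono (by decide) (by decide))
  have hnb0 : ∀ z < n, a2 3 z = 0 ↔ ∀ v, C v → ¬ A v z := fun z hz => by
    rw [hnb z hz, count_eq_card, Finset.card_eq_zero, Finset.filter_eq_empty_iff]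
    simp only [Finset.mem_range, not_and]
    exact ⟨fun h v hv => h (hCn v hv) hv, fun h v _ hv => h v hv⟩
  have hnb1 : ∀ z < n, a2 3 z ≤ 1 ↔ ∀ v v', C v → C v' → A v z → A v' z → v = v' := fun z hz => by
    rw [hnb z hz, count_eq_card, Finset.card_le_one]
    simp only [Finset.mem_filter, Finset.mem_range]
    exact ⟨fun h v v' hv hv' h1 h2 => h v ⟨hCn v hv, hv, h1⟩ v' ⟨hCn v' hv', hv', h2⟩,
      fun h v h1 v' h2 => h v v' h1.2.1 h2.2.1 h1.2.2 h2.2.2⟩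
  have e1 : a2 1 = a1 1 := hF2.arr 1 (by decide)
  refine kernelCmd_spec (s := s) (A := A) (r := r) (C := C)
    ((hF12.var 2 (by decide)).trans h2) ((hF12.var 3 (by decide)).trans h3)
    h9 (by rw [e1]; exact hC) (by rw [hF12.arr 0 (by decide)]; exact hs)
    (fun z hz hCz => by rw [hnb0 z hz]; exact ⟨fun h => ⟨hz, hCz, h⟩, fun h => h.2.2⟩)
    fun w3 a3 t3 hF3 hmark h19 h18 h10 ht3 => ?_
  have hcanon : w3 10 = 0 ↔ Canon n A s u u' r := by
    rw [h10, hout]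
    constructor
    · rintro ⟨g1, g2⟩
      refine ⟨hr, ⟨fun v hv => ?_, fun z v v' hz hv hv' h h' => ?_⟩, fun z hz sz => ?_,
        fun z hz sz => ?_⟩
      · obtain ⟨z, ⟨z1, z2⟩, z3⟩ := g1 v (hCn v hv) hv
        exact ⟨z, z2, z1, fun y y1 y2 => z3 y ⟨y2, y1⟩⟩
      · exact (hnb1 z (B.lt' h)).1 ((g2 z (B.lt' h)).1 hz) v v' hv hv' h h'
      · exact (g2 z hz.1).2.1 hz sz
      · exact (g2 z hz.1).2.2 hz sz
    · intro h
      refine ⟨fun v _ hv => ?_, fun z hz => ⟨fun hCz => (hnb1 z hz).2 fun v v' hv hv' =>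
        h.valid.inn z v v' hCz hv hv', h.left z, h.right z⟩⟩
      obtain ⟨z, z1, z2, z3⟩ := h.valid.out v hv
      exact ⟨z, ⟨z2, z1⟩, fun y hy => z3 y hy.2 hy.1⟩
  have hF : Fr compVars compArrs w a w3 a3 := (hF12.mono (by decide) (by decide)).trans
    (hF3.mono (by decide) (by decide))
  have e13 : w3 1 = w 1 := (hF3.var 1 (by decide)).trans (hF12.var 1 (by decide))
  have e3 : a3 1 = a1 1 := (hF3.arr 1 (by decide)).trans e1
  have htime : t3 ≤ t + (200 * n + 100) * Nat.count C n + 200 * n + 150 := by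
    have : (200 * n + 100) * Nat.count C n = (100 * n + 50) * Nat.count C n +
      (100 * n + 50) * Nat.count C n := by ring
    omega
  have idle : ¬ (Canon n A s u u' r ∧ kx n A s C = ky n A s C) → ∀ t4 ≤ t3 + 20,
      Q ⟨w3, a3, t4⟩ := by
    intro h t4 ht4
    refine hQ _ _ _ hF (by rw [e3]; exact hlab) (by rw [e3]; exact hcnt) (hw.congr e13) ?_ ?_
    · rintro (h' | h')
      · rw [e13, h']
      · exact absurd ⟨h'.1, h'.2.1⟩ h
    · omega
  simp only [wp_when]
  simp only [Cn.eq_ok, Cn.eq_holds, Cn.eq_cost, Ex.Ok, Ex.eval, Ex.cost, hcanon, h18, h19]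
  refine ⟨⟨trivial, by omega⟩, fun hc => ⟨⟨trivial, trivial⟩, fun hk => ?_, fun hk => ?_⟩,
    fun hc => idle (fun h => hc h.1) _ (by omega)⟩
  swap
  · exact idle (fun h => hk h.2.symm) _ (by omega)
  have hcount : Nat.count (fun y => a3 9 y = 2) n = ky n A s C := by
    rw [ky, count_eq_card, count_eq_card]
    congr 1
    refine Finset.filter_congr fun z hz => ?_
    rw [hmark z (Finset.mem_range.1 hz), mark]
    split_ifs <;> simp_all
  have hmm : MarkMatch n A (a3 9) ↔ KMatch n A s C := markMatch_iff hmark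
  refine auctionCmd_spec hcount rfl h18 fun w4 a4 t4 hF4 g1 g2 ht4 => ?_
  have e4 : a4 1 = a3 1 := hF4.arr 1 (by decide)
  -- The auction runs only for canonical triples with kernel sides of equal size, so its bound `k *
  -- k` is the product in `testCost`.
  have htc : testCost n A s u u' r = ky n A s C * ky n A s C := by
    rw [testCost, if_pos ⟨su, su', hc⟩, ← hk]
  refine hQ _ _ _ (hF.trans (hF4.mono (by decide) (by decide))) (by rw [e4, e3]; exact hlab)
    (by rw [e4, e3]; exact hcnt) ?_ ?_ ?_
  · rcases g2 with g2 | ⟨g2, g3⟩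
    · exact hw.congr (g2.trans e13)
    · exact .inr ⟨g2, hasCut_of_valid B hc.valid (Cp.self u u' r) hrn hk.symm (hmm.1 g3)⟩
  · rintro (h | h)
    · rcases g2 with g2 | g2
      · rw [g2, e13, h]
      · exact g2.1
    · exact g1 (hmm.2 h.2.2)
  · rw [htc]
    have : (200 * n + 200) * (ky n A s C * ky n A s C + 2) =
      (200 * n + 200) * (ky n A s C * ky n A s C) + (400 * n + 400) := by ring
    omega

end PMCut


/-! ### All components for all pairs. -/

namespace PMCut
open Relation

variable {n : ℕ} {A : ℕ → ℕ → Prop} {s : ℕ → Prop}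

/-- Give the label `n + 1` to `v8`. -/
def blockCmd : Cmd := .put 1 (.v 8) (.add (.v 0) (.c 1))

/-- Give the label `n + 1` to the closed neighbourhoods of `v2` and `v3`, and `0` to the other
vertices. -/
def labelCmd : Cmd :=
  .for 8 (.ite (.eq (.v 8) (.v 2)) blockCmd (.ite (.eq (.v 8) (.v 3)) blockCmd
    (.ite (.adj (.v 2) (.v 8)) blockCmd (.ite (.adj (.v 3) (.v 8)) blockCmd
    (.put 1 (.v 8) (.c 0))))))

-- The label `n + 1` differs from every label `r + 1` of a component, as `r < n`.
open Classical in
theorem labelCmd_spec {u u' : ℕ} {w a t} {Q : St → Prop} (hu : u < n) (hu' : u' < n)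
    (h2 : w 2 = u) (h3 : w 3 = u')
    (hQ : ∀ w2 a2 t2, Fr [8] [1] w a w2 a2 →
      (∀ v < n, a2 1 v = if Un n A u u' v then 0 else n + 1) → t2 ≤ t + 100 * n + 10 →
      Q ⟨w2, a2, t2⟩) :
    wp n A labelCmd Q ⟨w, a, t⟩ := by
  refine wp_for_const (by decide) (fun i w' a' => Fr [8] [1] w a w' a' ∧
    ∀ v < i, a' 1 v = if Un n A u u' v then 0 else n + 1) 90 ?_ ?_ ?_ ?_
  · exact fun i w a y h => ⟨h.1.set (by decide), h.2⟩
  · exact ⟨Fr.rfl, by simp⟩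
  · rintro v w1 a1 t1 hv hn1 hv8 ⟨hF, h1⟩
    have e2 := (hF.var 2 (by decide)).trans h2
    have e3 := (hF.var 3 (by decide)).trans h3
    have key : ∀ k t2, t2 ≤ t1 + 90 → k = (if Un n A u u' v then 0 else n + 1) →
        w1 8 = v ∧ (Fr [8] [1] w a w1 (Function.update a1 1 (Function.update (a1 1) v k)) ∧
          ∀ v' < v + 1, Function.update a1 1 (Function.update (a1 1) v k) 1 v' =
            if Un n A u u' v' then 0 else n + 1) ∧ t2 ≤ t1 + 90 := by
      rintro k t2 ht2 rfl
      refine ⟨hv8, ⟨hF.put (by decide), fun v' hv' => ?_⟩, ht2⟩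
      rw [Function.update_self]
      by_cases h : v' = v
      · rw [h, Function.update_self]
      · rw [Function.update_of_ne h]
        exact h1 v' (by omega)
    simp only [blockCmd, wp_ite, wp_put]
    simp only [Cn.eq_ok, Cn.eq_holds, Cn.eq_cost, Cn.adj_ok, Cn.adj_holds, Cn.adj_cost, Ex.Ok,
      Ex.eval, Ex.cost, hv8, e2, e3, hn1]
    have ok : 1 < 16 ∧ True ∧ (True ∧ 1 ≤ n + 9 ∧ n + 1 ≤ n + 9) :=
      ⟨by decide, trivial, trivial, by omega, by omega⟩
    have blocked : ∀ t2 ≤ t1 + 90, ¬ Un n A u u' v → _ := fun t2 ht2 h =>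
      key (n + 1) t2 ht2 (if_neg h).symm
    simp only [hv8] at blocked key
    refine ⟨⟨trivial, trivial⟩, fun h => ⟨ok.1, trivial, ok.2.2, blocked _ (by omega) fun h' => h'.2.1 h⟩, fun g1 =>
      ⟨⟨trivial, trivial⟩, fun h => ⟨ok.1, trivial, ok.2.2, blocked _ (by omega) fun h' => h'.2.2.1 h⟩, fun g2 =>
      ⟨⟨trivial, trivial, hu, hv⟩, fun h => ⟨ok.1, trivial, ok.2.2, blocked _ (by omega) fun h' => h'.2.2.2.1 h⟩, fun g3 =>
      ⟨⟨trivial, trivial, hu', hv⟩, fun h => ⟨ok.1, trivial, ok.2.2, blocked _ (by omega) fun h' => h'.2.2.2.2 h⟩, fun g4 =>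
      ⟨ok.1, trivial, by omega, key 0 _ (by omega) (if_pos ⟨hv, g1, g2, g3, g4⟩).symm⟩⟩⟩⟩⟩
  · rintro w' a' t' - - ⟨hF, h⟩ ht
    exact hQ w' a' t' hF h (by omega)

/-- Test the components of the graph without the closed neighbourhoods of `v2` and `v3`. -/
def pairCmd : Cmd := labelCmd ;; .for 4 (.when (.eq (.get 1 (.v 4)) (.c 0)) compCmd)

open Classical in
theorem pairCmd_spec (B : BG n A s) {u u' : ℕ} {w a t} {Q : St → Prop} (hu : u < n) (hu' : u' < n)
    (h2 : w 2 = u) (h3 : w 3 = u') (hs : ∀ v < n, a 0 v = 1 ↔ s v) (su : s u) (su' : ¬ s u')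
    (hw : Ans n A w)
    (hQ : ∀ w2 a2 t2, Fr (4 :: compVars) compArrs w a w2 a2 → Ans n A w2 →
      ((w 1 = 1 ∨ ∃ r, Test n A s u u' r) → w2 1 = 1) →
      t2 ≤ t + 2000 * (n * n) + 2000 * n + 100 +
        (200 * n + 200) * ∑ r ∈ Finset.range n, testCost n A s u u' r → Q ⟨w2, a2, t2⟩) :
    wp n A pairCmd Q ⟨w, a, t⟩ := by
  simp only [pairCmd, wp_seq]
  refine labelCmd_spec hu hu' h2 h3 fun w1 a1 t1 hF1 h1 ht1 => ?_
  -- The unlabelled vertices always form a union of components. The number of labelled vertices pays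
  -- for the searches, the counter `i` for the linear passes, and the sum of `testCost` for the
  -- auctions.
  refine wp_for (by decide) (fun i τ => Fr (4 :: compVars) compArrs w a τ.v τ.a ∧ Ans n A τ.v ∧
    (w 1 = 1 → τ.v 1 = 1) ∧
    (∀ v < n, τ.a 1 v = 0 → Un n A u u' v) ∧
    (∀ v < n, τ.a 1 v ≤ i ∨ τ.a 1 v = n + 1) ∧
    (∀ v < n, τ.a 1 v = 0 → ∀ z, A v z → Un n A u u' z → τ.a 1 z = 0) ∧
    (∀ v < i, τ.a 1 v ≠ 0) ∧
    (∀ v < n, Un n A u u' v → τ.a 1 v ≠ 0 → Test n A s u u' v → τ.v 1 = 1) ∧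
    τ.t ≤ t1 + 2 + (200 * n + 100) * Nat.count (fun v => τ.a 1 v ≠ 0) n + (600 * n + 650) * i +
      (200 * n + 200) * ∑ r ∈ Finset.range i, testCost n A s u u' r) ?_ ?_ ?_
  · have e1 := hF1.var 1 (by decide)
    refine ⟨(hF1.mono (by decide) (by decide)).set (by decide), hw.congr (by simpa using e1),
      by simp [e1], fun v hv h => ?_, fun v hv => ?_, fun v hv h z hz hzu => ?_, by simp,
      fun v hv hvu h => ?_, ?_⟩
    · simp only [h1 v hv] at h
      by_contra hc
      simp [hc] at h
    · simp only [h1 v hv]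
      split_ifs <;> simp
    · simp only [h1 z hzu.1, if_pos hzu]
    · simp only [h1 v hv, if_pos hvu] at h
      exact absurd rfl h
    · simp
  · rintro r w2 a2 t2 hr hn2 hr4 ⟨hF2, hw2, m1, i1, i2, i3, i4, i5, ht2⟩
    simp only at hF2 hw2 m1 i1 i2 i3 i4 i5 ht2
    simp only [wp_when]
    simp only [Cn.eq_ok, Cn.eq_holds, Cn.eq_cost, Ex.Ok, Ex.eval, Ex.cost, hr4]
    refine ⟨⟨⟨trivial, by decide⟩, by omega⟩, fun h0 => ?_, fun h0 => ?_⟩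
    · have hru := i1 r hr h0
      refine compCmd_spec B ((hF2.var 2 (by decide)).trans h2) ((hF2.var 3 (by decide)).trans h3)
        hr4 (by rw [hF2.arr 0 (by decide)]; exact hs) su su' h0 hru (fun v hv h => ?_) i1 i3 hw2
        fun w3 a3 t3 hF3 hlab hcnt hw3 g1 ht3 => ?_
      · rcases i2 v hv with h' | h' <;> omega
      have e1 : ∀ v < n, a3 1 v = 0 ↔ ¬ Cp n A u u' r v ∧ a2 1 v = 0 := fun v hv => by
        rw [hlab v hv]; split_ifs with h <;> simp [h]
      refine ⟨(hF3.var 4 (by decide)).trans hr4, (hF2.trans (hF3.mono (by decide)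
        (by decide))).set (by decide), hw3.congr (by simp), fun h => ?_, fun v hv h => ?_,
        fun v hv => ?_, fun v hv h z hz hzu => ?_, fun v hv => ?_, fun v hv hvu h ht => ?_, ?_⟩
      · simpa using g1 (.inl (m1 h))
      · exact i1 v hv ((e1 v hv).1 h).2
      · show a3 1 v ≤ r + 1 ∨ a3 1 v = n + 1
        rw [hlab v hv]
        split_ifs
        · exact .inl le_rfl
        · exact (i2 v hv).imp (fun h => by omega) id
      · obtain ⟨h5, h6⟩ := (e1 v hv).1 h
        have h7 := i3 v hv h6 z hz hzu
        refine (e1 z hzu.1).2 ⟨fun h8 => h5 ?_, h7⟩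
        exact ReflTransGen.tail h8 ⟨B.symm hz, i1 v hv h6⟩
      · show a3 1 v ≠ 0
        rw [Ne, e1 v (by omega)]
        rintro ⟨h5, h6⟩
        rcases Nat.lt_succ_iff_lt_or_eq.1 hv with h' | rfl
        · exact i4 v h' h6
        · exact h5 (Cp.self _ _ _)
      · show Function.update w3 4 (r + 1) 1 = 1
        rw [Function.update_of_ne (by decide)]
        refine g1 ?_
        by_cases hC : Cp n A u u' r v
        · exact .inr (ht.root B hru hC)
        · refine .inl (i5 v hv hvu (fun h6 => h ?_) ht)
          exact (e1 v hv).2 ⟨hC, h6⟩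
      · rw [Finset.sum_range_succ, hcnt]
        simp only [mul_add, add_mul] at ht2 ht3 ⊢
        omega
    · refine ⟨trivial, hF2.set (by decide), hw2.congr (by simp), fun h => by simpa using m1 h, i1,
        fun v hv => (i2 v hv).imp (fun h => by omega) id, i3, fun v hv => ?_,
        fun v hv hvu h ht => by simpa using i5 v hv hvu h ht, ?_⟩
      · rcases Nat.lt_succ_iff_lt_or_eq.1 hv with h' | rfl
        · exact i4 v h'
        · exact h0
      · rw [Finset.sum_range_succ]
        simp only [mul_add, add_mul] at ht2 ⊢
        omega
  · rintro w2 a2 t2 hn2 - ⟨hF2, hw2, m1, i1, i2, i3, i4, i5, ht2⟩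
    simp only at hF2 hw2 m1 i1 i2 i3 i4 i5 ht2
    refine hQ _ _ _ hF2 hw2 ?_ ?_
    · rintro (h | ⟨r, h⟩)
      · exact m1 h
      · have hr := h.1.un
        exact i5 r hr.1 hr (i4 r hr.1) h
    · have h5 : Nat.count (fun v => a2 1 v ≠ 0) n ≤ n := Nat.count_le _
      have h6 := Nat.mul_le_mul_left (200 * n + 100) h5
      simp only [add_mul, mul_assoc] at ht2 h6 ⊢
      omega

/-- Search for a perfect matching-cut one class of which only consists of vertices that are matched
to the other class. -/
def pairsCmd : Cmd :=
  .for 2 (.when (.eq (.get 0 (.v 2)) (.c 1))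
    (.for 3 (.ite (.eq (.get 0 (.v 3)) (.c 1)) .skip pairCmd)))

open Classical in
theorem pairsCmd_spec (B : BG n A s) {w a t} {Q : St → Prop} (hs : ∀ v < n, a 0 v = 1 ↔ s v)
    (hw : Ans n A w)
    (hQ : ∀ w2 a2 t2, Fr (2 :: 3 :: 4 :: compVars) compArrs w a w2 a2 → Ans n A w2 →
      ((w 1 = 1 ∨ ∃ u < n, ∃ u' < n, ∃ r, s u ∧ ¬ s u' ∧ Test n A s u u' r) → w2 1 = 1) →
      t2 ≤ t + 10000 * n ^ 4 + 10 → Q ⟨w2, a2, t2⟩) :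
    wp n A pairsCmd Q ⟨w, a, t⟩ := by
  set D : ℕ → ℕ → ℕ := fun u u' => 2000 * (n * n) + 2000 * n + 150 +
        (200 * n + 200) * ∑ r ∈ Finset.range n, testCost n A s u u' r with hD
  refine wp_for_sum (by decide) (fun i w' a' => Fr (2 :: 3 :: 4 :: compVars) compArrs w a w' a' ∧
    Ans n A w' ∧ (w 1 = 1 → w' 1 = 1) ∧
    ∀ u < i, ∀ u' < n, ∀ r, s u → ¬ s u' → Test n A s u u' r → w' 1 = 1)
    (fun u => ∑ u' ∈ Finset.range n, (D u u' + 5) + 50) ?_ ?_ ?_ ?_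
  · rintro i w a y ⟨h, h2⟩
    exact ⟨h.set (by decide), by simpa [Ans] using h2⟩
  · exact ⟨Fr.rfl, hw, id, by simp⟩
  · rintro u w1 a1 t1 hu hn1 hu2 ⟨hF, hw1, m1, h1⟩
    simp only [wp_when]
    simp only [Cn.eq_ok, Cn.eq_holds, Cn.eq_cost, Ex.Ok, Ex.eval, Ex.cost, hu2,
      hF.arr 0 (by decide), hs u hu]
    refine ⟨⟨⟨trivial, by decide⟩, by omega⟩, fun su => ?_, fun su => ⟨trivial, ⟨hF, hw1, m1,
      fun v hv v' hv' r sv sv' ht => ?_⟩, by omega⟩⟩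
    swap
    · rcases Nat.lt_succ_iff_lt_or_eq.1 hv with h' | rfl
      · exact h1 v h' v' hv' r sv sv' ht
      · exact absurd sv su
    refine wp_for_sum (by decide) (fun i w' a' => Fr (3 :: 4 :: compVars) compArrs w1 a1 w' a' ∧
      Ans n A w' ∧ (w1 1 = 1 → w' 1 = 1) ∧
      ∀ u' < i, ∀ r, ¬ s u' → Test n A s u u' r → w' 1 = 1) (D u) ?_ ?_ ?_ ?_
    · rintro i w a y ⟨h, h2⟩
      exact ⟨h.set (by decide), by simpa [Ans] using h2⟩
    · exact ⟨Fr.rfl, hw1, id, by simp⟩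
    · rintro u' w2 a2 t2 hu' hn2 hu3 ⟨hF2, hw2, m2, h2⟩
      have e0 : a2 0 = a 0 := (hF2.arr 0 (by decide)).trans (hF.arr 0 (by decide))
      simp only [wp_ite, wp_skip]
      simp only [Cn.eq_ok, Cn.eq_holds, Cn.eq_cost, Ex.Ok, Ex.eval, Ex.cost, hu3, e0, hs u' hu']
      refine ⟨⟨⟨trivial, by decide⟩, by omega⟩, fun su' => ⟨trivial, ⟨hF2, hw2, m2,
        fun v hv r sv ht => ?_⟩, by simp only [hD]; omega⟩, fun su' => ?_⟩
      · rcases Nat.lt_succ_iff_lt_or_eq.1 hv with h' | rfl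
        · exact h2 v h' r sv ht
        · exact absurd su' sv
      · refine pairCmd_spec B hu hu' ((hF2.var 2 (by decide)).trans hu2) hu3
          (by rw [e0]; exact hs) su su' hw2 fun w3 a3 t3 hF3 hw3 g3 ht3 => ?_
        refine ⟨(hF3.var 3 (by decide)).trans hu3, ⟨hF2.trans (hF3.mono (by decide) (by decide)),
          hw3, fun h => g3 (.inl (m2 h)), fun v hv r sv ht => ?_⟩, ?_⟩
        · rcases Nat.lt_succ_iff_lt_or_eq.1 hv with h' | rfl
          · exact g3 (.inl (h2 v h' r sv ht))
          · exact g3 (.inr ⟨r, ht⟩)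
        · simp only [hD]
          omega
    · rintro w2 a2 t2 hn2 - ⟨hF2, hw2, m2, h2⟩ ht2
      refine ⟨(hF2.var 2 (by decide)).trans hu2, ⟨hF.trans (hF2.mono (by decide) (by decide)), hw2,
        fun h => m2 (m1 h), fun v hv v' hv' r sv sv' ht => ?_⟩, by show t2 ≤ _; omega⟩
      rcases Nat.lt_succ_iff_lt_or_eq.1 hv with h' | rfl
      · exact m2 (h1 v h' v' hv' r sv sv' ht)
      · exact h2 v' hv' r sv' ht
  · rintro w1 a1 t1 hn1 - ⟨hF, hw1, m1, h1⟩ ht1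
    refine hQ _ _ _ hF hw1 ?_ (ht1.trans ?_)
    · rintro (h | ⟨u, hu, u', hu', r, su, su', ht⟩)
      · exact m1 h
      · exact h1 u hu u' hu' r su su' ht
    · have hsum := sum_testCost_le B
      simp only [hD, Finset.sum_add_distrib, ← Finset.mul_sum, Finset.sum_const, Finset.card_range,
        smul_eq_mul]
      have h2 := Nat.mul_le_mul_left (200 * n + 200) hsum
      rcases Nat.eq_zero_or_pos n with rfl | hn
      · simp
      have p1 : n ≤ n * n := Nat.le_mul_self n
      have p2 : n * n ≤ n ^ 3 := by nlinarith
      have p3 : n ^ 3 ≤ n ^ 4 := Nat.pow_le_pow_right hn (by decide)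
      ring_nf at h2 p1 p2 p3 ⊢
      omega

end PMCut


/-! ### The decision procedure. -/

namespace PMCut

section Algorithm
variable {n : ℕ} {A : ℕ → ℕ → Prop} {s : ℕ → Prop}

/-- The decision procedure; the answer is left in variable `1`. -/
def mainCmd : Cmd :=
  .ite (.eq (.v 0) (.c 2)) (.when (.adj (.c 0) (.c 1)) (.set 1 (.c 1)))
    (sideCmd ;; pairsCmd ;; fullCmd)

/-- Two vertices are the exception in `cut_cases`: no matching edge lies inside a class, and `0` has
no second neighbour. -/
theorem hasCut_two (B : BG 2 A s) : HasCut 2 A ↔ A 0 1 := by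
  constructor
  · rintro ⟨m, a, h⟩
    have h0 := h.adj 0 (by decide)
    have h1 := B.lt' h0
    have h2 : m 0 ≠ 0 := fun h => by
      rw [h] at h0
      have := B.bip h0
      tauto
    obtain h3 : m 0 = 1 := by omega
    rwa [h3] at h0
  · intro h
    refine ⟨fun v => 1 - v, id, fun v hv => ?_, fun v hv => ?_, fun {u v} h1 h2 => ?_,
      0, by decide, 1, by decide, by decide⟩
    · interval_cases v
      · exact h
      · exact B.symm h
    · omega
    · have := B.lt h1
      have := B.lt' h1
      simp only [id] at h2 ⊢
      omega

theorem mainCmd_spec (B : BG n A s) (hn : 0 < n)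
    (hs : ∀ v < n, s v ↔ v = 0 ∨ ∃ z < n, A 0 z ∧ A z v) {w a} {Q : St → Prop} (h0 : w 0 = n)
    (h1 : w 1 = 0)
    (hQ : ∀ w' a' t', (HasCut n A → w' 1 = 1) → (¬ HasCut n A → w' 1 = 0) →
      t' ≤ 2000000 * n ^ 4 → Q ⟨w', a', t'⟩) :
    wp n A mainCmd Q ⟨w, a, 0⟩ := by
  simp only [mainCmd, wp_ite, wp_when, wp_set]
  simp only [Cn.eq_ok, Cn.eq_holds, Cn.eq_cost, Cn.adj_ok, Cn.adj_holds, Cn.adj_cost, Ex.Ok,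
    Ex.eval, Ex.cost, h0]
  have hn4 : n ≤ n ^ 4 := Nat.le_self_pow (by decide) n
  refine ⟨⟨trivial, by omega⟩, fun h2 => ?_, fun h2 => ?_⟩
  · subst h2
    refine ⟨⟨by omega, by omega, by omega, by omega⟩, fun hA => ⟨by decide, by omega, ?_⟩,
      fun hA => ?_⟩
    · exact hQ _ _ _ (fun _ => by simp) (fun h => absurd ((hasCut_two B).2 hA) h) (by norm_num)
    · exact hQ _ _ _ (fun h => absurd ((hasCut_two B).1 h) hA) (fun _ => h1) (by norm_num)
  · simp only [wp_seq]
    refine sideCmd_spec hn fun w1 a1 t1 hF1 hside ht1 => ?_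
    have hside' : ∀ v < n, a1 0 v = 1 ↔ s v := fun v hv => by rw [(hside v hv).2, hs v hv]
    have hw1 : Ans n A w1 := .inl ((hF1.var 1 (by decide)).trans h1)
    refine pairsCmd_spec B hside' hw1 fun w2 a2 t2 hF2 hw2 g2 ht2 => ?_
    refine fullCmd_spec B hn hw2 fun w3 a3 t3 hF3 hw3 g3 ht3 => ?_
    refine hQ _ _ _ (fun h => ?_) (fun h => ?_) ?_
    · refine g3 ((cut_cases B hn h2 h).imp ?_ id)
      rintro ⟨u, hu, u', hu', r, su, su', ht⟩
      exact g2 (.inr ⟨u, hu, u', hu', r, su, su', ht⟩)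
    · exact hw3.resolve_right fun h' => h h'.2
    · have p1 : n * n ≤ n ^ 4 := by
        rw [← pow_two]; exact Nat.pow_le_pow_right hn (by decide)
      omega

end Algorithm

/-! ### From graphs on `Fin n` to relations on natural numbers. -/

section Graph
variable {n : ℕ} (G : SimpleGraph (Fin n))

/-- The adjacency relation of a graph on `Fin n`, as a relation on natural numbers. -/
def natAdj (i j : ℕ) : Prop := ∃ (hi : i < n) (hj : j < n), G.Adj ⟨i, hi⟩ ⟨j, hj⟩

variable {G}

theorem natAdj_val {i j : Fin n} : natAdj G i j ↔ G.Adj i j :=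
  ⟨fun ⟨_, _, h⟩ => h, fun h => ⟨i.2, j.2, h⟩⟩

theorem bool_eq_iff_of_ne : ∀ {x y : Bool} (z : Bool), x ≠ y → (x = z ↔ ¬ y = z) := by decide

theorem bool_eq_of_iff : ∀ {x y z : Bool}, (x = z ↔ y = z) → x = y := by decide

/-- A walk of length at most 3 between vertices of the same colour has even length; length 0 is
excluded by `huv`, so it has length 2. -/
theorem common_neighbour (c : G.Coloring Bool) (hd : G.ediam ≤ 3) {u v : Fin n} (huv : u ≠ v)
    (hc : c u = c v) : ∃ z, G.Adj u z ∧ G.Adj z v := by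
  have h3 : G.edist u v ≤ 3 := SimpleGraph.edist_le_ediam.trans hd
  obtain ⟨p, hp⟩ := SimpleGraph.exists_walk_of_edist_ne_top
    (ne_top_of_le_ne_top (by decide) h3)
  have h4 : p.length ≤ 3 := by
    rw [← hp] at h3
    exact_mod_cast h3
  have h5 := (c.even_length_iff_congr p).2 (by rw [hc])
  match p, h4, h5 with
  | .nil, _, _ => exact absurd rfl huv
  | .cons _ .nil, _, h => simp at h
  | .cons h (.cons h' .nil), _, _ => exact ⟨_, h, h'⟩
  | .cons _ (.cons _ (.cons _ .nil)), _, h => exact absurd h (by simp; decide)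
  | .cons _ (.cons _ (.cons _ (.cons _ p))), h, _ => simp at h; omega

theorem bg_natAdj (hn : 0 < n) (hb : G.IsBipartite) (hd : G.ediam ≤ 3) :
    BG n (natAdj G) fun v => v = 0 ∨ ∃ z < n, natAdj G 0 z ∧ natAdj G z v := by
  obtain ⟨c⟩ : Nonempty (G.Coloring Bool) := by
    obtain ⟨c⟩ := hb
    exact ⟨G.recolorOfEquiv finTwoEquiv c⟩
  -- The side that the program computes, the vertices at most two steps away from `0`, is a colour
  -- class.
  have key : ∀ v (hv : v < n), (v = 0 ∨ ∃ z < n, natAdj G 0 z ∧ natAdj G z v) ↔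
      c ⟨v, hv⟩ = c ⟨0, hn⟩ := by
    intro v hv
    constructor
    · rintro (rfl | ⟨z, hz, ⟨_, _, h1⟩, ⟨_, _, h2⟩⟩)
      · rfl
      · exact (bool_eq_iff_of_ne _ (c.valid h2).symm).2 (c.valid h1).symm
    · intro h
      by_cases h0 : v = 0
      · exact .inl h0
      · obtain ⟨z, h1, h2⟩ := common_neighbour c hd (u := ⟨0, hn⟩) (v := ⟨v, hv⟩)
          (by simpa [Fin.ext_iff] using Ne.symm h0) h.symm
        exact .inr ⟨z, z.2, ⟨hn, z.2, h1⟩, ⟨z.2, hv, h2⟩⟩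
  refine ⟨fun ⟨hi, hj, h⟩ => ⟨hj, hi, h.symm⟩, fun h => h.1, ?_, fun {i j} hi hj hij hs => ?_⟩
  · rintro i j ⟨hi, hj, h⟩
    rw [key i hi, key j hj]
    exact bool_eq_iff_of_ne _ (c.valid h)
  · rw [key i hi, key j hj] at hs
    obtain ⟨z, h1, h2⟩ := common_neighbour c hd (u := ⟨i, hi⟩) (v := ⟨j, hj⟩)
      (by simpa [Fin.ext_iff] using hij) (bool_eq_of_iff hs)
    exact ⟨z, ⟨hi, z.2, h1⟩, ⟨z.2, hj, h2⟩⟩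

/-- A colouring whose bichromatic edges lie in the matching is constant on the components of the
remaining graph. Conversely, if `p` does not reach `q` there, the vertices reachable from `p` form a
class. -/
theorem hasCut_natAdj (hn : 0 < n) : HasCut n (natAdj G) ↔ G.HasPerfectMatchingCut := by
  classical
  have : Nonempty (Fin n) := ⟨⟨0, hn⟩⟩
  constructor
  · rintro ⟨m, a, h⟩
    let M : G.Subgraph :=
      { verts := Set.univ
        Adj := fun u v => m u = v
        adj_sub := fun {u v} huv => by
          have := h.adj u u.2
          rw [huv] at this
          exact natAdj_val.1 this
        edge_vert := fun _ => trivial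
        symm := ⟨fun u v huv => by rw [← huv]; exact h.inv u u.2⟩ }
    refine ⟨M, ?_, fun hcon => ?_⟩
    · rw [SimpleGraph.Subgraph.isPerfectMatching_iff]
      intro v
      obtain ⟨-, hm, -⟩ := h.adj v v.2
      exact ⟨⟨m v, hm⟩, rfl, fun y (hy : m v = y) => Fin.ext hy.symm⟩
    · obtain ⟨p, hp, q, hq, hpq⟩ := h.nonconst
      refine hpq ?_
      obtain ⟨W⟩ := hcon.preconnected ⟨p, hp⟩ ⟨q, hq⟩
      have key : ∀ {x y : Fin n}, (G.deleteEdges M.edgeSet).Walk x y → a x = a y := by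
        intro x y W
        induction W with
        | nil => rfl
        | cons hxy _ ih =>
          rw [← ih]
          rw [SimpleGraph.deleteEdges_adj] at hxy
          by_contra hne
          exact hxy.2 (SimpleGraph.Subgraph.mem_edgeSet.2 (h.cross (natAdj_val.2 hxy.1) hne))
      exact key W
  · rintro ⟨M, hM, hcon⟩
    rw [SimpleGraph.Subgraph.isPerfectMatching_iff] at hM
    have : ¬ (G.deleteEdges M.edgeSet).Preconnected := fun h => hcon ⟨h⟩
    simp only [SimpleGraph.Preconnected, not_forall] at this
    obtain ⟨p, q, hpq⟩ := this
    refine HasCut.of_rel (R := fun u v => ∃ (hu : u < n) (hv : v < n), M.Adj ⟨u, hu⟩ ⟨v, hv⟩)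
      (a := fun v => if ∃ hv : v < n, (G.deleteEdges M.edgeSet).Reachable p ⟨v, hv⟩ then 1 else 0)
      (fun ⟨hu, hv, h⟩ => ⟨hv, hu, h.symm⟩) (fun ⟨hu, hv, h⟩ => ⟨hu, hv, M.adj_sub h⟩) ?_ ?_
      (fun h => h.1) ⟨p, p.2, q, q.2, ?_⟩
    · intro u hu
      obtain ⟨v, h1, h2⟩ := hM ⟨u, hu⟩
      exact ⟨v, ⟨hu, v.2, h1⟩, fun y ⟨_, hy, h⟩ => congrArg Fin.val (h2 ⟨y, hy⟩ h)⟩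
    · rintro u v ⟨hu, hv, h⟩ hne
      by_contra hM'
      have hadj : (G.deleteEdges M.edgeSet).Adj ⟨u, hu⟩ ⟨v, hv⟩ := by
        rw [SimpleGraph.deleteEdges_adj]
        exact ⟨h, fun h' => hM' ⟨hu, hv, SimpleGraph.Subgraph.mem_edgeSet.1 h'⟩⟩
      refine hne ?_
      congr 1
      refine propext ⟨fun ⟨_, h'⟩ => ⟨hv, h'.trans hadj.reachable⟩,
        fun ⟨_, h'⟩ => ⟨hu, h'.trans hadj.symm.reachable⟩⟩
    · rw [if_pos ⟨p.2, SimpleGraph.Reachable.refl _⟩, if_neg fun ⟨_, h⟩ => hpq h]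
      decide

theorem rep_encode : Rep n (natAdj G) (WordRAM.encode G) (Function.update (fun _ => 0) 0 n)
    fun _ _ => 0 where
  var x := by
    simp only [WordRAM.encode, Function.update_apply]
    congr 1
    simp
  size := by simp
  adj i j hi hj := by
    simp only [WordRAM.encode]
    congr 1
    refine propext ⟨?_, fun ⟨_, _, h⟩ => ⟨⟨i, hi⟩, ⟨j, hj⟩, h, rfl⟩⟩
    rintro ⟨u, v, huv, he⟩
    -- Row and column are recovered from `i * n + j` by division with remainder.
    have h1 : j = v := by
      have := congrArg (· % n) he
      simpa [Nat.mod_eq_of_lt hj, Nat.mod_eq_of_lt v.2] using this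
    have h2 : i = u := by
      rw [h1] at he
      exact Nat.eq_of_mul_eq_mul_right (by omega) (Nat.add_right_cancel he)
    subst h1 h2
    exact ⟨hi, hj, huv⟩
  arr b j hb := by
    simp only [WordRAM.encode]
    rw [if_neg]
    rintro ⟨u, v, -, he⟩
    have h1 : (u : ℕ) * n + v < n * n := by
      have := Nat.mul_le_mul_right n (Nat.succ_le_of_lt u.2)
      have h2 := v.2
      rw [Nat.succ_mul] at this
      omega
    omega
  var_le x := by
    rw [Function.update_apply]
    split_ifs <;> omega
  arr_le _ _ _ := Nat.zero_le _

end Graph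

end PMCut

theorem mainTheorem9 :
    ∃ (P : WordRAM.Prog) (C : ℝ),
      WordRAM.Decides P
        (fun _ G => G.IsBipartite ∧ G.ediam ≤ 3)
        (fun _ G => G.HasPerfectMatchingCut)
        (fun n => C * (n : ℝ) ^ (9 / 2 : ℝ)) := by
  -- Variable `1` lives in register `2`, and its value is moved to the answer register; this
  -- accounts for one more step than the bound for `mainCmd`. The value `200` for `K` is generous.
  refine ⟨.seq PMCut.mainCmd.code (.instr (.move 0 2)), 2000001, 200, ?_⟩
  rintro n G hn ⟨hb, hd⟩
  have B := PMCut.bg_natAdj hn hb hd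
  have hpow : n ^ 2 ≤ n ^ 200 := Nat.pow_le_pow_right hn (by decide)
  have hpow' : n ≤ n ^ 200 := Nat.le_self_pow (by decide) n
  have hW : n * n + (n + 9) * 16 + 16 ≤ 200 * n ^ 200 := by
    rw [pow_two] at hpow
    omega
  obtain ⟨t, s, ⟨w, a, t'⟩, hex, hrep, ht, h1, h2, h3⟩ := PMCut.wp_sound hW PMCut.mainCmd
    (Q := fun σ => (PMCut.HasCut n (PMCut.natAdj G) → σ.v 1 = 1) ∧
      (¬ PMCut.HasCut n (PMCut.natAdj G) → σ.v 1 = 0) ∧ σ.t ≤ 2000000 * n ^ 4)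
    (σ := ⟨_, _, 0⟩) PMCut.rep_encode
    (PMCut.mainCmd_spec B hn (fun v hv => Iff.rfl) rfl rfl
      fun w' a' t' h1 h2 h3 => ⟨h1, h2, h3⟩)
  simp only [zero_add] at ht h1 h2 h3
  have hr : s.reg 2 = w 1 := hrep.var 1
  refine ⟨t + 1, _, hex.seq (.instr (.move 0 2) s ?_), ?_, fun h => ?_, fun h => ?_⟩
  · have : w 1 ≤ n + 9 := hrep.var_le 1
    simp only [WordRAM.Instr.value]
    omega
  · have h4 : (t : ℝ) + 1 ≤ 2000001 * (n : ℝ) ^ 4 := by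
      have := Nat.one_le_pow 4 n hn
      have h5 : t + 1 ≤ 2000001 * n ^ 4 := by omega
      exact_mod_cast h5
    push_cast
    refine h4.trans (mul_le_mul_of_nonneg_left ?_ (by norm_num))
    rw [← Real.rpow_natCast]
    -- Here `n ≥ 1` and `4 ≤ 9 / 2`.
    exact Real.rpow_le_rpow_of_exponent_le (by exact_mod_cast hn) (by norm_num)
  · have := h1 ((PMCut.hasCut_natAdj hn).2 h)
    simp [WordRAM.Instr.apply, WordRAM.State.setReg, WordRAM.Instr.value, hr, this]
  · have := h2 fun h' => h ((PMCut.hasCut_natAdj hn).1 h')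
    simp [WordRAM.Instr.apply, WordRAM.State.setReg, WordRAM.Instr.value, hr, this]
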